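/- Let $m,k\ge 1$ be integers. The traffic rule $\mathcal R_{m,k}$ acts on states $\eta\in\{0,1\}^{\mathbb Z}$ of an infinite road ($1$ = car, $0$ = empty site): in one time step, simultaneously, in every maximal block of $x$ consecutive cars followed by a maximal block of $y$ empty sites, the last $\min\{k,x\}$ cars of the block move right by $\min\{m,y\}$ sites ($x,y$ may be infinite) and the other cars stay, i.e. $1^x0^y\to 1^{x-a}0^b1^a0^{y-b}$ with $a=\min\{k,x\}$, $b=\min\{m,y\}$. The velocity $v_i(\eta)$ is the number of sites by which a car at site $i$ moves in one step ($0$ if site $i$ is empty). The flow of a state $\eta$ (car density times average car velocity) is $J(\eta)=\lim_{N\to\infty}\frac1{2N+1}\sum_{i=-N}^{N}v_i(\eta)$, and the steady-state flow from an initial state $\eta_0$ with evolution $\eta_0,\eta_1,\eta_2,\dots$ is the time average $\phi=\lim_{T\to\infty}\frac1T\sum_{t=0}^{T-1}J(\eta_t)$. Let $0\le\rho\le1$ and let the initial state be random, the sites being independent and each occupied by a car with probability $\rho$. Then there is a constant $\phi=\phi(m,k,\rho)$ such that almost surely all the above limits exist and the steady-state flow equals $\phi$, and it satisfies $$\phi\le\min\{m\rho,\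 1,\ k(1-\rho)\},$$ the tighter upper limit $$\phi\le\min\{m\rho,\ 1-\rho^k(1-\rho)^m,\ k(1-\rho)\},$$ and the lower limit $$\phi\ge\min\bigl\{m\rho,\ \max\{1-\rho^k,\ 1-(1-\rho)^m\},\ k(1-\rho)\bigr\}.$$ -/

import Mathlib

open MeasureTheory ProbabilityTheory Filter Topology

namespace TrafficRule

/-- A state of the infinite road: `true` is a car (one), `false` an empty site (zero). -/
abbrev Road : Type := ℤ → Bool

/-- `gap η m j` is `min m y`, where `y` (possibly infinite) is the number of consecutive empty
sites `j, j + 1, …`. -/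
def gap (η : Road) : ℕ → ℤ → ℕ
  | 0, _ => 0
  | m + 1, j => if η j then 0 else gap η m (j + 1) + 1

/-- Number of sites by which the car at site `i` moves right in one step of the rule with
parameters `m` and `k`. It is nonzero only for the last `min k x` cars of a maximal block of `x`
cars, and these move by `min m y`, where `y` is the number of empty sites between the block and the
next one. The value is `0` when there is no car at `i`. -/
def velocity (η : Road) (m : ℕ) : ℕ → ℤ → ℕ
  | 0, _ => 0
  | k + 1, i =>
    if η i then (if η (i + 1) then velocity η m k (i + 1) else gap η m (i + 1)) else 0

open Classical in
/-- One synchronous step of the rule with parameters `m` and `k`: all cars move by their velocity.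
Equivalently, every maximal `1^x 0^y` is replaced by `1^(x-a) 0^b 1^a 0^(y-b)` with
`a = min k x` and `b = min m y`. -/
noncomputable def step (m k : ℕ) (η : Road) : Road := fun i =>
  decide (∃ j : ℤ, η j = true ∧ j + (velocity η m k j : ℤ) = i)

/-- The state `η` has flow `J`: the total velocity of the cars per site (that is, car density times
average car velocity) over the window `[-N, N]` converges to `J` as `N → ∞`. -/
def HasFlow (m k : ℕ) (η : Road) (J : ℝ) : Prop :=
  Tendsto (fun N : ℕ => (∑ i ∈ Finset.Icc (-(N : ℤ)) (N : ℤ), (velocity η m k i : ℝ)) /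
    (2 * (N : ℝ) + 1)) atTop (𝓝 J)

/-- The evolution started from `η` has (time-averaged) steady-state flow `φ`: at each time `t` the
state has a flow `J t`, and the averages of `J` over the first `T` time steps converge to `φ`. -/
def HasSteadyStateFlow (m k : ℕ) (η : Road) (φ : ℝ) : Prop :=
  ∃ J : ℕ → ℝ, (∀ t, HasFlow m k ((step m k)^[t] η) (J t)) ∧
    Tendsto (fun T : ℕ => (∑ t ∈ Finset.range T, J t) / (T : ℝ)) atTop (𝓝 φ)

/-- The law of the random infinite initial state of density `ρ`: the sites are independent, and
each is a car with probability `ρ`. -/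
noncomputable def initialLaw (ρ : unitInterval) : Measure Road :=
  Measure.infinitePi fun _ : ℤ => bernoulliMeasure true false ρ

end TrafficRule

namespace TrafficRule

/-! The proof identifies the flow as φ = min(mρ, ρ(1-ρ)/n, k(1-ρ)) for 0 < ρ < 1, where n is the
limiting density of fronts, that is, of bonds with a car on the left and a hole on the right.

One step has a simple effect between consecutive fronts z < z' (holes on [z,o), cars on [o,z')):
exactly one front results, except that two result when there are more than m holes facing more than
k cars, a split. So the front density increases by the split density (`frontDensity_succ`). Give the
bond u the car label X(u) and the hole label u - X(u). A new front then has the labels of the left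
front with m added to the hole label, or those of the right front with k subtracted from the car
label, or the car label of the left front and the hole label of the right one (`Alt.label`).

The number Φ of cars crossing bond 0 in T steps is estimated by tracing fronts back to the start.
For the upper bound, two fronts around 0 come from z ≤ z' with X(z) ≤ -Φ, z' - X(z') ≥ Φ and at most
T + 1 fronts in [z,z'). Since X(u) ≈ ρu, this gives Φ ≤ ρ(1-ρ)(z'-z) ≈ ρ(1-ρ)T/n_s at most, with n_s
the front density at the starting time s (`flux_upper`). For the lower bound, each step back is
accounted for by one more front between the traced ones, by a shift k of a car label, or by a shift
m of a hole label, apart from splits; these three are worth ρ(1-ρ)/n_s, k(1-ρ) and mρ in flux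
(`flux_lower`). The splits concerned lie in a window of length 2RT, and their mean number per unit
time is at most 2R(n - n_s), which is negligible when s is late. The bounds mρ and k(1-ρ) from above
hold at each time separately. This proves `tendsto_meanFlow`.

It remains to estimate n. A block of (t+1)m+1 holes facing (t+1)k+1 cars produces a split at time t,
which bounds n below by a geometric series (`le_frontDensity`). Giving a front with a cars behind it
the weight ⌈a/k⌉ yields a total that does not increase; the mirror weight ⌈b/m⌉ for holes behaves
alike. These bound n above (`frontDensity_le_carRuns`, `frontDensity_le_holeRuns`).

Randomness enters only through the strong law for local functions (`ae_hasDensity`): almost surely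
every local quantity has its mean as spatial density, and the rest is deterministic. -/

/-! ### Velocities and one step near a front. -/

theorem gap_le (η : Road) (m : ℕ) (j : ℤ) : gap η m j ≤ m := by
  induction m generalizing j with
  | zero => simp [gap]
  | succ m ih =>
    have := ih (j + 1)
    unfold gap
    split_ifs <;> omega

theorem gap_holes (η : Road) (m : ℕ) (j i : ℤ) (h1 : j ≤ i) (h2 : i < j + gap η m j) :
    η i = false := by
  induction m generalizing j with
  | zero => simp [gap] at h2; omega
  | succ m ih =>
    unfold gap at h2
    split_ifs at h2 with h
    · simp at h2; omega
    · rcases h1.eq_or_lt with rfl | h3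
      · simpa using h
      · exact ih (j + 1) (by omega) (by push_cast at h2; omega)

theorem gap_eq (η : Road) (m b : ℕ) (j : ℤ) (hbm : b ≤ m)
    (hh : ∀ i, j ≤ i → i < j + b → η i = false) (hb : b = m ∨ η (j + b) = true) :
    gap η m j = b := by
  induction m generalizing j b with
  | zero => simp [gap]; omega
  | succ m ih =>
    unfold gap
    rcases b with _ | b
    · rcases hb with hb | hb
      · omega
      · simp at hb; simp [hb]
    · have h0 : η j = false := hh j le_rfl (by push_cast; omega)
      rw [if_neg (by simp [h0]), ih b (j + 1) (by omega)]
      · intro i h1 h2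
        exact hh i (by omega) (by push_cast; omega)
      · rcases hb with hb | hb
        · left; omega
        · right; rw [← hb]; congr 1; push_cast; ring

theorem velocity_of_hole (η : Road) (m k : ℕ) (i : ℤ) (h : η i = false) :
    velocity η m k i = 0 := by
  cases k <;> simp [velocity, h]

theorem velocity_eq_gap (η : Road) (m k l : ℕ) (i : ℤ) (hl : l < k)
    (hc : ∀ j, i ≤ j → j ≤ i + l → η j = true) (hh : η (i + l + 1) = false) :
    velocity η m k i = gap η m (i + l + 1) := by
  induction k generalizing l i with
  | zero => omega
  | succ k ih =>
    have h0 := hc i le_rfl (by omega)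
    rcases l with _ | l
    · simp at hh
      simp [velocity, h0, hh]
    · have h1 := hc (i + 1) (by omega) (by push_cast; omega)
      have e : i + 1 + (l : ℤ) + 1 = i + ((l + 1 : ℕ) : ℤ) + 1 := by push_cast; ring
      rw [velocity, if_pos h0, if_pos h1, ih l (i + 1) (by omega), e]
      · intro j h2 h3; exact hc j (by omega) (by push_cast; omega)
      · rw [e, hh]

theorem velocity_eq_zero (η : Road) (m k : ℕ) (i : ℤ)
    (hc : ∀ j, i ≤ j → j ≤ i + k → η j = true) : velocity η m k i = 0 := by
  induction k generalizing i with
  | zero => simp [velocity]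
  | succ k ih =>
    have h0 := hc i le_rfl (by omega)
    have h1 := hc (i + 1) (by omega) (by push_cast; omega)
    rw [velocity, if_pos h0, if_pos h1, ih (i + 1)]
    intro j h2 h3
    exact hc j (by omega) (by push_cast; omega)

theorem velocity_le (η : Road) (m k : ℕ) (i : ℤ) : velocity η m k i ≤ m := by
  induction k generalizing i with
  | zero => simp [velocity]
  | succ k ih =>
    unfold velocity
    split_ifs
    · exact ih _
    · exact gap_le ..
    · omega

/-- A moving car is among the last `k` of its block, and passes only empty sites after it. -/
theorem exists_of_velocity_pos (η : Road) (m k : ℕ) (i : ℤ) (h : 0 < velocity η m k i) :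
    ∃ l : ℕ, l < k ∧ (∀ j, i ≤ j → j ≤ i + l → η j = true) ∧ η (i + l + 1) = false ∧
      ∀ j, i + l + 1 ≤ j → j < i + l + 1 + velocity η m k i → η j = false := by
  suffices H : ∃ l : ℕ, l < k ∧ (∀ j, i ≤ j → j ≤ i + l → η j = true) ∧ η (i + l + 1) = false by
    obtain ⟨l, h1, h2, h3⟩ := H
    refine ⟨l, h1, h2, h3, ?_⟩
    rw [velocity_eq_gap η m k l i h1 h2 h3]
    intro j h4 h5
    exact gap_holes η m _ j h4 h5
  induction k generalizing i with
  | zero => simp [velocity] at h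
  | succ k ih =>
    unfold velocity at h
    split_ifs at h with h0 h1
    · obtain ⟨l, h3, h4, h5⟩ := ih (i + 1) h
      refine ⟨l + 1, by omega, ?_, ?_⟩
      · intro j h6 h7
        rcases h6.eq_or_lt with rfl | h8
        · exact h0
        · exact h4 j (by omega) (by push_cast at h7; omega)
      · rw [← h5]; congr 1; push_cast; ring
    · refine ⟨0, by omega, ?_, by simpa using h1⟩
      intro j h6 h7
      have : j = i := by simp at h7; omega
      rw [this]; exact h0
    · omega

theorem step_eq_true (m k : ℕ) (η : Road) (u : ℤ) :
    step m k η u = true ↔ ∃ j : ℤ, η j = true ∧ j + (velocity η m k j : ℤ) = u := by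
  simp [step]

theorem not_true_of_false {b : Bool} (h : b = false) : ¬ b = true := by simp [h]

theorem step_hole (m k : ℕ) (η : Road) (u : ℤ) (h : ∀ i, u - m ≤ i → i ≤ u → η i = false) :
    step m k η u = false := by
  rw [← Bool.not_eq_true, step_eq_true]
  rintro ⟨j, hj, e⟩
  have := velocity_le η m k j
  have := h j (by omega) (by omega)
  simp [this] at hj

theorem step_car (m k : ℕ) (η : Road) (u : ℤ) (h : ∀ i, u ≤ i → i ≤ u + k → η i = true) :
    step m k η u = true := by
  rw [step_eq_true]
  exact ⟨u, h u le_rfl (by omega), by rw [velocity_eq_zero η m k u h]; simp⟩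

theorem velocity_before_front (m k a b : ℕ) (η : Road) (z j : ℤ) (hak : a ≤ k)
    (hcar : ∀ i, z - a ≤ i → i < z → η i = true) (hb1 : 1 ≤ b) (hbm : b ≤ m)
    (hhole : ∀ i, z ≤ i → i < z + b → η i = false) (hb : b = m ∨ η (z + b) = true)
    (h1 : z - a ≤ j) (h2 : j < z) : velocity η m k j = b := by
  obtain ⟨l, rfl⟩ : ∃ l : ℕ, j = z - 1 - l := ⟨(z - 1 - j).toNat, by omega⟩
  have e : z - 1 - (l : ℤ) + l + 1 = z := by ring
  rw [velocity_eq_gap η m k l (z - 1 - l) (by omega)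
    (fun i h3 h4 => hcar i (by omega) (by omega)) (by rw [e]; exact hhole z le_rfl (by omega)), e]
  exact gap_eq η m b z hbm hhole hb

/-- The last a cars move together by b, vacating the first b sites of the window. No car from the
left of z - a can land there: either its own block ends earlier and it would pass over the car at z
- a, or it belongs to the block of z - 1 and is more than k cars from its end. -/
theorem step_front (m k a b : ℕ) (η : Road) (z u : ℤ) (ha1 : 1 ≤ a) (hak : a ≤ k)
    (hcar : ∀ i, z - a ≤ i → i < z → η i = true) (ha : a = k ∨ η (z - a - 1) = false)
    (hb1 : 1 ≤ b) (hbm : b ≤ m)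
    (hhole : ∀ i, z ≤ i → i < z + b → η i = false) (hb : b = m ∨ η (z + b) = true)
    (h1 : z - a ≤ u) (h2 : u < z + b) :
    step m k η u = true ↔ z - a + b ≤ u := by
  have hv : ∀ j, z - a ≤ j → j < z → velocity η m k j = b := fun j h1 h2 =>
    velocity_before_front m k a b η z j hak hcar hb1 hbm hhole hb h1 h2
  rw [step_eq_true]
  constructor
  · rintro ⟨j, hj, e⟩
    by_contra hlt
    have hjz : j < z + b := by omega
    have hjz' : j < z := by
      by_contra h3
      exact not_true_of_false (hhole j (by omega) hjz) hj
    rcases lt_or_ge j (z - a) with h3 | h3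
    · have hpos : 0 < velocity η m k j := by omega
      obtain ⟨l, hl, hc, hh, hg⟩ := exists_of_velocity_pos η m k j hpos
      rcases lt_or_ge (j + l + 1) z with h4 | h4
      · have h5 : j + l + 1 < z - a := by
          by_contra h6
          exact not_true_of_false hh (hcar _ (by omega) h4)
        have := hg (z - a) (by omega) (by omega)
        exact not_true_of_false this (hcar _ le_rfl (by omega))
      · have h5 : j + l < z := by
          by_contra h6
          exact not_true_of_false (hhole z le_rfl (by omega)) (hc z (by omega) (by omega))
        rcases ha with ha | ha
        · omega
        · exact not_true_of_false ha (hc _ (by omega) (by omega))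
    · have := hv j h3 hjz'
      omega
  · intro h3
    exact ⟨u - b, hcar _ (by omega) (by omega), by rw [hv _ (by omega) (by omega)]; ring⟩

/-- Cars never collide. -/
theorem move_injective (m k : ℕ) (η : Road) (i j : ℤ) (hi : η i = true) (hj : η j = true)
    (h : i + (velocity η m k i : ℤ) = j + velocity η m k j) : i = j := by
  have key : ∀ i j : ℤ, η i = true → η j = true →
      i + (velocity η m k i : ℤ) = j + velocity η m k j → ¬ i < j := by
    intro i j hi hj h hlt
    obtain ⟨l, hl, hc, hh, hg⟩ := exists_of_velocity_pos η m k i (by omega)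
    -- Moving cars of one block have equal velocities; a car from an earlier block would have to
    -- pass over the occupied site j.
    rcases le_or_gt j (i + l) with h1 | h1
    · obtain ⟨d, rfl⟩ : ∃ d : ℕ, j = i + d := ⟨(j - i).toNat, by omega⟩
      have e : i + (d : ℤ) + ((l - d : ℕ) : ℤ) + 1 = i + l + 1 := by omega
      have h2 := velocity_eq_gap η m k l i hl hc hh
      have h3 := velocity_eq_gap η m k (l - d) (i + d) (by omega)
        (fun x h4 h5 => hc x (by omega) (by omega)) (by rw [e]; exact hh)
      rw [e] at h3
      omega
    · exact not_true_of_false (hg j (by omega) (by omega)) hj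
  exact le_antisymm (not_lt.1 (key j i hj hi h.symm)) (not_lt.1 (key i j hi hj h))

/-! ### Conservation of cars. -/

/-- The number of cars that cross the bond between `z - 1` and `z` in one step. -/
def crossings (m k : ℕ) (η : Road) (z : ℤ) : ℤ :=
  ∑ d ∈ Finset.range m, if d + 1 ≤ velocity η m k (z - 1 - d) then 1 else 0

/-- Occupation number of the site `i`. -/
def occ (η : Road) (i : ℤ) : ℤ := if η i then 1 else 0

theorem crossings_nonneg (m k : ℕ) (η : Road) (z : ℤ) : 0 ≤ crossings m k η z :=
  Finset.sum_nonneg fun _ _ => by split_ifs <;> simp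

theorem crossings_le (m k : ℕ) (η : Road) (z : ℤ) : crossings m k η z ≤ m := by
  calc crossings m k η z ≤ ∑ d ∈ Finset.range m, 1 :=
        Finset.sum_le_sum fun _ _ => by split_ifs <;> simp
    _ = m := by simp

theorem crossings_succ (m k : ℕ) (η : Road) (z : ℤ) :
    crossings m k η (z + 1) = (if 1 ≤ velocity η m k z then 1 else 0) +
      ∑ d ∈ Finset.range m, if d + 2 ≤ velocity η m k (z - 1 - d) then 1 else 0 := by
  -- The sum may be extended by the term d = m, which would need a velocity m + 1; afterwards the
  -- two sums match under d ↦ d + 1.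
  have h : (∑ d ∈ Finset.range (m + 1),
      if d + 1 ≤ velocity η m k (z + 1 - 1 - (d : ℕ)) then (1 : ℤ) else 0)
      = crossings m k η (z + 1) := by
    rw [Finset.sum_range_succ, if_neg, add_zero]
    · rfl
    · have := velocity_le η m k (z + 1 - 1 - m)
      omega
  rw [← h, Finset.sum_range_succ', add_comm]
  congr 1
  · simp
  · refine Finset.sum_congr rfl fun d _ => ?_
    have : z + 1 - 1 - ((d + 1 : ℕ) : ℤ) = z - 1 - d := by push_cast; ring
    rw [this]

/-- The difference of the two crossing numbers counts the cars that land exactly on z from the left,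
minus the car leaving z. By `move_injective` at most one car ends at z. -/
theorem occ_step (m k : ℕ) (η : Road) (z : ℤ) :
    occ (step m k η) z = occ η z + crossings m k η z - crossings m k η (z + 1) := by
  have h1 : crossings m k η z - ∑ d ∈ Finset.range m,
      (if d + 2 ≤ velocity η m k (z - 1 - d) then (1 : ℤ) else 0)
      = ∑ d ∈ Finset.range m, if velocity η m k (z - 1 - d) = d + 1 then (1 : ℤ) else 0 := by
    rw [crossings, ← Finset.sum_sub_distrib]
    refine Finset.sum_congr rfl fun d _ => ?_
    split_ifs <;> omega
  have hcar : ∀ i : ℤ, 0 < velocity η m k i → η i = true := by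
    intro i hi
    by_contra h
    rw [velocity_of_hole η m k i (by simpa using h)] at hi
    omega
  rw [crossings_succ]
  by_cases hz : step m k η z = true
  · obtain ⟨j, hj, e⟩ := (step_eq_true m k η z).1 hz
    have hocc : occ (step m k η) z = 1 := by simp [occ, hz]
    by_cases hjz : j = z
    · subst hjz
      have h2 : ∑ d ∈ Finset.range m,
          (if velocity η m k (j - 1 - d) = d + 1 then (1 : ℤ) else 0) = 0 := by
        refine Finset.sum_eq_zero fun d _ => if_neg fun h => ?_
        have := move_injective m k η (j - 1 - d) j (hcar _ (by omega)) hj (by omega)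
        omega
      have h3 : occ η j = 1 := by simp [occ, hj]
      rw [if_neg (by omega)]
      omega
    · have hv := velocity_le η m k j
      have h2 : ∑ d ∈ Finset.range m,
          (if velocity η m k (z - 1 - d) = d + 1 then (1 : ℤ) else 0) = 1 := by
        rw [Finset.sum_eq_single (velocity η m k j - 1)]
        · rw [if_pos]
          have : z - 1 - ((velocity η m k j - 1 : ℕ) : ℤ) = j := by omega
          rw [this]; omega
        · intro d _ hd
          refine if_neg fun h => hd ?_
          have := move_injective m k η (z - 1 - d) j (hcar _ (by omega)) hj (by omega)
          rw [← this]; omega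
        · intro h
          rw [Finset.mem_range] at h
          omega
      by_cases h3 : η z = true
      · have h4 : occ η z = 1 := by simp [occ, h3]
        have h5 : 1 ≤ velocity η m k z := by
          by_contra h
          exact hjz (move_injective m k η j z hj h3 (by omega))
        rw [if_pos h5]; omega
      · have h4 : occ η z = 0 := by simp [occ, h3]
        rw [velocity_of_hole η m k z (by simpa using h3), if_neg (by omega)]
        omega
  · have hocc : occ (step m k η) z = 0 := by simp [occ, hz]
    have hno : ∀ j, η j = true → j + (velocity η m k j : ℤ) ≠ z := fun j hj e =>
      hz ((step_eq_true m k η z).2 ⟨j, hj, e⟩)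
    have h2 : ∑ d ∈ Finset.range m,
        (if velocity η m k (z - 1 - d) = d + 1 then (1 : ℤ) else 0) = 0 := by
      refine Finset.sum_eq_zero fun d _ => if_neg fun h => ?_
      exact hno _ (hcar (z - 1 - d) (by omega)) (by omega)
    by_cases h3 : η z = true
    · have h4 : occ η z = 1 := by simp [occ, h3]
      have := hno z h3
      rw [if_pos (by omega)]; omega
    · have h4 : occ η z = 0 := by simp [occ, h3]
      rw [velocity_of_hole η m k z (by simpa using h3), if_neg (by omega)]
      omega

/-- A car crossing here would have to enter the occupied site o. Hence the label of such a bond is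
unchanged by the step, which lets `Alt.label` compare labels before and after. -/
theorem crossings_eq_zero (m k : ℕ) (η : Road) (o : ℤ) (h0 : η (o - 1) = false)
    (h1 : η o = true) : crossings m k η o = 0 := by
  refine Finset.sum_eq_zero fun d _ => if_neg fun h => ?_
  obtain ⟨l, hl, hc, hh, hg⟩ := exists_of_velocity_pos η m k (o - 1 - d) (by omega)
  rcases lt_or_ge (o - 1) (o - 1 - d + l + 1) with h2 | h2
  · exact not_true_of_false h0 (hc _ (by omega) (by omega))
  · exact not_true_of_false (hg o (by omega) (by omega)) h1

/-! ### Fronts, splits and the state between two fronts after a step. -/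

/-- A car at `z - 1` followed by an empty site at `z`. -/
def IsFront (η : Road) (z : ℤ) : Prop := η (z - 1) = true ∧ η z = false

/-- More than `m` empty sites before the bond `o`, followed by more than `k` cars. -/
def IsSplit (m k : ℕ) (η : Road) (o : ℤ) : Prop :=
  (∀ i, o - m - 1 ≤ i → i < o → η i = false) ∧ ∀ i, o ≤ i → i ≤ o + k → η i = true

open Classical in
/-- Indicator of a front. -/
noncomputable def frontInd (η : Road) (z : ℤ) : ℤ := if IsFront η z then 1 else 0

open Classical in
/-- Indicator of a split. -/
noncomputable def splitInd (m k : ℕ) (η : Road) (o : ℤ) : ℤ := if IsSplit m k η o then 1 else 0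

/-- `z` and `z'` are consecutive fronts: empty sites in `[z, o)` and cars in `[o, z')`. -/
structure Alt (η : Road) (z o z' : ℤ) : Prop where
  lt_left : z < o
  lt_right : o < z'
  car_before : η (z - 1) = true
  hole : ∀ i, z ≤ i → i < o → η i = false
  car : ∀ i, o ≤ i → i < z' → η i = true
  hole_after : η z' = false

theorem Alt.front_left {η : Road} {z o z' : ℤ} (h : Alt η z o z') : IsFront η z :=
  ⟨h.car_before, h.hole z le_rfl h.lt_left⟩

theorem Alt.front_right {η : Road} {z o z' : ℤ} (h : Alt η z o z') : IsFront η z' :=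
  ⟨h.car _ (by have := h.lt_right; omega) (by omega), h.hole_after⟩

theorem Alt.eq_left {η : Road} {z o z' f : ℤ} (h : Alt η z o z') (hf : IsFront η f)
    (h1 : z ≤ f) (h2 : f < z') : f = z := by
  by_contra hne
  rcases le_or_gt f o with h3 | h3
  · exact not_true_of_false (h.hole (f - 1) (by omega) (by omega)) hf.1
  · exact not_true_of_false hf.2 (h.car f (by omega) h2)

/-- Fronts exist arbitrarily far in both directions. -/
def Unbounded (η : Road) : Prop :=
  ∀ N : ℤ, (∃ z, N ≤ z ∧ IsFront η z) ∧ ∃ z, z ≤ N ∧ IsFront η z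

theorem Unbounded.exists_alt {η : Road} (h : Unbounded η) (u : ℤ) :
    ∃ z o z', Alt η z o z' ∧ z ≤ u ∧ u < z' := by
  classical
  obtain ⟨z, ⟨hz1, hz2⟩, hz3⟩ := Int.exists_greatest_of_bdd (P := fun z => z ≤ u ∧ IsFront η z)
    ⟨u, fun z hz => hz.1⟩ (h u).2
  obtain ⟨z', ⟨hz1', hz2'⟩, hz3'⟩ := Int.exists_least_of_bdd
    (P := fun z => u + 1 ≤ z ∧ IsFront η z) ⟨u + 1, fun z hz => hz.1⟩ (h (u + 1)).1
  obtain ⟨o, ⟨ho1, ho2⟩, ho3⟩ := Int.exists_least_of_bdd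
    (P := fun o => z ≤ o ∧ η o = true) ⟨z, fun o ho => ho.1⟩ ⟨z' - 1, by omega, hz2'.1⟩
  have hzo : z ≠ o := by
    rintro rfl
    exact not_true_of_false hz2.2 ho2
  have hoz : o ≤ z' - 1 := ho3 _ ⟨by omega, hz2'.1⟩
  refine ⟨z, o, z', ⟨by omega, by omega, hz2.1, ?_, ?_, hz2'.2⟩, hz1, by omega⟩
  · intro i h1 h2
    by_contra h3
    have := ho3 i ⟨h1, by simpa using h3⟩
    omega
  · intro i h1 h2
    induction i, h1 using Int.leInduction with
    | base => exact ho2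
    | succ i h1 ih =>
      by_contra h3
      have hf : IsFront η (i + 1) := ⟨by simpa using ih (by omega), by simpa using h3⟩
      rcases le_or_gt (i + 1) u with h4 | h4
      · have := hz3 _ ⟨h4, hf⟩; omega
      · have := hz3' _ ⟨h4, hf⟩; omega

theorem Unbounded.exists_alt_left {η : Road} (h : Unbounded η) {z : ℤ} (hz : IsFront η z) :
    ∃ o z', Alt η z o z' := by
  obtain ⟨w, o, z', ha, h1, h2⟩ := h.exists_alt z
  obtain rfl := ha.eq_left hz h1 h2
  exact ⟨o, z', ha⟩

theorem Unbounded.exists_alt_right {η : Road} (h : Unbounded η) {z : ℤ} (hz : IsFront η z) :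
    ∃ w o, Alt η w o z := by
  obtain ⟨w, o, z', ha, h1, h2⟩ := h.exists_alt (z - 1)
  rcases eq_or_ne z z' with rfl | h3
  · exact ⟨w, o, ha⟩
  · have := ha.eq_left hz (by omega) (by omega)
    omega

/-- Supplies the number a of `step_front`, the minimum of k and the block length; induction on k
avoids a separate case for infinite blocks. -/
theorem exists_run_left (η : Road) (k : ℕ) (hk : 1 ≤ k) (z : ℤ) (hz : η (z - 1) = true) :
    ∃ a : ℕ, 1 ≤ a ∧ a ≤ k ∧ (∀ i, z - a ≤ i → i < z → η i = true) ∧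
      (a = k ∨ η (z - a - 1) = false) := by
  induction k, hk using Nat.le_induction with
  | base =>
    refine ⟨1, le_rfl, le_rfl, fun i h1 h2 => ?_, Or.inl rfl⟩
    have : i = z - 1 := by push_cast at h1; omega
    rw [this, hz]
  | succ k hk ih =>
    obtain ⟨a, h1, h2, h3, h4⟩ := ih
    rcases h4 with rfl | h4
    · by_cases h5 : η (z - a - 1) = true
      · refine ⟨a + 1, by omega, le_rfl, fun i h6 h7 => ?_, Or.inl rfl⟩
        rcases eq_or_ne i (z - a - 1) with rfl | h8
        · exact h5
        · exact h3 i (by push_cast at h6; omega) h7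
      · exact ⟨a, h1, by omega, h3, Or.inr (by simpa using h5)⟩
    · exact ⟨a, h1, by omega, h3, Or.inr h4⟩

theorem exists_run_right (η : Road) (m : ℕ) (hm : 1 ≤ m) (z : ℤ) (hz : η z = false) :
    ∃ b : ℕ, 1 ≤ b ∧ b ≤ m ∧ (∀ i, z ≤ i → i < z + b → η i = false) ∧
      (b = m ∨ η (z + b) = true) := by
  induction m, hm using Nat.le_induction with
  | base =>
    refine ⟨1, le_rfl, le_rfl, fun i h1 h2 => ?_, Or.inl rfl⟩
    have : i = z := by push_cast at h2; omega
    rw [this, hz]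
  | succ m hm ih =>
    obtain ⟨b, h1, h2, h3, h4⟩ := ih
    rcases h4 with rfl | h4
    · by_cases h5 : η (z + b) = false
      · refine ⟨b + 1, by omega, le_rfl, fun i h6 h7 => ?_, Or.inl rfl⟩
        rcases eq_or_ne i (z + b) with rfl | h8
        · exact h5
        · exact h3 i h6 (by push_cast at h7; omega)
      · exact ⟨b, h1, by omega, h3, Or.inr (by simpa using h5)⟩
    · exact ⟨b, h1, by omega, h3, Or.inr h4⟩

/-- The state after one step between two consecutive fronts; `p` empty sites before and `q` cars
after the bond `o` are at rest. -/
structure StepShape (m k : ℕ) (η' : Road) (z o z' p q : ℤ) : Prop where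
  p_eq : p = max 0 (o - z - m)
  q_eq : q = max 0 (z' - o - k)
  le_left : z < o - p
  le_right : o + q < z'
  hole : ∀ u, o - p ≤ u → u < o → η' u = false
  car : ∀ u, o ≤ u → u < o + q → η' u = true
  car_before : η' (o - p - 1) = true
  hole_after : η' (o + q) = false
  mono_left : ∀ u, z ≤ u → u < o - p → η' (u - 1) = true → η' u = true
  mono_right : ∀ u, o + q < u → u < z' → η' (u - 1) = true → η' u = true
  group_cars : ∃ a : ℕ, a ≤ k ∧ η' (o - p - 1 - a) = false
  group_holes : ∃ b : ℕ, b ≤ m ∧ η' (o + q + b) = true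

/-- Apply `step_front` at both ends. The group leaving z advances min(m, o-z) and stops p sites
before o; the group leaving z' takes min(k, z'-o) cars away, so q cars stay after o. -/
theorem Alt.stepShape {m k : ℕ} (hm : 1 ≤ m) (hk : 1 ≤ k) {η : Road} {z o z' : ℤ}
    (h : Alt η z o z') :
    StepShape m k (step m k η) z o z' (max 0 (o - z - m)) (max 0 (z' - o - k)) := by
  have hl := h.lt_left
  have hr := h.lt_right
  obtain ⟨a, ha1, hak, hac, ha⟩ := exists_run_left η k hk z h.car_before
  obtain ⟨b', hb1', hbm', hbc', hb'⟩ := exists_run_right η m hm z' h.hole_after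
  obtain ⟨b, hbdef⟩ : ∃ b : ℕ, (b : ℤ) = min (m : ℤ) (o - z) := ⟨(min (m : ℤ) (o - z)).toNat, by omega⟩
  obtain ⟨a', hadef⟩ : ∃ a : ℕ, (a : ℤ) = min (k : ℤ) (z' - o) :=
    ⟨(min (k : ℤ) (z' - o)).toNat, by omega⟩
  have left : ∀ u, z - a ≤ u → u < z + b → (step m k η u = true ↔ z - a + b ≤ u) := fun u =>
    step_front m k a b η z u ha1 hak hac ha (by omega) (by omega)
      (fun i h1 h2 => h.hole i h1 (by omega))
      (by
        rcases le_or_gt (m : ℤ) (o - z) with h1 | h1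
        · left; omega
        · right
          have : z + b = o := by omega
          rw [this]; exact h.car o le_rfl hr)
  have right : ∀ u, z' - a' ≤ u → u < z' + b' → (step m k η u = true ↔ z' - a' + b' ≤ u) :=
    fun u => step_front m k a' b' η z' u (by omega) (by omega)
      (fun i h1 h2 => h.car i (by omega) h2)
      (by
        rcases le_or_gt (k : ℤ) (z' - o) with h1 | h1
        · left; omega
        · right
          have : z' - a' - 1 = o - 1 := by omega
          rw [this]; exact h.hole _ (by omega) (by omega))
      hb1' hbm' hbc' hb'
  have ep : o - max 0 (o - z - m) = z + b := by omega
  have eq : o + max 0 (z' - o - k) = z' - a' := by omega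
  refine ⟨rfl, rfl, by omega, by omega, ?_, ?_, ?_, ?_, ?_, ?_, ?_, ?_⟩
  · intro u h1 h2
    exact step_hole m k η u fun i h3 h4 => h.hole i (by omega) (by omega)
  · intro u h1 h2
    exact step_car m k η u fun i h3 h4 => h.car i (by omega) (by omega)
  · rw [ep]
    exact (left _ (by omega) (by omega)).2 (by omega)
  · rw [eq, ← Bool.not_eq_true, right _ (by omega) (by omega)]
    omega
  · intro u h1 h2
    rw [left _ (by omega) (by omega), left _ (by omega) (by omega)]
    omega
  · intro u h1 h2
    rw [right _ (by omega) (by omega), right _ (by omega) (by omega)]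
    omega
  · refine ⟨a, hak, ?_⟩
    rw [ep, ← Bool.not_eq_true, left _ (by omega) (by omega)]
    omega
  · refine ⟨b', hbm', ?_⟩
    rw [eq, right _ (by omega) (by omega)]

/-- On both sides of [o - p, o + q] the new state is holes followed by cars, so fronts can occur
only at the ends of the resting part. There are two of them exactly when p and q are both positive,
which by `Alt.isSplit_iff` is a split at o. -/
theorem StepShape.isFront_iff {m k : ℕ} {η' : Road} {z o z' p q f : ℤ}
    (h : StepShape m k η' z o z' p q) (h1 : z ≤ f) (h2 : f < z') :
    IsFront η' f ↔ (0 < p ∧ f = o - p) ∨ (0 < q ∧ f = o + q) ∨ (p = 0 ∧ q = 0 ∧ f = o) := by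
  have hp := h.p_eq
  have hq := h.q_eq
  constructor
  · rintro ⟨h3, h4⟩
    rcases lt_or_ge f (o - p) with h5 | h5
    · exact absurd (h.mono_left f h1 h5 h3) (not_true_of_false h4)
    rcases lt_or_ge (o + q) f with h6 | h6
    · exact absurd (h.mono_right f h6 h2 h3) (not_true_of_false h4)
    rcases lt_trichotomy f o with h7 | h7 | h7
    · have : f = o - p := by
        by_contra h8
        exact not_true_of_false (h.hole (f - 1) (by omega) (by omega)) h3
      left; omega
    · have hq0 : q = 0 := by
        by_contra h8
        exact not_true_of_false h4 (h.car f (by omega) (by omega))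
      have hp0 : p = 0 := by
        by_contra h8
        exact not_true_of_false (h.hole (f - 1) (by omega) (by omega)) h3
      omega
    · have : f = o + q := by
        by_contra h8
        exact not_true_of_false h4 (h.car f (by omega) (by omega))
      right; left; omega
  · rintro (⟨h3, rfl⟩ | ⟨h3, rfl⟩ | ⟨h3, h4, rfl⟩)
    · exact ⟨h.car_before, h.hole _ le_rfl (by omega)⟩
    · exact ⟨h.car _ (by omega) (by omega), h.hole_after⟩
    · have h5 := h.car_before
      have h6 := h.hole_after
      simp only [h3, sub_zero, h4, add_zero] at h5 h6
      exact ⟨h5, h6⟩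

theorem StepShape.frontInd_eq {m k : ℕ} {η' : Road} {z o z' p q f : ℤ}
    (h : StepShape m k η' z o z' p q) (h1 : z ≤ f) (h2 : f < z') :
    frontInd η' f = (if f = o - p then (if 0 < p then 1 else 0) else 0) +
      (if f = o + q then (if 0 < q then 1 else 0) else 0) +
      (if f = o then (if p = 0 ∧ q = 0 then 1 else 0) else 0) := by
  have hp := h.p_eq
  have hq := h.q_eq
  rw [frontInd]
  simp only [h.isFront_iff h1 h2]
  split_ifs <;> first | rfl | omega

theorem Alt.frontInd_eq {η : Road} {z o z' f : ℤ} (h : Alt η z o z') (h1 : z ≤ f) (h2 : f < z') :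
    frontInd η f = if f = z then 1 else 0 := by
  rw [frontInd]
  congr 1
  exact propext ⟨fun hf => h.eq_left hf h1 h2, fun e => e ▸ h.front_left⟩

theorem Alt.isSplit_iff {m k : ℕ} {η : Road} {z o z' f : ℤ} (h : Alt η z o z')
    (h1 : z ≤ f) (h2 : f < z') :
    IsSplit m k η f ↔ f = o ∧ 0 < o - z - m ∧ 0 < z' - o - k := by
  have hl := h.lt_left
  have hr := h.lt_right
  constructor
  · rintro ⟨h3, h4⟩
    have h5 : f = o := by
      rcases lt_trichotomy f o with h6 | h6 | h6
      · exact absurd (h4 f le_rfl (by omega)) (not_true_of_false (h.hole f h1 h6))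
      · exact h6
      · exact absurd (h.car (f - 1) (by omega) (by omega))
          (not_true_of_false (h3 _ (by omega) (by omega)))
    subst h5
    refine ⟨rfl, ?_, ?_⟩
    · by_contra h6
      exact not_true_of_false (h3 (z - 1) (by omega) (by omega)) h.car_before
    · by_contra h6
      exact not_true_of_false h.hole_after (h4 z' (by omega) (by omega))
  · rintro ⟨rfl, h3, h4⟩
    exact ⟨fun i h5 h6 => h.hole i (by omega) h6, fun i h5 h6 => h.car i h5 (by omega)⟩

theorem Alt.splitInd_eq {m k : ℕ} {η : Road} {z o z' f : ℤ} (h : Alt η z o z')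
    (h1 : z ≤ f) (h2 : f < z') :
    splitInd m k η f = if f = o then (if 0 < o - z - m ∧ 0 < z' - o - k then 1 else 0) else 0 := by
  rw [splitInd]
  simp only [h.isSplit_iff h1 h2]
  split_ifs <;> first | rfl | omega

theorem Alt.exists_front_step {m k : ℕ} (hm : 1 ≤ m) (hk : 1 ≤ k) {η : Road} {z o z' : ℤ}
    (h : Alt η z o z') : ∃ f, IsFront (step m k η) f ∧ z ≤ f ∧ f < z' := by
  have hs := h.stepShape hm hk
  have h1 := hs.le_left
  have h2 := hs.le_right
  have hl := h.lt_left
  have hr := h.lt_right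
  rcases lt_or_ge 0 (max 0 (o - z - m)) with h3 | h3
  · exact ⟨_, (hs.isFront_iff h1.le (by omega)).2 (Or.inl ⟨h3, rfl⟩), h1.le, by omega⟩
  rcases lt_or_ge 0 (max 0 (z' - o - k)) with h4 | h4
  · exact ⟨_, (hs.isFront_iff (by omega) h2).2 (Or.inr (Or.inl ⟨h4, rfl⟩)), by omega, h2⟩
  · exact ⟨o, (hs.isFront_iff hl.le hr).2 (Or.inr (Or.inr ⟨by omega, by omega, rfl⟩)), hl.le, hr⟩

theorem Unbounded.step {m k : ℕ} (hm : 1 ≤ m) (hk : 1 ≤ k) {η : Road} (h : Unbounded η) :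
    Unbounded (step m k η) := by
  intro N
  constructor
  · obtain ⟨z, hz1, hz2⟩ := (h N).1
    obtain ⟨o, z', ha⟩ := h.exists_alt_left hz2
    obtain ⟨f, hf, h1, h2⟩ := ha.exists_front_step hm hk
    exact ⟨f, by omega, hf⟩
  · obtain ⟨z, hz1, hz2⟩ := (h N).2
    obtain ⟨w, o, ha⟩ := h.exists_alt_right hz2
    obtain ⟨f, hf, h1, h2⟩ := ha.exists_front_step hm hk
    exact ⟨f, by omega, hf⟩

theorem Unbounded.iterate {m k : ℕ} (hm : 1 ≤ m) (hk : 1 ≤ k) {η : Road} (h : Unbounded η)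
    (t : ℕ) : Unbounded ((TrafficRule.step m k)^[t] η) := by
  induction t with
  | zero => exact h
  | succ t ih => rw [Function.iterate_succ_apply']; exact ih.step hm hk

/-! ### Counting fronts, and their car and hole labels. -/

/-- Signed sum of `f` from `0` to `z`. -/
noncomputable def isum {M : Type*} [AddCommGroup M] (f : ℤ → M) (z : ℤ) : M :=
  ∑ i ∈ Finset.Ico 0 z, f i - ∑ i ∈ Finset.Ico z 0, f i

theorem isum_add_sum {M : Type*} [AddCommGroup M] (f : ℤ → M) {a b : ℤ} (h : a ≤ b) :
    isum f a + ∑ i ∈ Finset.Ico a b, f i = isum f b := by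
  have key : ∀ x y z : ℤ, x ≤ y → y ≤ z → ∑ i ∈ Finset.Ico x y, f i + ∑ i ∈ Finset.Ico y z, f i
      = ∑ i ∈ Finset.Ico x z, f i := by
    intro x y z h1 h2
    rw [← Finset.sum_union (Finset.Ico_disjoint_Ico_consecutive x y z),
      Finset.Ico_union_Ico_eq_Ico h1 h2]
  unfold isum
  rcases le_total 0 a with h0 | h0
  · rw [← key 0 a b h0 h, Finset.Ico_eq_empty (a := a) (b := 0) (by omega),
      Finset.Ico_eq_empty (a := b) (b := 0) (by omega)]
    simp
  · rcases le_total 0 b with h1 | h1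
    · rw [← key a 0 b h0 h1, Finset.Ico_eq_empty (a := 0) (b := a) (by omega),
        Finset.Ico_eq_empty (a := b) (b := 0) (by omega)]
      simp
    · rw [← key a b 0 h h1, Finset.Ico_eq_empty (a := 0) (b := a) (by omega),
        Finset.Ico_eq_empty (a := 0) (b := b) (by omega)]
      simp

theorem isum_zero {M : Type*} [AddCommGroup M] (f : ℤ → M) : isum f 0 = 0 := by simp [isum]

theorem isum_succ {M : Type*} [AddCommGroup M] (f : ℤ → M) (z : ℤ) :
    isum f (z + 1) = isum f z + f z := by
  rw [← isum_add_sum f (show z ≤ z + 1 by omega)]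
  congr 1
  rw [show Finset.Ico z (z + 1) = {z} by ext; simp; omega]
  simp

/-- A sum comparison between consecutive fronts, in its exact form, extends to all fronts. -/
theorem Unbounded.sum_eq {η : Road} (h : Unbounded η) (A : ℤ → ℤ)
    (hA : ∀ z o z', Alt η z o z' → ∑ u ∈ Finset.Ico z z', A u = 0) {z w : ℤ}
    (hz : IsFront η z) (hw : IsFront η w) (hzw : z ≤ w) : isum A w = isum A z := by
  obtain ⟨n, hn⟩ : ∃ n : ℕ, w - z ≤ n := ⟨(w - z).toNat, by omega⟩
  induction n generalizing z with
  | zero => rw [show w = z by omega]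
  | succ n ih =>
    rcases hzw.eq_or_lt with rfl | hlt
    · rfl
    obtain ⟨o, z', ha⟩ := h.exists_alt_left hz
    have h1 := ha.lt_left
    have h2 := ha.lt_right
    have h3 : z' ≤ w := by
      by_contra h4
      have := ha.eq_left hw hzw (by omega)
      omega
    rw [ih ha.front_right h3 (by omega), ← isum_add_sum A (show z ≤ z' by omega), hA _ _ _ ha,
      add_zero]

theorem Alt.sum_front {m k : ℕ} (hm : 1 ≤ m) (hk : 1 ≤ k) {η : Road} {z o z' g : ℤ}
    (h : Alt η z o z') (_ : z ≤ g) (h2 : g ≤ z') :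
    ∑ u ∈ Finset.Ico z g, frontInd (TrafficRule.step m k η) u =
      (if o - max 0 (o - z - m) < g then (if 0 < o - z - m then 1 else 0) else 0) +
      (if o + max 0 (z' - o - k) < g then (if 0 < z' - o - k then 1 else 0) else 0) +
      (if o < g then (if o - z - m ≤ 0 ∧ z' - o - k ≤ 0 then 1 else 0) else 0) := by
  have hs := h.stepShape hm hk
  have h3 := hs.le_left
  have h4 := hs.le_right
  have hl := h.lt_left
  rw [Finset.sum_congr rfl fun u hu => hs.frontInd_eq (Finset.mem_Ico.1 hu).1
    (lt_of_lt_of_le (Finset.mem_Ico.1 hu).2 h2)]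
  rw [Finset.sum_add_distrib, Finset.sum_add_distrib, Finset.sum_ite_eq', Finset.sum_ite_eq',
    Finset.sum_ite_eq']
  simp only [Finset.mem_Ico]
  congr 1
  · congr 1 <;> split_ifs <;> first | rfl | omega
  · split_ifs <;> first | rfl | omega

theorem Alt.sum_split {m k : ℕ} {η : Road} {z o z' g : ℤ}
    (h : Alt η z o z') (h2 : g ≤ z') :
    ∑ u ∈ Finset.Ico z g, splitInd m k η u =
      if o < g then (if 0 < o - z - m ∧ 0 < z' - o - k then 1 else 0) else 0 := by
  have hl := h.lt_left
  rw [Finset.sum_congr rfl fun u hu => h.splitInd_eq (Finset.mem_Ico.1 hu).1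
    (lt_of_lt_of_le (Finset.mem_Ico.1 hu).2 h2), Finset.sum_ite_eq']
  simp only [Finset.mem_Ico]
  split_ifs <;> first | rfl | omega

theorem Alt.sum_old_front {η : Road} {z o z' : ℤ} (h : Alt η z o z') :
    ∑ u ∈ Finset.Ico z z', frontInd η u = 1 := by
  have hl := h.lt_left
  have hr := h.lt_right
  rw [Finset.sum_congr rfl fun u hu => h.frontInd_eq (Finset.mem_Ico.1 hu).1
    (Finset.mem_Ico.1 hu).2, Finset.sum_ite_eq']
  simp only [Finset.mem_Ico]
  rw [if_pos (by omega)]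

/-- Every split creates exactly one new front. -/
theorem Alt.sum_front_step {m k : ℕ} (hm : 1 ≤ m) (hk : 1 ≤ k) {η : Road} {z o z' : ℤ}
    (h : Alt η z o z') :
    ∑ u ∈ Finset.Ico z z',
      (frontInd (TrafficRule.step m k η) u - frontInd η u - splitInd m k η u) = 0 := by
  have hl := h.lt_left
  have hr := h.lt_right
  have h4 := (h.stepShape hm hk).le_right
  rw [Finset.sum_sub_distrib, Finset.sum_sub_distrib, h.sum_old_front, h.sum_split le_rfl,
    h.sum_front hm hk (by omega) le_rfl]
  split_ifs <;> first | rfl | omega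

theorem label_hole {Y : ℤ → ℤ} {ζ : Road} (hY : ∀ u, Y (u + 1) = Y u + occ ζ u) (a b : ℤ)
    (hab : a ≤ b) (hh : ∀ i, a ≤ i → i < b → ζ i = false) : Y b = Y a := by
  induction b, hab using Int.leInduction with
  | base => rfl
  | succ b hab ih =>
    rw [hY, ih fun i h1 h2 => hh i h1 (by omega)]
    simp [occ, hh b hab (by omega)]

theorem label_car {Y : ℤ → ℤ} {ζ : Road} (hY : ∀ u, Y (u + 1) = Y u + occ ζ u) (a b : ℤ)
    (hab : a ≤ b) (hh : ∀ i, a ≤ i → i < b → ζ i = true) : Y b = Y a + (b - a) := by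
  induction b, hab using Int.leInduction with
  | base => omega
  | succ b hab ih =>
    rw [hY, ih fun i h1 h2 => hh i h1 (by omega)]
    simp [occ, hh b hab (by omega)]
    ring

/-- The label of the car at or after a bond decreases with the number of cars crossing it. -/
theorem Alt.label {m k : ℕ} (hm : 1 ≤ m) (hk : 1 ≤ k) {η : Road} {z o z' f : ℤ}
    (h : Alt η z o z') (X : ℤ → ℤ) (hX : ∀ u, X (u + 1) = X u + occ η u)
    (hf : IsFront (TrafficRule.step m k η) f) (h1 : z ≤ f) (h2 : f < z') :
    (f < o ∧ z - X z + m ≤ z' - X z' ∧ X f - crossings m k η f = X z ∧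
      f - (X f - crossings m k η f) = z - X z + m ∧
      ∑ u ∈ Finset.Ico z f, frontInd (TrafficRule.step m k η) u =
        ∑ u ∈ Finset.Ico z f, splitInd m k η u) ∨
    (o < f ∧ X z ≤ X z' - k ∧ X f - crossings m k η f = X z' - k ∧
      f - (X f - crossings m k η f) = z' - X z' ∧
      ∑ u ∈ Finset.Ico z f, frontInd (TrafficRule.step m k η) u =
        ∑ u ∈ Finset.Ico z f, splitInd m k η u) ∨
    (f = o ∧ X f - crossings m k η f = X z ∧ f - (X f - crossings m k η f) = z' - X z' ∧
      ∑ u ∈ Finset.Ico z f, frontInd (TrafficRule.step m k η) u =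
        ∑ u ∈ Finset.Ico z f, splitInd m k η u) := by
  have hs := h.stepShape hm hk
  have hl := h.lt_left
  have hr := h.lt_right
  have hX' : ∀ u, (X (u + 1) - crossings m k η (u + 1)) =
      (X u - crossings m k η u) + occ (TrafficRule.step m k η) u := by
    intro u
    rw [occ_step, hX]; ring
  -- The label of o is the same before and after the step, so all other labels are computed from it.
  have ho : crossings m k η o = 0 :=
    crossings_eq_zero m k η o (h.hole _ (by omega) (by omega)) (h.car o le_rfl hr)
  have e1 : X o = X z := label_hole hX z o hl.le h.hole
  have e2 : X z' = X o + (z' - o) := label_car hX o z' hr.le h.car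
  have e3 := label_hole (Y := fun u => X u - crossings m k η u) hX' _ o (by omega) hs.hole
  have e4 := label_car (Y := fun u => X u - crossings m k η u) hX' o _ (by omega) hs.car
  simp only [ho, sub_zero] at e3 e4
  rw [h.sum_front hm hk h1 h2.le, h.sum_split h2.le]
  -- The front at o - p descends from z with its hole label raised by m, the one at o + q from z'
  -- with its car label lowered by k; the one at o takes the car label of z and the hole label of
  -- z'.
  rcases (hs.isFront_iff h1 h2).1 hf with ⟨h3, rfl⟩ | ⟨h3, rfl⟩ | ⟨h3, h4, rfl⟩
  · left
    refine ⟨by omega, by omega, by omega, by omega, ?_⟩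
    split_ifs <;> first | rfl | omega
  · right; left
    refine ⟨by omega, by omega, by omega, by omega, ?_⟩
    split_ifs <;> first | rfl | omega
  · right; right
    refine ⟨rfl, by omega, by omega, ?_⟩
    split_ifs <;> first | rfl | omega

theorem isum_mono {f : ℤ → ℤ} (hf : ∀ u, 0 ≤ f u) {a b : ℤ} (h : a ≤ b) :
    isum f a ≤ isum f b := by
  rw [← isum_add_sum f h]
  have : 0 ≤ ∑ i ∈ Finset.Ico a b, f i := Finset.sum_nonneg fun i _ => hf i
  omega

theorem isum_sub_fun {M : Type*} [AddCommGroup M] (f g : ℤ → M) (z : ℤ) :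
    isum (fun u => f u - g u) z = isum f z - isum g z := by
  simp only [isum, Finset.sum_sub_distrib]
  abel

theorem frontInd_nonneg (η : Road) (u : ℤ) : 0 ≤ frontInd η u := by
  unfold frontInd; split_ifs <;> simp

theorem splitInd_nonneg (m k : ℕ) (η : Road) (u : ℤ) : 0 ≤ splitInd m k η u := by
  unfold splitInd; split_ifs <;> simp

/-- The counts of fronts before and after a step differ by the splits in between. -/
theorem front_count_step {m k : ℕ} (hm : 1 ≤ m) (hk : 1 ≤ k) {η : Road} (hη : Unbounded η)
    {z w g g' : ℤ} (hz : IsFront η z) (hw : IsFront η w) (hzg : z ≤ g) (hwg : w ≤ g')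
    (h1 : ∑ u ∈ Finset.Ico z g, frontInd (step m k η) u = ∑ u ∈ Finset.Ico z g, splitInd m k η u)
    (h2 : ∑ u ∈ Finset.Ico w g', frontInd (step m k η) u =
      ∑ u ∈ Finset.Ico w g', splitInd m k η u) :
    isum (frontInd (step m k η)) g' - isum (frontInd (step m k η)) g =
      isum (frontInd η) w - isum (frontInd η) z +
        (isum (splitInd m k η) g' - isum (splitInd m k η) g) := by
  have key : ∀ a b, IsFront η a → IsFront η b → a ≤ b →
      isum (fun u => frontInd (step m k η) u - frontInd η u - splitInd m k η u) b =
      isum (fun u => frontInd (step m k η) u - frontInd η u - splitInd m k η u) a :=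
    fun a b ha hb hab => hη.sum_eq _ (fun z o z' h => h.sum_front_step hm hk) ha hb hab
  have key' : isum (fun u => frontInd (step m k η) u - frontInd η u - splitInd m k η u) w =
      isum (fun u => frontInd (step m k η) u - frontInd η u - splitInd m k η u) z := by
    rcases le_total z w with h | h
    · exact key z w hz hw h
    · exact (key w z hw hz h).symm
  rw [isum_sub_fun (fun u => frontInd (step m k η) u - frontInd η u),
    isum_sub_fun (fun u => frontInd (step m k η) u - frontInd η u),
    isum_sub_fun (frontInd (step m k η)), isum_sub_fun (frontInd (step m k η))] at key'
  have e1 := isum_add_sum (frontInd (step m k η)) hzg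
  have e2 := isum_add_sum (frontInd (step m k η)) hwg
  have e3 := isum_add_sum (splitInd m k η) hzg
  have e4 := isum_add_sum (splitInd m k η) hwg
  simp only [h1, h2] at e1 e2
  linarith

theorem Alt.count_right {η : Road} {z o z' : ℤ} (h : Alt η z o z') :
    isum (frontInd η) z' = isum (frontInd η) z + 1 := by
  rw [← isum_add_sum (frontInd η) (show z ≤ z' by have := h.lt_left; have := h.lt_right; omega),
    h.sum_old_front]

theorem Alt.right_le {η : Road} {z o z' w o' w' : ℤ} (h : Alt η z o z') (h' : Alt η w o' w')
    (hlt : z < w) : z' ≤ w := by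
  by_contra h1
  have := h.eq_left h'.front_left hlt.le (by omega)
  omega

theorem Alt.right_le_right {η : Road} {z o z' w o' w' : ℤ} (h : Alt η z o z')
    (h' : Alt η w o' w') (hle : z ≤ w) : z' ≤ w' := by
  by_contra h1
  have h2 := h'.lt_left
  have h3 := h'.lt_right
  have := h.eq_left h'.front_right (by omega) (by omega)
  omega

theorem Alt.left_le {η : Road} {z o z' w o' w' g g' : ℤ} (h : Alt η z o z') (h' : Alt η w o' w')
    (h1 : z ≤ g) (h2 : g' < w') (hle : g ≤ g') : z ≤ w := by
  by_contra h3
  have := h'.eq_left h.front_left (by omega) (by omega)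
  omega

/-- The outer choice of ancestors: g goes back to the left end of its interval and g' to the right
end of its own. The labels are then monotone whichever case of `Alt.label` occurs. The right end
costs one extra front, and splits only help. -/
theorem upper_step {m k : ℕ} (hm : 1 ≤ m) (hk : 1 ≤ k) {η : Road} (hη : Unbounded η)
    (X : ℤ → ℤ) (hX : ∀ u, X (u + 1) = X u + occ η u) {g g' : ℤ}
    (hg : IsFront (step m k η) g) (hg' : IsFront (step m k η) g') (hle : g ≤ g') :
    ∃ z z', IsFront η z ∧ IsFront η z' ∧ z ≤ z' ∧ X z ≤ X g - crossings m k η g ∧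
      g' - (X g' - crossings m k η g') ≤ z' - X z' ∧
      isum (frontInd η) z' - isum (frontInd η) z ≤
        isum (frontInd (step m k η)) g' - isum (frontInd (step m k η)) g + 1 := by
  obtain ⟨z, o, z1, ha, h1, h2⟩ := hη.exists_alt g
  obtain ⟨w, o', w1, ha', h1', h2'⟩ := hη.exists_alt g'
  have hl := ha.label hm hk X hX hg h1 h2
  have hl' := ha'.label hm hk X hX hg' h1' h2'
  have hc : ∑ u ∈ Finset.Ico z g, frontInd (step m k η) u =
      ∑ u ∈ Finset.Ico z g, splitInd m k η u := by tauto
  have hc' : ∑ u ∈ Finset.Ico w g', frontInd (step m k η) u =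
      ∑ u ∈ Finset.Ico w g', splitInd m k η u := by tauto
  have hcount := front_count_step hm hk hη ha.front_left ha'.front_left h1 h1' hc hc'
  have hsp := isum_mono (splitInd_nonneg m k η) hle
  have hr := ha'.count_right
  exact ⟨z, w1, ha.front_left, ha'.front_right, by omega, by omega, by omega, by omega⟩

/-- The inner choice of ancestors: a front with a shifted label goes back to the front whose label
was shifted. Choosing the right end for g loses a front but gains a shift k (α = 1); choosing the
left end for g' loses a front but gains a shift m (β = 1). In all four cases fronts plus shifts go
up by one, up to splits. -/
theorem lower_step {m k : ℕ} (hm : 1 ≤ m) (hk : 1 ≤ k) {η : Road} (hη : Unbounded η)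
    (X : ℤ → ℤ) (hX : ∀ u, X (u + 1) = X u + occ η u) {g g' : ℤ}
    (hg : IsFront (step m k η) g) (hg' : IsFront (step m k η) g') (hle : g ≤ g') :
    ∃ z z', ∃ α β : ℕ, IsFront η z ∧ IsFront η z' ∧ z ≤ z' ∧
      X g - crossings m k η g + k * α ≤ X z ∧
      z' - X z' + m * β ≤ g' - (X g' - crossings m k η g') ∧
      isum (frontInd (step m k η)) g' - isum (frontInd (step m k η)) g + 1 ≤
        isum (frontInd η) z' - isum (frontInd η) z + α + β +
          (isum (splitInd m k η) g' - isum (splitInd m k η) g) := by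
  obtain ⟨z, o, z1, ha, h1, h2⟩ := hη.exists_alt g
  obtain ⟨w, o', w1, ha', h1', h2'⟩ := hη.exists_alt g'
  have hl := ha.label hm hk X hX hg h1 h2
  have hl' := ha'.label hm hk X hX hg' h1' h2'
  have hc : ∑ u ∈ Finset.Ico z g, frontInd (step m k η) u =
      ∑ u ∈ Finset.Ico z g, splitInd m k η u := by tauto
  have hc' : ∑ u ∈ Finset.Ico w g', frontInd (step m k η) u =
      ∑ u ∈ Finset.Ico w g', splitInd m k η u := by tauto
  have hcount := front_count_step hm hk hη ha.front_left ha'.front_left h1 h1' hc hc'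
  have hzw : z ≤ w := ha.left_le ha' h1 h2' hle
  have hzw1 : z1 ≤ w1 := ha.right_le_right ha' hzw
  have hr := ha.count_right
  have hr' := ha'.count_right
  have hX1 : X g - crossings m k η g ≤ X z ∨ (o < g ∧ X g - crossings m k η g = X z1 - k) := by
    rcases hl with h | h | h
    · left; exact h.2.2.1.le
    · right; exact ⟨h.1, h.2.2.1⟩
    · left; exact h.2.1.le
  have hY1 : (g' < o' ∧ g' - (X g' - crossings m k η g') = w - X w + m) ∨
      w1 - X w1 ≤ g' - (X g' - crossings m k η g') := by
    rcases hl' with h | h | h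
    · left; exact ⟨h.1, h.2.2.2.1⟩
    · right; exact h.2.2.2.1.ge
    · right; exact h.2.2.1.ge
  rcases hX1 with hX1 | ⟨hog, hX1⟩ <;> rcases hY1 with ⟨hgo, hY1⟩ | hY1
  · exact ⟨z, w, 0, 1, ha.front_left, ha'.front_left, hzw, by simpa using hX1,
      by simpa using hY1.ge, by push_cast; omega⟩
  · exact ⟨z, w1, 0, 0, ha.front_left, ha'.front_right, by omega, by simpa using hX1,
      by simpa using hY1, by push_cast; omega⟩
  · have hne : z < w := by
      rcases hzw.eq_or_lt with rfl | h
      · exfalso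
        have hzz : z1 = w1 := le_antisymm hzw1 (ha'.right_le_right ha le_rfl)
        have h3 := ha.lt_left
        have h4 := ha.lt_right
        have h5 := ha'.lt_left
        rcases lt_trichotomy o o' with h6 | h6 | h6
        · exact not_true_of_false (ha'.hole o h3.le h6) (ha.car o le_rfl h4)
        · omega
        · exact not_true_of_false (ha.hole o' h5.le h6) (ha'.car o' le_rfl ha'.lt_right)
      · exact h
    exact ⟨z1, w, 1, 1, ha.front_right, ha'.front_left, ha.right_le ha' hne, by push_cast; omega,
      by push_cast; omega, by push_cast; omega⟩
  · exact ⟨z1, w1, 1, 0, ha.front_right, ha'.front_right, hzw1, by push_cast; omega,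
      by push_cast; omega, by push_cast; omega⟩

/-! ### Tracing fronts back to time zero. -/

/-- Label at time `t` of the first car at or after the bond `z`, where the first car at or after
the bond `0` at time `0` has label `0`. -/
noncomputable def label (m k : ℕ) (η : Road) : ℕ → ℤ → ℤ
  | 0, z => isum (occ η) z
  | t + 1, z => label m k η t z - crossings m k ((step m k)^[t] η) z

theorem label_succ (m k : ℕ) (η : Road) (t : ℕ) (z : ℤ) :
    label m k η t (z + 1) = label m k η t z + occ ((step m k)^[t] η) z := by
  induction t with
  | zero => exact isum_succ _ _
  | succ t ih =>
    rw [label, label, ih, Function.iterate_succ_apply', occ_step]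
    ring

theorem label_mono (m k : ℕ) (η : Road) (t : ℕ) {a b : ℤ} (h : a ≤ b) :
    label m k η t a ≤ label m k η t b := by
  induction b, h using Int.leInduction with
  | base => exact le_rfl
  | succ b h ih =>
    rw [label_succ]
    have : 0 ≤ occ ((step m k)^[t] η) b := by unfold occ; split_ifs <;> simp
    omega

theorem hole_label_mono (m k : ℕ) (η : Road) (t : ℕ) {a b : ℤ} (h : a ≤ b) :
    a - label m k η t a ≤ b - label m k η t b := by
  induction b, h using Int.leInduction with
  | base => exact le_rfl
  | succ b h ih =>
    rw [label_succ]
    have : occ ((step m k)^[t] η) b ≤ 1 := by unfold occ; split_ifs <;> simp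
    omega

theorem label_le_zero_time (m k : ℕ) (η : Road) (t : ℕ) (z : ℤ) :
    label m k η t z ≤ label m k η 0 z := by
  induction t with
  | zero => exact le_rfl
  | succ t ih =>
    have := crossings_nonneg m k ((step m k)^[t] η) z
    change label m k η t z - _ ≤ _
    omega

theorem label_zero (m k : ℕ) (η : Road) (t : ℕ) :
    label m k η t 0 = - ∑ s ∈ Finset.range t, crossings m k ((step m k)^[s] η) 0 := by
  induction t with
  | zero => simp [label, isum_zero]
  | succ t ih => rw [label, ih, Finset.sum_range_succ]; ring

theorem upper_chain {m k : ℕ} (hm : 1 ≤ m) (hk : 1 ≤ k) {η : Road} (hη : Unbounded η) (T : ℕ)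
    {g g' : ℤ} (hg : IsFront ((step m k)^[T] η) g) (hg' : IsFront ((step m k)^[T] η) g')
    (hle : g ≤ g') :
    ∃ z z', z ≤ z' ∧ label m k η 0 z ≤ label m k η T g ∧
      g' - label m k η T g' ≤ z' - label m k η 0 z' ∧
      isum (frontInd η) z' - isum (frontInd η) z ≤
        isum (frontInd ((step m k)^[T] η)) g' - isum (frontInd ((step m k)^[T] η)) g + T := by
  induction T generalizing g g' with
  | zero => exact ⟨g, g', hle, le_rfl, le_rfl, by simp⟩
  | succ T ih =>
    rw [Function.iterate_succ_apply'] at hg hg'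
    obtain ⟨z, z', hz, hz', h1, h2, h3, h4⟩ := upper_step hm hk (hη.iterate hm hk T)
      (label m k η T) (label_succ m k η T) hg hg' hle
    obtain ⟨w, w', h5, h6, h7, h8⟩ := ih hz hz' h1
    rw [Function.iterate_succ_apply']
    exact ⟨w, w', h5, h6.trans h2, h3.trans h7, by push_cast; omega⟩

/-- Iterates `lower_step`. Going back in time the left car label can only rise and the right hole
label can only fall, so `hW` keeps the whole chain inside [A, B], and only splits in this window are
charged. -/
theorem lower_chain {m k : ℕ} (hm : 1 ≤ m) (hk : 1 ≤ k) {η : Road} (hη : Unbounded η) (T : ℕ)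
    {L M A B : ℤ}
    (hW : ∀ u, L ≤ label m k η 0 u → u - label m k η 0 u ≤ M → A ≤ u ∧ u ≤ B)
    {g g' : ℤ} (hg : IsFront ((step m k)^[T] η) g) (hg' : IsFront ((step m k)^[T] η) g')
    (hle : g ≤ g') (hL : L ≤ label m k η T g) (hM : g' - label m k η T g' ≤ M) :
    ∃ z z', ∃ α β : ℕ, z ≤ z' ∧ label m k η T g + k * α ≤ label m k η 0 z ∧
      z' - label m k η 0 z' + m * β ≤ g' - label m k η T g' ∧
      isum (frontInd ((step m k)^[T] η)) g' - isum (frontInd ((step m k)^[T] η)) g + T ≤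
        isum (frontInd η) z' - isum (frontInd η) z + α + β +
        ∑ t ∈ Finset.range T, ∑ u ∈ Finset.Ico A B, splitInd m k ((step m k)^[t] η) u := by
  induction T generalizing g g' with
  | zero => exact ⟨g, g', 0, 0, hle, by simp, by simp, by simp⟩
  | succ T ih =>
    have hLg := label_le_zero_time m k η (T + 1) g
    have hLg' := label_le_zero_time m k η (T + 1) g'
    have hm1 := label_mono m k η (T + 1) hle
    have hm2 := hole_label_mono m k η (T + 1) hle
    have hA : A ≤ g := (hW g (by omega) (by omega)).1
    have hB : g' ≤ B := (hW g' (by omega) (by omega)).2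
    have hsp : isum (splitInd m k ((step m k)^[T] η)) g' -
        isum (splitInd m k ((step m k)^[T] η)) g ≤
        ∑ u ∈ Finset.Ico A B, splitInd m k ((step m k)^[T] η) u := by
      have e := isum_add_sum (splitInd m k ((step m k)^[T] η)) (show A ≤ B by omega)
      have e1 := isum_mono (splitInd_nonneg m k ((step m k)^[T] η)) hA
      have e2 := isum_mono (splitInd_nonneg m k ((step m k)^[T] η)) hB
      omega
    rw [Function.iterate_succ_apply'] at hg hg'
    obtain ⟨z, z', α, β, hz, hz', h1, h2, h3, h4⟩ := lower_step hm hk (hη.iterate hm hk T)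
      (label m k η T) (label_succ m k η T) hg hg' hle
    change label m k η (T + 1) g + k * α ≤ label m k η T z at h2
    change z' - label m k η T z' + m * β ≤ g' - label m k η (T + 1) g' at h3
    have hkα : 0 ≤ (k : ℤ) * α := by positivity
    have hmβ : 0 ≤ (m : ℤ) * β := by positivity
    obtain ⟨w, w', α', β', h5, h6, h7, h8⟩ := ih hz hz' h1 (by omega) (by omega)
    rw [Function.iterate_succ_apply', Finset.sum_range_succ]
    refine ⟨w, w', α + α', β + β', h5, ?_, ?_, ?_⟩
    · push_cast; linarith
    · push_cast; linarith
    · push_cast; linarith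

/-! ### Flux through a bond from the densities of cars and fronts. -/

/-- The integer sequence `f` has mean `α` in both directions. -/
def HasDensity (f : ℤ → ℝ) (α : ℝ) : Prop :=
  ∀ ε : ℝ, 0 < ε → ∃ C : ℝ, 0 ≤ C ∧ ∀ z : ℤ, |isum f z - α * z| ≤ ε * |(z : ℝ)| + C

theorem isum_cast (f : ℤ → ℤ) (z : ℤ) :
    isum (fun u => (f u : ℝ)) z = ((isum f z : ℤ) : ℝ) := by
  simp [isum]

theorem HasDensity.int_bound {f : ℤ → ℤ} {α : ℝ} (h : HasDensity (fun u => (f u : ℝ)) α) {δ : ℝ}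
    (hδ : 0 < δ) : ∃ C : ℝ, 0 ≤ C ∧ ∀ z : ℤ,
      ((isum f z : ℤ) : ℝ) - α * z ≤ δ * |(z : ℝ)| + C ∧
      α * z - ((isum f z : ℤ) : ℝ) ≤ δ * |(z : ℝ)| + C := by
  obtain ⟨C, hC, h1⟩ := h δ hδ
  refine ⟨C, hC, fun z => ?_⟩
  have := abs_le.1 (h1 z)
  rw [isum_cast] at this
  constructor <;> linarith [this.1, this.2]

/-- The linear estimates behind the upper bound for the flux. -/
theorem upper_estimate {ρ n r δ C D E z z' x x' f f' Φ T : ℝ} (h0 : 0 < ρ) (h1 : ρ < 1)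
    (hn : 0 < n) (hr : r = ρ * (1 - ρ) / n) (hδ : 0 < δ) (hδρ : δ ≤ ρ / 2)
    (hδρ' : δ ≤ (1 - ρ) / 2) (hδn : δ ≤ n / 2) (hC : 0 ≤ C)
    (hE : E = 2 * (C / (ρ / 2) + C / ((1 - ρ) / 2)))
    (hΦ0 : 0 ≤ Φ) (hx : x ≤ -Φ) (hy : Φ ≤ z' - x') (hc : f' - f ≤ T + 1) (hzz : z ≤ z')
    (hx1 : ρ * z - x ≤ δ * |z| + C) (hx1' : ρ * z' - x' ≤ δ * |z'| + C)
    (hf1 : f - n * z ≤ δ * |z| + D) (hf1' : n * z' - f' ≤ δ * |z'| + D) :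
    Φ ≤ r * T + δ * ((r + 1) * (2 / n)) * T + ((δ * E + C) + r * (1 + δ * E + 2 * D) +
      (r + 1) * δ * (2 / n) * (1 + δ * E + 2 * D)) := by
  have hρ' : 0 < 1 - ρ := by linarith
  have hr0 : 0 ≤ r := by rw [hr]; positivity
  have hC0 : 0 ≤ C / (ρ / 2) := by positivity
  have hC1 : 0 ≤ C / ((1 - ρ) / 2) := by positivity
  have hz1 : z ≤ C / (ρ / 2) := by
    rcases le_total z 0 with h | h
    · exact h.trans (by positivity)
    · rw [le_div_iff₀ (by positivity)]
      rw [abs_of_nonneg h] at hx1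
      have := mul_le_mul_of_nonneg_right hδρ h
      linarith
  have hz2 : -z' ≤ C / ((1 - ρ) / 2) := by
    rcases le_total 0 z' with h | h
    · exact (neg_nonpos.2 h).trans (by positivity)
    · rw [le_div_iff₀ (by positivity)]
      rw [abs_of_nonpos h] at hx1'
      have := mul_le_mul_of_nonneg_right hδρ' (neg_nonneg.2 h)
      linarith
  -- Up to constants z ≤ 0 ≤ z', so errors proportional to |z| + |z'| are errors proportional to the
  -- length z' - z.
  have habs : |z| + |z'| ≤ (z' - z) + E := by
    rcases abs_cases z with h | h <;> rcases abs_cases z' with h' | h' <;>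
      rw [h.1, h'.1, hE] <;> linarith
  have e3 : δ * (|z| + |z'|) ≤ δ * (z' - z + E) := mul_le_mul_of_nonneg_left habs hδ.le
  obtain ⟨Z, hZ⟩ : ∃ Z, Z = z' - z := ⟨_, rfl⟩
  obtain ⟨F, hF⟩ : ∃ F, F = 1 + δ * E + 2 * D := ⟨_, rfl⟩
  rw [← hF]
  have hZ0 : 0 ≤ Z := by linarith
  have hnZ : n * Z ≤ T + F + δ * Z := by
    rw [hF, hZ]
    linarith
  have hZ2 : Z ≤ 2 / n * (T + F) := by
    have := mul_le_mul_of_nonneg_right hδn hZ0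
    rw [div_mul_eq_mul_div, le_div_iff₀ hn]
    linarith
  -- Here Φ ≲ -ρz and Φ ≲ (1-ρ)z'; the weights 1 - ρ and ρ make only z' - z appear.
  have hΦ1 : Φ ≤ ρ * (1 - ρ) * Z + δ * (Z + E) + C := by
    have e4 : ρ * (δ * |z'|) ≤ 1 * (δ * |z'|) :=
      mul_le_mul_of_nonneg_right h1.le (by positivity)
    have e5 : (1 - ρ) * (δ * |z|) ≤ 1 * (δ * |z|) :=
      mul_le_mul_of_nonneg_right (by linarith) (by positivity)
    have e6 : ρ * Φ ≤ ρ * (z' - x') := mul_le_mul_of_nonneg_left hy h0.le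
    have e7 : (1 - ρ) * Φ ≤ (1 - ρ) * (-x) :=
      mul_le_mul_of_nonneg_left (by linarith) hρ'.le
    have e8 := mul_le_mul_of_nonneg_left hx1' h0.le
    have e9 := mul_le_mul_of_nonneg_left hx1 hρ'.le
    rw [hZ]
    linarith
  have hrn : ρ * (1 - ρ) * Z = r * (n * Z) := by
    rw [hr]; field_simp
  have e1 := mul_le_mul_of_nonneg_left hnZ hr0
  have e2 : (r + 1) * δ * Z ≤ (r + 1) * δ * (2 / n * (T + F)) :=
    mul_le_mul_of_nonneg_left hZ2 (by positivity)
  linarith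

/-- The linear estimates behind the lower bound for the flux. -/
theorem lower_estimate {ρ n r δ C D W M m k α β S z z' x x' f f' Φ T : ℝ} (h0 : 0 < ρ) (h1 : ρ < 1)
    (hn : 0 < n) (hr : r = ρ * (1 - ρ) / n) (hδ : 0 < δ) (hC : 0 ≤ C) (hW : 0 ≤ W)
    (hM : 0 ≤ M) (hM1 : M ≤ m * ρ) (hM2 : M ≤ k * (1 - ρ)) (hM3 : M ≤ r) (hα : 0 ≤ α) (hβ : 0 ≤ β)
    (hf : f ≤ f') (hT : T ≤ f' - f + α + β + S) (hx : -Φ + k * α ≤ x)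
    (hy : z' - x' + m * β ≤ Φ) (hz : |z| ≤ W) (hz' : |z'| ≤ W)
    (hx1 : x - ρ * z ≤ δ * |z| + C) (hx1' : x' - ρ * z' ≤ δ * |z'| + C)
    (hf1 : n * z - f ≤ δ * |z| + D) (hf1' : f' - n * z' ≤ δ * |z'| + D) :
    M * T ≤ Φ + M * S + 2 * (r + 1) * δ * W + (2 * C + r * (2 * D)) := by
  have hρ' : 0 < 1 - ρ := by linarith
  have hr0 : 0 ≤ r := by rw [hr]; positivity
  have d1 : δ * |z| ≤ δ * W := mul_le_mul_of_nonneg_left hz hδ.le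
  have d2 : δ * |z'| ≤ δ * W := mul_le_mul_of_nonneg_left hz' hδ.le
  have d0 : 0 ≤ δ * W := by positivity
  obtain ⟨V, hV⟩ : ∃ V, V = δ * W := ⟨_, rfl⟩
  rw [← hV] at d0 d1 d2
  have hKZ : r * (f' - f) ≤ ρ * (1 - ρ) * (z' - z) + r * (2 * V + 2 * D) := by
    have e3 : f' - f ≤ n * (z' - z) + (2 * V + 2 * D) := by linarith
    have e4 : ρ * (1 - ρ) * (z' - z) = r * (n * (z' - z)) := by rw [hr]; field_simp
    have := mul_le_mul_of_nonneg_left e3 hr0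
    rw [e4]; linarith
  have hΦ1 : ρ * (1 - ρ) * (z' - z) + m * ρ * β + k * (1 - ρ) * α ≤ Φ + V + C := by
    have e6 := mul_le_mul_of_nonneg_left hy h0.le
    have e7 := mul_le_mul_of_nonneg_left hx hρ'.le
    have e8 : ρ * (x' - ρ * z') ≤ ρ * (V + C) :=
      mul_le_mul_of_nonneg_left (by linarith) h0.le
    have e9 : (1 - ρ) * (x - ρ * z) ≤ (1 - ρ) * (V + C) :=
      mul_le_mul_of_nonneg_left (by linarith) hρ'.le
    linarith
  have hα' := mul_le_mul_of_nonneg_right hM2 hα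
  have hβ' := mul_le_mul_of_nonneg_right hM1 hβ
  -- With the two lines before: every front, every k-shift and every m-shift contributes at least M
  -- to the flux.
  have hKM := mul_le_mul_of_nonneg_right hM3 (sub_nonneg.2 hf)
  have hMT := mul_le_mul_of_nonneg_left hT hM
  have e : 2 * (r + 1) * δ * W = 2 * r * V + 2 * V := by rw [hV]; ring
  rw [e]
  linarith

theorem flux_upper {m k : ℕ} (hm : 1 ≤ m) (hk : 1 ≤ k) {η : Road} (hη : Unbounded η) {ρ n : ℝ}
    (h0 : 0 < ρ) (h1 : ρ < 1) (hn : 0 < n) (hρ : HasDensity (fun u => (occ η u : ℝ)) ρ)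
    (hd : HasDensity (fun u => (frontInd η u : ℝ)) n) {ε : ℝ} (hε : 0 < ε) :
    ∃ T₀ : ℕ, ∀ T ≥ T₀, -(label m k η T 0 : ℝ) ≤ (ρ * (1 - ρ) / n + ε) * T := by
  set r := ρ * (1 - ρ) / n with hr
  have hr0 : 0 < r := by have : 0 < 1 - ρ := by linarith
                         positivity
  obtain ⟨δ, hδ, hδρ, hδρ', hδn, hδε⟩ : ∃ δ : ℝ, 0 < δ ∧ δ ≤ ρ / 2 ∧ δ ≤ (1 - ρ) / 2 ∧ δ ≤ n / 2 ∧
      δ * ((r + 1) * (2 / n)) ≤ ε / 2 := by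
    have hK : 0 < (r + 1) * (2 / n) := by positivity
    refine ⟨min (min (ρ / 2) ((1 - ρ) / 2)) (min (n / 2) (ε / 2 / ((r + 1) * (2 / n)))), ?_, ?_, ?_,
      ?_, ?_⟩
    · have : 0 < 1 - ρ := by linarith
      positivity
    · exact (min_le_left _ _).trans (min_le_left _ _)
    · exact (min_le_left _ _).trans (min_le_right _ _)
    · exact (min_le_right _ _).trans (min_le_left _ _)
    · rw [← le_div_iff₀ hK]
      exact (min_le_right _ _).trans (min_le_right _ _)
  obtain ⟨C, hC, hC'⟩ := hρ.int_bound hδ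
  obtain ⟨D, hD, hD'⟩ := hd.int_bound hδ
  set E : ℝ := 2 * (C / (ρ / 2) + C / ((1 - ρ) / 2)) with hE
  set G : ℝ := (δ * E + C) + r * (1 + δ * E + 2 * D) +
      (r + 1) * δ * (2 / n) * (1 + δ * E + 2 * D) with hG
  obtain ⟨T₀, hT₀⟩ := exists_nat_ge (G / (ε / 2))
  refine ⟨T₀, fun T hT => ?_⟩
  have hη' := hη.iterate hm hk T
  obtain ⟨g, o, g', ha, hg0, hg0'⟩ := hη'.exists_alt 0
  have hgg := ha.lt_left
  have hgg' := ha.lt_right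
  obtain ⟨z, z', hzz, h2, h3, h4⟩ := upper_chain hm hk hη T ha.front_left ha.front_right
    (by omega)
  have h5 := ha.count_right
  have h6 := label_mono m k η T hg0
  have h7 := hole_label_mono m k η T hg0'.le
  have h8 := label_le_zero_time m k η T 0
  have hz0 : label m k η 0 0 = 0 := isum_zero _
  set Φ : ℝ := -(label m k η T 0 : ℝ) with hΦ
  have hΦ0 : 0 ≤ Φ := by
    have : (label m k η T 0 : ℝ) ≤ 0 := by exact_mod_cast hz0 ▸ h8
    linarith
  have hx : ((isum (occ η) z : ℤ) : ℝ) ≤ -Φ := by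
    have : label m k η 0 z ≤ label m k η T 0 := by omega
    have h : (label m k η 0 z : ℝ) ≤ label m k η T 0 := by exact_mod_cast this
    rw [hΦ, neg_neg]; exact h
  have hy : Φ ≤ z' - ((isum (occ η) z' : ℤ) : ℝ) := by
    have : - label m k η T 0 ≤ z' - label m k η 0 z' := by omega
    have h : -(label m k η T 0 : ℝ) ≤ z' - label m k η 0 z' := by exact_mod_cast this
    exact h
  have hc : ((isum (frontInd η) z' : ℤ) : ℝ) - ((isum (frontInd η) z : ℤ) : ℝ) ≤ T + 1 := by
    have : isum (frontInd η) z' - isum (frontInd η) z ≤ T + 1 := by omega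
    exact_mod_cast this
  have hzz' : (z : ℝ) ≤ z' := by exact_mod_cast hzz
  have hfin : Φ ≤ r * T + δ * ((r + 1) * (2 / n)) * T + G :=
    upper_estimate h0 h1 hn hr hδ hδρ hδρ' hδn hC hE hΦ0 hx hy hc hzz' (hC' z).2 (hC' z').2
      (hD' z).1 (hD' z').2
  have hG' : G ≤ ε / 2 * T := by
    have h : G / (ε / 2) ≤ T := hT₀.trans (by exact_mod_cast hT)
    rw [div_le_iff₀ (by positivity)] at h
    linarith
  have hT0 : (0 : ℝ) ≤ T := by positivity
  have := mul_le_mul_of_nonneg_right hδε hT0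
  linarith

theorem flux_lower {m k : ℕ} (hm : 1 ≤ m) (hk : 1 ≤ k) {η : Road} (hη : Unbounded η) {ρ n M : ℝ}
    (h0 : 0 < ρ) (h1 : ρ < 1) (hn : 0 < n) (hρ : HasDensity (fun u => (occ η u : ℝ)) ρ)
    (hd : HasDensity (fun u => (frontInd η u : ℝ)) n) (hM : 0 ≤ M) (hM1 : M ≤ m * ρ)
    (hM2 : M ≤ k * (1 - ρ)) (hM3 : M ≤ ρ * (1 - ρ) / n) {R : ℕ} (hR1 : 4 * m ≤ ρ * R)
    (hR2 : 4 * m ≤ (1 - ρ) * R) {ε : ℝ} (hε : 0 < ε) :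
    ∃ T₀ : ℕ, ∀ T ≥ T₀, (M - ε) * T ≤ -(label m k η T 0 : ℝ) +
      M * ∑ t ∈ Finset.range T, ∑ u ∈ Finset.Ico (-((R * T : ℕ) : ℤ)) ((R * T : ℕ) : ℤ),
        (splitInd m k ((step m k)^[t] η) u : ℝ) := by
  set r := ρ * (1 - ρ) / n with hr
  have hρ' : 0 < 1 - ρ := by linarith
  have hr0 : 0 < r := by positivity
  have hm' : (1 : ℝ) ≤ m := by exact_mod_cast hm
  have hR0 : (0 : ℝ) ≤ R := by positivity
  obtain ⟨δ, hδ, hδρ, hδρ', hδε⟩ : ∃ δ : ℝ, 0 < δ ∧ δ ≤ ρ / 2 ∧ δ ≤ (1 - ρ) / 2 ∧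
      δ * ((r + 1) * (2 * R + 1)) ≤ ε / 2 := by
    have hK : 0 < (r + 1) * (2 * R + 1) := by positivity
    refine ⟨min (min (ρ / 2) ((1 - ρ) / 2)) (ε / 2 / ((r + 1) * (2 * R + 1))), ?_, ?_, ?_, ?_⟩
    · positivity
    · exact (min_le_left _ _).trans (min_le_left _ _)
    · exact (min_le_left _ _).trans (min_le_right _ _)
    · rw [← le_div_iff₀ hK]
      exact min_le_right _ _
  obtain ⟨C, hC, hC'⟩ := hρ.int_bound hδ
  obtain ⟨D, hD, hD'⟩ := hd.int_bound hδ
  set G : ℝ := 2 * C + r * (2 * D) with hG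
  obtain ⟨T₀, hT₀⟩ := exists_nat_ge (max (G / (ε / 2)) C)
  refine ⟨T₀, fun T hT => ?_⟩
  have hT' : max (G / (ε / 2)) C ≤ T := hT₀.trans (by exact_mod_cast hT)
  have hTC : C ≤ T := (le_max_right _ _).trans hT'
  have hTG : G ≤ ε / 2 * T := by
    have h : G / (ε / 2) ≤ T := (le_max_left _ _).trans hT'
    rw [div_le_iff₀ (by positivity)] at h
    linarith
  have hT0 : (0 : ℝ) ≤ T := by positivity
  have hη' := hη.iterate hm hk T
  set Φ : ℝ := -(label m k η T 0 : ℝ) with hΦ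
  have hΦm : Φ ≤ m * T := by
    rw [hΦ, label_zero]
    have : ∑ s ∈ Finset.range T, crossings m k ((step m k)^[s] η) 0 ≤ m * T := by
      calc ∑ s ∈ Finset.range T, crossings m k ((step m k)^[s] η) 0
          ≤ ∑ s ∈ Finset.range T, (m : ℤ) := Finset.sum_le_sum fun s _ => crossings_le ..
        _ = m * T := by simp [mul_comm]
    have h : ((∑ s ∈ Finset.range T, crossings m k ((step m k)^[s] η) 0 : ℤ) : ℝ) ≤ m * T := by
      exact_mod_cast this
    push_cast at h ⊢
    linarith
  -- If bond 0 lies at or inside a block of cars, the next front has the same hole label; otherwise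
  -- the preceding front has the same car label.
  obtain ⟨g, hg, hgX, hgY⟩ : ∃ g, IsFront ((step m k)^[T] η) g ∧
      label m k η T 0 ≤ label m k η T g ∧ g - label m k η T g ≤ - label m k η T 0 := by
    obtain ⟨g, o, g', ha, hg0, hg0'⟩ := hη'.exists_alt 0
    rcases le_or_gt o 0 with h | h
    · have e := label_car (label_succ m k η T) 0 g' hg0'.le
        fun i h2 h3 => ha.car i (by omega) h3
      exact ⟨g', ha.front_right, by omega, by omega⟩
    · have e := label_hole (label_succ m k η T) g 0 hg0
        fun i h2 h3 => ha.hole i h2 (by omega)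
      exact ⟨g, ha.front_left, by omega, by omega⟩
  -- Since Φ ≤ mT and C ≤ T ≤ mT, a negative u satisfies (ρ/2)|u| ≤ 2mT and a positive one (1-ρ)/2 ·
  -- u ≤ 2mT. This is the origin of the constant 4m in the conditions on R.
  have hW : ∀ u, label m k η T 0 ≤ label m k η 0 u → u - label m k η 0 u ≤ - label m k η T 0 →
      -((R * T : ℕ) : ℤ) ≤ u ∧ u ≤ ((R * T : ℕ) : ℤ) := by
    intro u h2 h3
    have h2' : -Φ ≤ ((isum (occ η) u : ℤ) : ℝ) := by
      have h : (label m k η T 0 : ℝ) ≤ label m k η 0 u := by exact_mod_cast h2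
      rw [hΦ, neg_neg]; exact h
    have h3' : u - ((isum (occ η) u : ℤ) : ℝ) ≤ Φ := by
      have h : (u : ℝ) - label m k η 0 u ≤ - label m k η T 0 := by exact_mod_cast h3
      exact h
    have hmT : (T : ℝ) ≤ m * T := le_mul_of_one_le_left hT0 hm'
    have e1 := (hC' u).1
    have e2 := (hC' u).2
    have key : -((R * T : ℕ) : ℝ) ≤ u ∧ (u : ℝ) ≤ ((R * T : ℕ) : ℝ) := by
      push_cast
      rcases le_total (u : ℝ) 0 with h | h
      · rw [abs_of_nonpos h] at e1 e2
        refine ⟨?_, h.trans (by positivity)⟩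
        have h6 := mul_le_mul_of_nonneg_right hδρ (neg_nonneg.2 h)
        have h4 : -(ρ / 2 * u) ≤ 2 * (m * T) := by linarith
        have h5 := mul_le_mul_of_nonneg_right hR1 hT0
        have h7 : ρ * -(u : ℝ) ≤ ρ * (R * T) := by linarith
        linarith [le_of_mul_le_mul_left h7 h0]
      · rw [abs_of_nonneg h] at e1 e2
        refine ⟨le_trans (neg_nonpos.2 (by positivity)) h, ?_⟩
        have h6 := mul_le_mul_of_nonneg_right hδρ' h
        have h4 : (1 - ρ) / 2 * u ≤ 2 * (m * T) := by linarith
        have h5 := mul_le_mul_of_nonneg_right hR2 hT0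
        have h7 : (1 - ρ) * u ≤ (1 - ρ) * (R * T) := by linarith
        linarith [le_of_mul_le_mul_left h7 hρ']
    exact ⟨by exact_mod_cast key.1, by exact_mod_cast key.2⟩
  obtain ⟨z, z', α, β, hzz, h2, h3, h4⟩ := lower_chain hm hk hη T hW hg hg le_rfl hgX hgY
  have hmono : ((isum (frontInd η) z : ℤ) : ℝ) ≤ ((isum (frontInd η) z' : ℤ) : ℝ) := by
    exact_mod_cast isum_mono (frontInd_nonneg η) hzz
  set S : ℝ := ∑ t ∈ Finset.range T, ∑ u ∈ Finset.Ico (-((R * T : ℕ) : ℤ)) ((R * T : ℕ) : ℤ),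
        (splitInd m k ((step m k)^[t] η) u : ℝ) with hS
  have h4' : (T : ℝ) ≤ ((isum (frontInd η) z' : ℤ) : ℝ) - ((isum (frontInd η) z : ℤ) : ℝ) + α + β + S := by
    have h : ((T : ℤ) : ℝ) ≤ ((isum (frontInd η) z' - isum (frontInd η) z + α + β +
        ∑ t ∈ Finset.range T, ∑ u ∈ Finset.Ico (-((R * T : ℕ) : ℤ)) ((R * T : ℕ) : ℤ),
          splitInd m k ((step m k)^[t] η) u : ℤ) : ℝ) := by
      exact_mod_cast (by omega)
    push_cast at h ⊢
    rw [hS]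
    push_cast
    exact h
  have h2' : -Φ + k * α ≤ ((isum (occ η) z : ℤ) : ℝ) := by
    have : label m k η T 0 + k * α ≤ label m k η 0 z := by omega
    have h : (label m k η T 0 : ℝ) + k * α ≤ label m k η 0 z := by exact_mod_cast this
    rw [hΦ, neg_neg]; exact h
  have h3' : z' - ((isum (occ η) z' : ℤ) : ℝ) + m * β ≤ Φ := by
    have : z' - label m k η 0 z' + m * β ≤ - label m k η T 0 := by omega
    have h : (z' : ℝ) - label m k η 0 z' + m * β ≤ - label m k η T 0 := by exact_mod_cast this
    exact h
  have hkα : 0 ≤ (k : ℤ) * α := by positivity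
  have hmβ : 0 ≤ (m : ℤ) * β := by positivity
  have hmz := label_mono m k η 0 hzz
  have hmz' := hole_label_mono m k η 0 hzz
  have hzW := hW z (by omega) (by omega)
  have hzW' := hW z' (by omega) (by omega)
  have habs : |(z : ℝ)| ≤ R * T := by
    rw [abs_le]
    exact ⟨by exact_mod_cast hzW.1, by exact_mod_cast hzW.2⟩
  have habs' : |(z' : ℝ)| ≤ R * T := by
    rw [abs_le]
    exact ⟨by exact_mod_cast hzW'.1, by exact_mod_cast hzW'.2⟩
  have hfin := lower_estimate h0 h1 hn hr hδ hC (by positivity) hM hM1 hM2 hM3 (Nat.cast_nonneg α)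
    (Nat.cast_nonneg β) hmono h4' h2' h3' habs habs' (hC' z).1 (hC' z').1 (hD' z).2 (hD' z').1
  have h5 := mul_le_mul_of_nonneg_right hδε hT0
  have h6 : 0 ≤ (r + 1) * δ * T := by positivity
  linarith

/-- If sums of `A` are at most sums of `B` over a chain of intervals going to the right, then the
mean of `A` is at most the mean of `B`. -/
theorem HasDensity.le_of_chain {A B : ℤ → ℝ} {α β : ℝ} (hA : HasDensity A α)
    (hB : HasDensity B β) (P : ℤ → Prop) (h0 : ∃ z, P z)
    (hP : ∀ z, P z → ∃ z', z < z' ∧ P z' ∧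
      ∑ u ∈ Finset.Ico z z', A u ≤ ∑ u ∈ Finset.Ico z z', B u) : α ≤ β := by
  obtain ⟨z₀, hz₀⟩ := h0
  have chain : ∀ N : ℕ, ∃ z, z₀ + N ≤ z ∧ P z ∧ isum A z - isum A z₀ ≤ isum B z - isum B z₀ := by
    intro N
    induction N with
    | zero => exact ⟨z₀, by simp, hz₀, by simp⟩
    | succ N ih =>
      obtain ⟨z, h1, h2, h3⟩ := ih
      obtain ⟨z', h4, h5, h6⟩ := hP z h2
      refine ⟨z', by push_cast; omega, h5, ?_⟩
      rw [← isum_add_sum A h4.le, ← isum_add_sum B h4.le]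
      linarith
  by_contra hlt
  push Not at hlt
  set ε := (α - β) / 4 with hε
  have hε0 : 0 < ε := by rw [hε]; linarith
  obtain ⟨C, hC, hC'⟩ := hA ε hε0
  obtain ⟨D, hD, hD'⟩ := hB ε hε0
  obtain ⟨N, hN⟩ := exists_nat_gt ((C + D + isum A z₀ - isum B z₀) / ε)
  obtain ⟨z, h1, -, h3⟩ := chain (N + z₀.natAbs)
  have hzN : (N : ℝ) ≤ z := by
    have : (N : ℤ) ≤ z := by omega
    exact_mod_cast this
  have hz0 : (0 : ℝ) ≤ z := le_trans (Nat.cast_nonneg N) hzN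
  have e1 := (abs_le.1 (hC' z)).1
  have e2 := (abs_le.1 (hD' z)).2
  rw [abs_of_nonneg hz0] at e1 e2
  rw [div_lt_iff₀ hε0] at hN
  have e3 : (N : ℝ) * ε ≤ z * ε := mul_le_mul_of_nonneg_right hzN hε0.le
  have e4 : α * z - β * z = 4 * (z * ε) := by rw [hε]; ring
  have e5 : 0 ≤ z * ε := by positivity
  linarith

theorem HasDensity.le_of_alt {η : Road} (hη : Unbounded η) {A B : ℤ → ℝ} {α β : ℝ}
    (hA : HasDensity A α) (hB : HasDensity B β)
    (h : ∀ z o z', Alt η z o z' → ∑ u ∈ Finset.Ico z z', A u ≤ ∑ u ∈ Finset.Ico z z', B u) :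
    α ≤ β := by
  refine hA.le_of_chain hB (IsFront η) ?_ fun z hz => ?_
  · obtain ⟨z, -, hz⟩ := (hη 0).1
    exact ⟨z, hz⟩
  · obtain ⟨o, z', ha⟩ := hη.exists_alt_left hz
    exact ⟨z', ha.lt_left.trans ha.lt_right, ha.front_right, h _ _ _ ha⟩

/-- At most `k` cars jump over each empty site. -/
theorem velocity_density_le {m k : ℕ} {η : Road} (hη : Unbounded η) {J ρ : ℝ}
    (hJ : HasDensity (fun u => (velocity η m k u : ℝ)) J)
    (hρ : HasDensity (fun u => (k : ℝ) * (1 - occ η u)) ρ) : J ≤ ρ := by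
  -- The chain uses the starts of car blocks instead of fronts, so that a block and the gap its cars
  -- move into lie in the same interval.
  refine hJ.le_of_chain hρ (fun o => η (o - 1) = false ∧ η o = true) ?_ ?_
  · obtain ⟨z, o, z', ha, -, -⟩ := hη.exists_alt 0
    exact ⟨o, ha.hole _ (by have := ha.lt_left; omega) (by omega), ha.car o le_rfl ha.lt_right⟩
  · rintro o ⟨ho1, ho2⟩
    obtain ⟨z, o₁, w, ha, h1, h2⟩ := hη.exists_alt o
    have ho : o = o₁ := by
      rcases lt_trichotomy o o₁ with h | h | h
      · exact absurd ho2 (not_true_of_false (ha.hole o h1 h))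
      · exact h
      · exact absurd (ha.car (o - 1) (by omega) (by omega)) (not_true_of_false ho1)
    subst ho
    obtain ⟨o', w', ha'⟩ := hη.exists_alt_left ha.front_right
    have l1 := ha.lt_right
    have l2 := ha'.lt_left
    have ho' := ha'.car o' le_rfl ha'.lt_right
    refine ⟨o', by omega, ⟨ha'.hole _ (by omega) (by omega), ho'⟩, ?_⟩
    have hv : ∀ u ∈ Finset.Ico o o', (velocity η m k u : ℝ) ≤
        if u ∈ Finset.Ico (w - k) w then ((o' - w : ℤ) : ℝ) else 0 := by
      intro u hu
      rw [Finset.mem_Ico] at hu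
      rcases Nat.eq_zero_or_pos (velocity η m k u) with h0 | h0
      · rw [h0]
        split_ifs
        · exact_mod_cast (by omega : (0 : ℤ) ≤ o' - w)
        · simp
      obtain ⟨l, hl, hc, hh, hg⟩ := exists_of_velocity_pos η m k u h0
      have hu' : u < w := by
        by_contra h
        exact not_true_of_false (ha'.hole u (by omega) hu.2) (hc u le_rfl (by omega))
      have hlw : u + l + 1 = w := by
        rcases lt_trichotomy (u + l + 1) w with h | h | h
        · exact absurd (ha.car _ (by omega) h) (not_true_of_false hh)
        · exact h
        · exact absurd (hc w (by omega) (by omega)) (not_true_of_false ha.hole_after)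
      rw [if_pos (Finset.mem_Ico.2 ⟨by omega, hu'⟩)]
      have : (velocity η m k u : ℤ) ≤ o' - w := by
        by_contra h
        exact not_true_of_false (hg o' (by omega) (by omega)) ho'
      exact_mod_cast this
    have hocc : ∑ u ∈ Finset.Ico o o', ((k : ℝ) * (1 - occ η u)) = k * ((o' - w : ℤ) : ℝ) := by
      rw [← Finset.mul_sum]
      congr 1
      rw [← Finset.Ico_union_Ico_eq_Ico l1.le l2.le,
        Finset.sum_union (Finset.Ico_disjoint_Ico_consecutive o w o'),
        Finset.sum_eq_zero (s := Finset.Ico o w), Finset.sum_congr (s₁ := Finset.Ico w o') rfl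
          (g := fun _ => (1 : ℝ))]
      · have : ((o' - w).toNat : ℤ) = o' - w := by omega
        have h : (((o' - w).toNat : ℤ) : ℝ) = ((o' - w : ℤ) : ℝ) := by rw [this]
        rw [Finset.sum_const, Int.card_Ico, nsmul_eq_mul, mul_one, zero_add]
        exact_mod_cast h
      · intro u hu
        rw [Finset.mem_Ico] at hu
        simp [occ, ha'.hole u hu.1 hu.2]
      · intro u hu
        rw [Finset.mem_Ico] at hu
        simp [occ, ha.car u hu.1 hu.2]
    rw [hocc]
    refine (Finset.sum_le_sum hv).trans ?_
    rw [← Finset.sum_filter, Finset.sum_const, nsmul_eq_mul]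
    refine mul_le_mul_of_nonneg_right ?_ (by exact_mod_cast (by omega : (0 : ℤ) ≤ o' - w))
    have hcard : (Finset.filter (fun u => u ∈ Finset.Ico (w - k) w) (Finset.Ico o o')).card ≤ k := by
      calc _ ≤ (Finset.Ico (w - (k : ℤ)) w).card :=
            Finset.card_le_card fun u hu => (Finset.mem_filter.1 hu).2
        _ = k := by simp
    exact_mod_cast hcard

/-! ### Weights of fronts, and blocks that produce splits. -/

/-- `a` cars before the bond `z` and an empty site after it. -/
def CarRun (η : Road) (a : ℕ) (z : ℤ) : Prop :=
  (∀ i, z - a ≤ i → i < z → η i = true) ∧ η z = false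

/-- A car before the bond `z` and `b` empty sites after it. -/
def HoleRun (η : Road) (b : ℕ) (z : ℤ) : Prop :=
  η (z - 1) = true ∧ ∀ i, z ≤ i → i < z + b → η i = false

open Classical in
/-- Indicator of a proposition. -/
noncomputable def ind (p : Prop) : ℤ := if p then 1 else 0

theorem ind_nonneg (p : Prop) : 0 ≤ ind p := by unfold ind; split_ifs <;> simp

theorem ind_pos {p : Prop} (h : p) : ind p = 1 := if_pos h

theorem ind_neg {p : Prop} (h : ¬ p) : ind p = 0 := if_neg h

theorem ind_mono {p q : Prop} (h : p → q) : ind p ≤ ind q := by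
  by_cases hp : p
  · rw [ind_pos hp, ind_pos (h hp)]
  · rw [ind_neg hp]; exact ind_nonneg q

/-- For a split: f₁ has only level 0, paid by G 0, and level j at f₂ is paid by level j + 1 of the
old front. -/
theorem sum_le_of_two {z z' f₁ f₂ : ℤ} {F : ℕ → ℤ → ℤ} {G : ℕ → ℤ} (hG : ∀ j, 0 ≤ G j)
    (hG0 : G 0 = 1) (h : ∀ f, z ≤ f → f < z' → ∀ j, F j f ≤
      (if f = f₁ then (if j = 0 then 1 else 0) else 0) + (if f = f₂ then G (j + 1) else 0))
    (J : ℕ) : ∑ f ∈ Finset.Ico z z', ∑ j ∈ Finset.range (J + 1), F j f ≤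
      ∑ j ∈ Finset.range (J + 2), G j := by
  rw [Finset.sum_range_succ' _ (J + 1), hG0, Finset.sum_comm]
  have hj : ∀ j, ∑ f ∈ Finset.Ico z z', F j f ≤ (if j = 0 then 1 else 0) + G (j + 1) := by
    intro j
    refine (Finset.sum_le_sum fun f hf =>
      h f (Finset.mem_Ico.1 hf).1 (Finset.mem_Ico.1 hf).2 j).trans ?_
    rw [Finset.sum_add_distrib, Finset.sum_ite_eq', Finset.sum_ite_eq']
    have := hG (j + 1)
    split_ifs <;> omega
  refine (Finset.sum_le_sum fun j _ => hj j).trans ?_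
  rw [Finset.sum_add_distrib, Finset.sum_ite_eq']
  simp [add_comm]

theorem sum_le_of_one {z z' f₁ : ℤ} {F : ℕ → ℤ → ℤ} {G : ℕ → ℤ} (hG : ∀ j, 0 ≤ G j)
    (h : ∀ f, z ≤ f → f < z' → ∀ j, F j f ≤ (if f = f₁ then G j else 0))
    (J : ℕ) : ∑ f ∈ Finset.Ico z z', ∑ j ∈ Finset.range (J + 1), F j f ≤
      ∑ j ∈ Finset.range (J + 2), G j := by
  rw [Finset.sum_range_succ _ (J + 1), Finset.sum_comm]
  refine (Finset.sum_le_sum (g := G) fun j _ => ?_).trans (by have := hG (J + 1); omega)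
  refine (Finset.sum_le_sum fun f hf =>
    h f (Finset.mem_Ico.1 hf).1 (Finset.mem_Ico.1 hf).2 j).trans ?_
  rw [Finset.sum_ite_eq']
  have := hG j
  split_ifs <;> omega

theorem ind_le_ite {p q : Prop} {f f₁ : ℤ} (h : p → f = f₁ ∧ q) :
    ind p ≤ if f = f₁ then ind q else 0 := by
  by_cases hp : p
  · rw [if_pos (h hp).1]
    exact ind_mono fun hp => (h hp).2
  · rw [ind_neg hp]
    split_ifs
    · exact ind_nonneg q
    · exact le_rfl

theorem ind_le_two {p q : Prop} {f f₁ f₂ : ℤ} {j : ℕ}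
    (h : p → (f = f₁ ∧ j = 0) ∨ (f = f₂ ∧ q)) :
    ind p ≤ (if f = f₁ then (if j = 0 then 1 else 0) else 0) + (if f = f₂ then ind q else 0) := by
  have hq := ind_nonneg q
  by_cases hp : p
  · rw [ind_pos hp]
    rcases h hp with ⟨h1, h2⟩ | ⟨h1, h2⟩
    · rw [if_pos h1, if_pos h2]
      split_ifs <;> omega
    · rw [if_pos h1, ind_pos h2]
      split_ifs <;> omega
  · rw [ind_neg hp]
    split_ifs <;> omega

theorem lt_of_mul_lt_self {j k : ℕ} {a : ℤ} (h : (j * k : ℕ) < a) (ha : a ≤ k) : j = 0 := by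
  by_contra hj
  have : k ≤ j * k := Nat.le_mul_of_pos_left k (Nat.pos_of_ne_zero hj)
  omega

theorem CarRun.isFront {η : Road} {a : ℕ} {z : ℤ} (h : CarRun η (a + 1) z) : IsFront η z :=
  ⟨h.1 _ (by push_cast; omega) (by omega), h.2⟩

theorem HoleRun.isFront {η : Road} {a : ℕ} {z : ℤ} (h : HoleRun η (a + 1) z) : IsFront η z :=
  ⟨h.1, h.2 z le_rfl (by push_cast; omega)⟩

/-- The inner sum is ⌈a/k⌉, truncated, for a front with a cars behind it. A split takes k cars off
the block of z', so its weight drops by one; this pays for the front at o - p, whose block has at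
most k cars. Without a split the single new front has at most the larger of z' - o and k cars behind
it. The truncation keeps the function local and is why the range grows by one. -/
theorem Alt.sum_carRun_le {m k : ℕ} {η η' : Road} {z o z' p q : ℤ}
    (h : Alt η z o z') (hs : StepShape m k η' z o z' p q) (J : ℕ) :
    ∑ f ∈ Finset.Ico z z', ∑ j ∈ Finset.range (J + 1), ind (CarRun η' (j * k + 1) f) ≤
    ∑ j ∈ Finset.range (J + 2), ind (CarRun η (j * k + 1) z') := by
  have hq := hs.q_eq
  have hp := hs.p_eq
  have hr := h.lt_right
  have run : ∀ j : ℕ, ((j * k : ℕ) : ℤ) < z' - o → CarRun η (j * k + 1) z' := fun j hj =>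
    ⟨fun i h1 h2 => h.car i (by push_cast at *; omega) h2, h.hole_after⟩
  have run0 : CarRun η (0 * k + 1) z' := run 0 (by simp; omega)
  obtain ⟨a, hak, ha⟩ := hs.group_cars
  have bound : ∀ (j : ℕ) (f s : ℤ), CarRun η' (j * k + 1) f → s < f → η' s = false →
      ((j * k : ℕ) : ℤ) < f - s - 1 := by
    intro j f s hrun hsf hs0
    by_contra hlt
    exact not_true_of_false hs0 (hrun.1 s (by push_cast at *; omega) hsf)
  by_cases hpq : 0 < p ∧ 0 < q
  · refine sum_le_of_two (f₁ := o - p) (f₂ := o + q)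
      (G := fun j => ind (CarRun η (j * k + 1) z')) (fun j => ind_nonneg _) (ind_pos run0) ?_ J
    intro f h1 h2 j
    refine ind_le_two fun hrun => ?_
    rcases (hs.isFront_iff h1 h2).1 hrun.isFront with ⟨h3, rfl⟩ | ⟨h3, rfl⟩ | h3
    · left
      have := bound j _ _ hrun (by omega) ha
      exact ⟨rfl, lt_of_mul_lt_self (k := k) (a := a) (by omega) (by omega)⟩
    · right
      refine ⟨rfl, run (j + 1) ?_⟩
      have := bound j _ (o - 1) hrun (by omega) (hs.hole _ (by omega) (by omega))
      rw [Nat.add_mul]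
      omega
    · omega
  · refine sum_le_of_one (f₁ := if 0 < p then o - p else o + q)
      (G := fun j => ind (CarRun η (j * k + 1) z')) (fun j => ind_nonneg _) ?_ J
    intro f h1 h2 j
    refine ind_le_ite fun hrun => ?_
    have hf := (hs.isFront_iff h1 h2).1 hrun.isFront
    rcases lt_or_ge 0 p with h3 | h3
    · have hfo : f = o - p := by omega
      rw [if_pos h3]
      have := bound j f _ hrun (by omega) ha
      obtain rfl := lt_of_mul_lt_self (j := j) (k := k) (a := a) (by omega) (by omega)
      exact ⟨hfo, run0⟩
    · have hfo : f = o + q := by omega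
      rw [if_neg (by omega)]
      have := bound j f _ hrun (by omega) ha
      rcases lt_or_ge 0 q with h4 | h4
      · exact ⟨hfo, run j (by omega)⟩
      · obtain rfl := lt_of_mul_lt_self (j := j) (k := k) (a := a) (by omega) (by omega)
        exact ⟨hfo, run0⟩

/-- Mirror image of `Alt.sum_carRun_le` with cars and holes exchanged; the weight is now charged to
the left front z. -/
theorem Alt.sum_holeRun_le {m k : ℕ} {η η' : Road} {z o z' p q : ℤ}
    (h : Alt η z o z') (hs : StepShape m k η' z o z' p q) (J : ℕ) :
    ∑ f ∈ Finset.Ico z z', ∑ j ∈ Finset.range (J + 1), ind (HoleRun η' (j * m + 1) f) ≤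
    ∑ j ∈ Finset.range (J + 2), ind (HoleRun η (j * m + 1) z) := by
  have hq := hs.q_eq
  have hp := hs.p_eq
  have hl := h.lt_left
  have run : ∀ j : ℕ, ((j * m : ℕ) : ℤ) < o - z → HoleRun η (j * m + 1) z := fun j hj =>
    ⟨h.car_before, fun i h1 h2 => h.hole i h1 (by push_cast at *; omega)⟩
  have run0 : HoleRun η (0 * m + 1) z := run 0 (by simp; omega)
  obtain ⟨b, hbm, hb⟩ := hs.group_holes
  have bound : ∀ (j : ℕ) (f s : ℤ), HoleRun η' (j * m + 1) f → f ≤ s → η' s = true →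
      ((j * m : ℕ) : ℤ) < s - f := by
    intro j f s hrun hsf hs0
    by_contra hlt
    exact not_true_of_false (hrun.2 s hsf (by push_cast at *; omega)) hs0
  by_cases hpq : 0 < p ∧ 0 < q
  · refine sum_le_of_two (f₁ := o + q) (f₂ := o - p)
      (G := fun j => ind (HoleRun η (j * m + 1) z)) (fun j => ind_nonneg _) (ind_pos run0) ?_ J
    intro f h1 h2 j
    refine ind_le_two fun hrun => ?_
    rcases (hs.isFront_iff h1 h2).1 hrun.isFront with ⟨h3, rfl⟩ | ⟨h3, rfl⟩ | h3
    · right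
      refine ⟨rfl, run (j + 1) ?_⟩
      have := bound j _ o hrun (by omega) (hs.car _ le_rfl (by omega))
      rw [Nat.add_mul]
      omega
    · left
      have := bound j _ _ hrun (by omega) hb
      exact ⟨rfl, lt_of_mul_lt_self (k := m) (a := b) (by omega) (by omega)⟩
    · omega
  · refine sum_le_of_one (f₁ := if 0 < q then o + q else o - p)
      (G := fun j => ind (HoleRun η (j * m + 1) z)) (fun j => ind_nonneg _) ?_ J
    intro f h1 h2 j
    refine ind_le_ite fun hrun => ?_
    have hf := (hs.isFront_iff h1 h2).1 hrun.isFront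
    rcases lt_or_ge 0 q with h3 | h3
    · have hfo : f = o + q := by omega
      rw [if_pos h3]
      have := bound j f _ hrun (by omega) hb
      obtain rfl := lt_of_mul_lt_self (j := j) (k := m) (a := b) (by omega) (by omega)
      exact ⟨hfo, run0⟩
    · have hfo : f = o - p := by omega
      rw [if_neg (by omega)]
      have := bound j f _ hrun (by omega) hb
      rcases lt_or_ge 0 p with h4 | h4
      · exact ⟨hfo, run j (by omega)⟩
      · obtain rfl := lt_of_mul_lt_self (j := j) (k := m) (a := b) (by omega) (by omega)
        exact ⟨hfo, run0⟩

/-- `b` empty sites before the bond `o` and `a` cars after it. -/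
def Facing (η : Road) (b a : ℕ) (o : ℤ) : Prop :=
  (∀ i, o - b ≤ i → i < o → η i = false) ∧ ∀ i, o ≤ i → i < o + a → η i = true

/-- A step fills at most the m leftmost holes and removes at most the k rightmost cars of the two
blocks. -/
theorem Facing.step {m k b a : ℕ} {η : Road} {o : ℤ} (h : Facing η (b + m) (a + k) o) :
    Facing (step m k η) b a o :=
  ⟨fun u h1 h2 => step_hole m k η u fun i h3 h4 => h.1 i (by push_cast; omega) (by omega),
    fun u h1 h2 => step_car m k η u fun i h3 h4 => h.2 i (by omega) (by push_cast; omega)⟩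

theorem isSplit_iff_facing (m k : ℕ) (η : Road) (o : ℤ) :
    IsSplit m k η o ↔ Facing η (m + 1) (k + 1) o := by
  constructor
  · rintro ⟨h1, h2⟩
    exact ⟨fun i h3 h4 => h1 i (by push_cast at h3; omega) h4,
      fun i h3 h4 => h2 i h3 (by push_cast at h4; omega)⟩
  · rintro ⟨h1, h2⟩
    exact ⟨fun i h3 h4 => h1 i (by push_cast; omega) h4,
      fun i h3 h4 => h2 i h3 (by push_cast; omega)⟩

theorem Facing.isSplit_iterate {m k : ℕ} (t : ℕ) {η : Road} {o : ℤ}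
    (h : Facing η ((t + 1) * m + 1) ((t + 1) * k + 1) o) :
    IsSplit m k ((TrafficRule.step m k)^[t] η) o := by
  induction t generalizing η with
  | zero => rw [isSplit_iff_facing]; simpa using h
  | succ t ih =>
    rw [Function.iterate_succ_apply]
    refine ih (Facing.step ?_)
    convert h using 1 <;> ring

/-! ### Local functions and translations. -/

/-- `g` depends on finitely many sites only. -/
def IsLocal {β : Type*} (g : Road → β) : Prop :=
  ∃ R : ℕ, ∀ η η' : Road, (∀ i : ℤ, -R ≤ i → i ≤ R → η i = η' i) → g η = g η'

theorem IsLocal.comp {β γ : Type*} {g : Road → β} (hg : IsLocal g) (φ : β → γ) :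
    IsLocal fun η => φ (g η) := by
  obtain ⟨R, hR⟩ := hg
  exact ⟨R, fun η η' h => congrArg φ (hR η η' h)⟩

theorem IsLocal.comp₂ {β γ δ : Type*} {g : Road → β} {g' : Road → γ} (hg : IsLocal g)
    (hg' : IsLocal g') (φ : β → γ → δ) : IsLocal fun η => φ (g η) (g' η) := by
  obtain ⟨R, hR⟩ := hg
  obtain ⟨R', hR'⟩ := hg'
  refine ⟨R + R', fun η η' h => ?_⟩
  beta_reduce
  rw [hR η η' fun i h1 h2 => h i (by push_cast; omega) (by push_cast; omega),
    hR' η η' fun i h1 h2 => h i (by push_cast; omega) (by push_cast; omega)]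

theorem isLocal_const {β : Type*} (c : β) : IsLocal fun _ : Road => c := ⟨0, fun _ _ _ => rfl⟩

theorem isLocal_sum {ι : Type*} (s : Finset ι) {g : ι → Road → ℝ} (h : ∀ i ∈ s, IsLocal (g i)) :
    IsLocal fun η => ∑ i ∈ s, g i η := by
  classical
  induction s using Finset.induction_on with
  | empty => simpa using isLocal_const (0 : ℝ)
  | insert a s ha ih =>
    simp only [Finset.sum_insert ha]
    exact (h a (by simp)).comp₂ (ih fun i hi => h i (by simp [hi])) (· + ·)

theorem isLocal_of_window {β : Type*} {g : Road → β} (a b : ℤ)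
    (h : ∀ η η' : Road, (∀ i, a ≤ i → i ≤ b → η i = η' i) → g η = g η') : IsLocal g :=
  ⟨a.natAbs + b.natAbs, fun η η' h' => h η η' fun i h1 h2 =>
    h' i (by omega) (by omega)⟩

theorem gap_congr {η η' : Road} (m : ℕ) (j : ℤ) (h : ∀ i, j ≤ i → i ≤ j + m → η i = η' i) :
    gap η m j = gap η' m j := by
  induction m generalizing j with
  | zero => rfl
  | succ m ih =>
    rw [gap, gap, h j le_rfl (by omega), ih (j + 1) fun i h1 h2 =>
      h i (by omega) (by push_cast; omega)]

theorem velocity_congr {η η' : Road} (m k : ℕ) (j : ℤ)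
    (h : ∀ i, j ≤ i → i ≤ j + m + k → η i = η' i) : velocity η m k j = velocity η' m k j := by
  induction k generalizing j with
  | zero => rfl
  | succ k ih =>
    rw [velocity, velocity, h j le_rfl (by omega), h (j + 1) (by omega) (by push_cast; omega),
      ih (j + 1) fun i h1 h2 => h i (by omega) (by push_cast; omega),
      gap_congr m (j + 1) fun i h1 h2 => h i (by omega) (by push_cast; omega)]

theorem step_congr {η η' : Road} (m k : ℕ) (u : ℤ)
    (h : ∀ i, u - m ≤ i → i ≤ u + m + k → η i = η' i) : step m k η u = step m k η' u := by
  have key : ∀ η η' : Road, (∀ i, u - m ≤ i → i ≤ u + m + k → η i = η' i) →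
      step m k η u = true → step m k η' u = true := by
    intro η η' h h1
    rw [step_eq_true] at h1 ⊢
    obtain ⟨j, hj, e⟩ := h1
    have := velocity_le η m k j
    refine ⟨j, by rw [← h j (by omega) (by omega), hj], ?_⟩
    rw [← velocity_congr m k j fun i h1 h2 => h i (by omega) (by omega), e]
  rw [Bool.eq_iff_iff]
  exact ⟨key η η' h, key η' η fun i h1 h2 => (h i h1 h2).symm⟩

/-- Finite speed of propagation; it makes every quantity at a fixed time a local function of the
initial state. -/
theorem IsLocal.step {β : Type*} {g : Road → β} (hg : IsLocal g) (m k : ℕ) :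
    IsLocal fun η => g (step m k η) := by
  obtain ⟨R, hR⟩ := hg
  refine ⟨R + m + k, fun η η' h => hR _ _ fun i h1 h2 => step_congr m k i fun j h3 h4 =>
    h j (by push_cast; omega) (by push_cast; omega)⟩

theorem IsLocal.iterate {β : Type*} {g : Road → β} (hg : IsLocal g) (m k t : ℕ) :
    IsLocal fun η => g ((TrafficRule.step m k)^[t] η) := by
  induction t with
  | zero => exact hg
  | succ t ih =>
    simp only [Function.iterate_succ_apply]
    exact ih.step m k

theorem isLocal_velocity (m k : ℕ) (i : ℤ) : IsLocal fun η => velocity η m k i :=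
  isLocal_of_window i (i + m + k) fun _ _ h => velocity_congr m k i h

theorem isLocal_occ (i : ℤ) : IsLocal fun η => occ η i :=
  isLocal_of_window i i fun η η' h => by rw [occ, occ, h i le_rfl le_rfl]

theorem isLocal_crossings (m k : ℕ) (i : ℤ) : IsLocal fun η => crossings m k η i :=
  isLocal_of_window (i - m - 1) (i + m + k) fun η η' h => by
    refine Finset.sum_congr rfl fun d hd => ?_
    rw [Finset.mem_range] at hd
    rw [velocity_congr m k (i - 1 - d) fun j h1 h2 => h j (by omega) (by omega)]

theorem isFront_congr {η η' : Road} {z : ℤ} (h : ∀ i, z - 1 ≤ i → i ≤ z → η i = η' i) :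
    IsFront η z ↔ IsFront η' z := by
  rw [IsFront, IsFront, h (z - 1) le_rfl (by omega), h z (by omega) le_rfl]

theorem isLocal_frontInd (z : ℤ) : IsLocal fun η => frontInd η z :=
  isLocal_of_window (z - 1) z fun η η' h => by
    exact congrArg ind (propext (isFront_congr h))

theorem facing_congr {η η' : Road} {b a : ℕ} {o : ℤ}
    (h : ∀ i, o - b ≤ i → i ≤ o + a → η i = η' i) : Facing η b a o ↔ Facing η' b a o := by
  unfold Facing
  constructor <;> rintro ⟨h1, h2⟩ <;> constructor <;> intro i h3 h4
  · rw [← h i h3 (by omega)]; exact h1 i h3 h4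
  · rw [← h i (by omega) (by omega)]; exact h2 i h3 h4
  · rw [h i h3 (by omega)]; exact h1 i h3 h4
  · rw [h i (by omega) (by omega)]; exact h2 i h3 h4

theorem isLocal_splitInd (m k : ℕ) (o : ℤ) : IsLocal fun η => splitInd m k η o :=
  isLocal_of_window (o - (m + 1 : ℕ)) (o + (k + 1 : ℕ)) fun η η' h => by
    refine congrArg ind (propext ?_)
    rw [isSplit_iff_facing, isSplit_iff_facing, facing_congr h]

theorem isLocal_carRun (a : ℕ) (z : ℤ) : IsLocal fun η => ind (CarRun η a z) :=
  isLocal_of_window (z - a) z fun η η' h => by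
    have : CarRun η a z ↔ CarRun η' a z := by
      unfold CarRun
      rw [h z (by omega) le_rfl]
      refine and_congr_left fun _ => forall_congr' fun i => ?_
      refine forall_congr' fun h1 => forall_congr' fun h2 => ?_
      rw [h i h1 h2.le]
    simp only [this]

theorem isLocal_holeRun (b : ℕ) (z : ℤ) : IsLocal fun η => ind (HoleRun η b z) :=
  isLocal_of_window (z - 1) (z + b) fun η η' h => by
    have : HoleRun η b z ↔ HoleRun η' b z := by
      unfold HoleRun
      rw [h (z - 1) le_rfl (by omega)]
      refine and_congr_right fun _ => forall_congr' fun i => ?_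
      refine forall_congr' fun h1 => forall_congr' fun h2 => ?_
      rw [h i (by omega) h2.le]
    simp only [this]

/-- Translation of a state. -/
def shift (u : ℤ) (η : Road) : Road := fun i => η (i + u)

theorem gap_shift (η : Road) (m : ℕ) (u j : ℤ) : gap (shift u η) m j = gap η m (j + u) := by
  induction m generalizing j with
  | zero => rfl
  | succ m ih => rw [gap, gap, ih, shift, add_right_comm]

theorem velocity_shift (η : Road) (m k : ℕ) (u j : ℤ) :
    velocity (shift u η) m k j = velocity η m k (j + u) := by
  induction k generalizing j with
  | zero => rfl
  | succ k ih => rw [velocity, velocity, ih, gap_shift, shift, shift, add_right_comm]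

theorem step_shift (m k : ℕ) (u : ℤ) (η : Road) :
    step m k (shift u η) = shift u (step m k η) := by
  funext i
  rw [Bool.eq_iff_iff, step_eq_true, shift, step_eq_true]
  constructor
  · rintro ⟨j, h1, h2⟩
    refine ⟨j + u, h1, ?_⟩
    rw [velocity_shift] at h2
    omega
  · rintro ⟨j, h1, h2⟩
    refine ⟨j - u, by rw [shift, sub_add_cancel]; exact h1, ?_⟩
    rw [velocity_shift, sub_add_cancel]
    omega

theorem iterate_shift (m k t : ℕ) (u : ℤ) (η : Road) :
    (step m k)^[t] (shift u η) = shift u ((step m k)^[t] η) := by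
  induction t with
  | zero => rfl
  | succ t ih => rw [Function.iterate_succ_apply', ih, step_shift, Function.iterate_succ_apply']

theorem occ_shift (u : ℤ) (η : Road) (i : ℤ) : occ (shift u η) i = occ η (i + u) := rfl

theorem crossings_shift (m k : ℕ) (u : ℤ) (η : Road) (i : ℤ) :
    crossings m k (shift u η) i = crossings m k η (i + u) := by
  refine Finset.sum_congr rfl fun d _ => ?_
  rw [velocity_shift, show i - 1 - (d : ℤ) + u = i + u - 1 - d by ring]

theorem isFront_shift (u : ℤ) (η : Road) (z : ℤ) : IsFront (shift u η) z ↔ IsFront η (z + u) := by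
  rw [IsFront, IsFront, shift, shift, show z - 1 + u = z + u - 1 by ring]

theorem frontInd_shift (u : ℤ) (η : Road) (z : ℤ) :
    frontInd (shift u η) z = frontInd η (z + u) := by
  exact congrArg ind (propext (isFront_shift u η z))

theorem facing_shift (u : ℤ) (η : Road) (b a : ℕ) (o : ℤ) :
    Facing (shift u η) b a o ↔ Facing η b a (o + u) := by
  unfold Facing shift
  constructor <;> rintro ⟨h1, h2⟩ <;> constructor <;> intro i h3 h4
  · simpa using h1 (i - u) (by omega) (by omega)
  · simpa using h2 (i - u) (by omega) (by omega)
  · exact h1 (i + u) (by omega) (by omega)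
  · exact h2 (i + u) (by omega) (by omega)

theorem splitInd_shift (m k : ℕ) (u : ℤ) (η : Road) (o : ℤ) :
    splitInd m k (shift u η) o = splitInd m k η (o + u) := by
  refine congrArg ind (propext ?_)
  rw [isSplit_iff_facing, isSplit_iff_facing, facing_shift]

theorem carRun_shift (u : ℤ) (η : Road) (a : ℕ) (z : ℤ) :
    CarRun (shift u η) a z ↔ CarRun η a (z + u) := by
  unfold CarRun shift
  refine and_congr_left fun _ => ⟨fun h i h1 h2 => ?_, fun h i h1 h2 => ?_⟩
  · simpa using h (i - u) (by omega) (by omega)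
  · exact h (i + u) (by omega) (by omega)

theorem holeRun_shift (u : ℤ) (η : Road) (b : ℕ) (z : ℤ) :
    HoleRun (shift u η) b z ↔ HoleRun η b (z + u) := by
  unfold HoleRun shift
  rw [show z - 1 + u = z + u - 1 by ring]
  refine and_congr_right fun _ => ⟨fun h i h1 h2 => ?_, fun h i h1 h2 => ?_⟩
  · simpa using h (i - u) (by omega) (by omega)
  · exact h (i + u) (by omega) (by omega)

/-! ### The law of large numbers for local functions. -/

instance (ρ : unitInterval) : IsProbabilityMeasure (initialLaw ρ) := by
  unfold initialLaw; infer_instance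

/-- A local function factors through the restriction to a finite window, also after a shift. -/
theorem IsLocal.factor {g : Road → ℝ} {R : ℕ}
    (hR : ∀ η η' : Road, (∀ i : ℤ, -R ≤ i → i ≤ R → η i = η' i) → g η = g η') (u : ℤ) :
    ∃ G : (Finset.Icc (u - R) (u + R) → Bool) → ℝ, Measurable G ∧
      ∀ η, g (shift u η) = G fun i => η i := by
  classical
  refine ⟨fun x => g fun i => if h : i + u ∈ Finset.Icc (u - (R : ℤ)) (u + R) then x ⟨i + u, h⟩
    else false, Measurable.of_discrete, fun η => hR _ _ fun i h1 h2 => ?_⟩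
  have : i + u ∈ Finset.Icc (u - (R : ℤ)) (u + R) := Finset.mem_Icc.2 ⟨by omega, by omega⟩
  rw [dif_pos this]
  rfl

theorem measurable_shift (u : ℤ) : Measurable (shift u) :=
  measurable_pi_lambda _ fun i => measurable_pi_apply (i + u)

theorem shift_zero (η : Road) : shift 0 η = η := by funext i; simp [shift]

theorem IsLocal.measurable {g : Road → ℝ} (hg : IsLocal g) : Measurable g := by
  obtain ⟨R, hR⟩ := hg
  obtain ⟨G, hG, h⟩ := IsLocal.factor hR 0
  have : g = fun η => G fun i => η i := by
    funext η
    rw [← h, shift_zero]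
  rw [this]
  exact hG.comp (measurable_pi_lambda _ fun i => measurable_pi_apply _)

theorem IsLocal.bounded {g : Road → ℝ} (hg : IsLocal g) : ∃ C, 0 ≤ C ∧ ∀ η, |g η| ≤ C := by
  obtain ⟨R, hR⟩ := hg
  obtain ⟨G, -, h⟩ := IsLocal.factor hR 0
  refine ⟨∑ x, |G x|, Finset.sum_nonneg fun _ _ => abs_nonneg _, fun η => ?_⟩
  have := h η
  rw [shift_zero] at this
  rw [this]
  exact Finset.single_le_sum (f := fun x => |G x|) (fun _ _ => abs_nonneg _) (Finset.mem_univ _)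

theorem IsLocal.integrable {g : Road → ℝ} (hg : IsLocal g) (ρ : unitInterval) :
    Integrable g (initialLaw ρ) := by
  obtain ⟨C, -, hC⟩ := hg.bounded
  exact Integrable.of_bound hg.measurable.aestronglyMeasurable C (ae_of_all _ hC)

theorem map_shift (ρ : unitInterval) (u : ℤ) : (initialLaw ρ).map (shift u) = initialLaw ρ := by
  unfold initialLaw
  refine Measure.eq_infinitePi _ fun s t ht => ?_
  classical
  rw [Measure.map_apply (measurable_shift u) (MeasurableSet.pi s.countable_toSet fun i _ => ht i)]
  have : shift u ⁻¹' (Set.pi s t) =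
      Set.pi (s.map (Equiv.addRight u).toEmbedding : Finset ℤ) fun i => t (i - u) := by
    ext η
    simp only [shift, Set.mem_preimage, Set.mem_pi, Finset.coe_map, Equiv.coe_toEmbedding,
      Equiv.coe_addRight, Set.mem_image, forall_exists_index, and_imp, forall_apply_eq_imp_iff₂,
      add_sub_cancel_right]
  rw [this, Measure.infinitePi_pi _ fun i _ => ht _]
  simp

theorem integral_shift (ρ : unitInterval) (u : ℤ) {g : Road → ℝ} (hg : IsLocal g) :
    ∫ η, g (shift u η) ∂(initialLaw ρ) = ∫ η, g η ∂(initialLaw ρ) := by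
  conv_rhs => rw [← map_shift ρ u]
  rw [integral_map (measurable_shift u).aemeasurable hg.measurable.aestronglyMeasurable]

theorem indep_shift (ρ : unitInterval) {g : Road → ℝ} {R : ℕ}
    (hR : ∀ η η' : Road, (∀ i : ℤ, -R ≤ i → i ≤ R → η i = η' i) → g η = g η') {u v : ℤ}
    (huv : 2 * (R : ℤ) < |u - v|) :
    IndepFun (fun η => g (shift u η)) (fun η => g (shift v η)) (initialLaw ρ) := by
  obtain ⟨G, hG, hG'⟩ := IsLocal.factor hR u
  obtain ⟨H, hH, hH'⟩ := IsLocal.factor hR v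
  simp only [hG', hH']
  have hi : iIndepFun (fun (i : ℤ) (η : Road) => η i) (initialLaw ρ) :=
    iIndepFun_infinitePi (X := fun _ x => x) fun _ => measurable_id
  have hd : Disjoint (Finset.Icc (u - (R : ℤ)) (u + R)) (Finset.Icc (v - (R : ℤ)) (v + R)) := by
    rw [Finset.disjoint_left]
    intro i h1 h2
    rw [Finset.mem_Icc] at h1 h2
    rcases abs_cases (u - v) with h | h <;> omega
  exact (hi.indepFun_finset _ _ hd fun i => measurable_pi_apply i).comp hG hH

/-- A linear-deviation form of convergence of averages. -/
theorem exists_linear_bound {S : ℕ → ℝ} {E : ℝ}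
    (h : Tendsto (fun n : ℕ => S n / n) atTop (𝓝 E)) {ε : ℝ} (hε : 0 < ε) :
    ∃ C, 0 ≤ C ∧ ∀ n : ℕ, |S n - n * E| ≤ ε * n + C := by
  obtain ⟨N, hN⟩ := Metric.tendsto_atTop.1 h ε hε
  refine ⟨∑ n ∈ Finset.range (N + 1), |S n - n * E|, Finset.sum_nonneg fun _ _ => abs_nonneg _,
    fun n => ?_⟩
  rcases lt_or_ge n (N + 1) with hn | hn
  · have := Finset.single_le_sum (f := fun n : ℕ => |S n - n * E|) (fun _ _ => abs_nonneg _)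
      (Finset.mem_range.2 hn)
    have h0 : 0 ≤ ε * n := by positivity
    linarith
  · have hn0 : (0 : ℝ) < n := by exact_mod_cast (by omega : 0 < n)
    have h1 := (hN n (by omega)).le
    rw [Real.dist_eq, div_sub' hn0.ne', abs_div, abs_of_pos hn0, div_le_iff₀ hn0] at h1
    have h0 : 0 ≤ ∑ n ∈ Finset.range (N + 1), |S n - n * E| :=
      Finset.sum_nonneg fun _ _ => abs_nonneg _
    linarith

theorem sum_range_mul_add (f : ℕ → ℝ) (L q : ℕ) :
    ∑ u ∈ Finset.range (q * L), f u =
      ∑ r ∈ Finset.range L, ∑ i ∈ Finset.range q, f (i * L + r) := by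
  rw [Finset.sum_comm]
  induction q with
  | zero => simp
  | succ q ih =>
    rw [Nat.add_mul, one_mul, Finset.sum_range_add, ih, Finset.sum_range_succ]

/-- Averages along the strides of length `L` control the averages of a bounded sequence. -/
theorem linear_bound_of_strides {f : ℕ → ℝ} {C E : ℝ} (hf : ∀ u, |f u| ≤ C) {L : ℕ} (hL : 0 < L)
    (h : ∀ r < L, Tendsto (fun n : ℕ => (∑ i ∈ Finset.range n, f (i * L + r)) / n) atTop (𝓝 E))
    {ε : ℝ} (hε : 0 < ε) :
    ∃ D, 0 ≤ D ∧ ∀ N : ℕ, |∑ u ∈ Finset.range N, f u - N * E| ≤ ε * N + D := by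
  choose! D hD hD' using fun r hr => exists_linear_bound (h r hr) hε
  have hC : 0 ≤ C := (abs_nonneg _).trans (hf 0)
  refine ⟨∑ r ∈ Finset.range L, D r + L * (C + |E|), ?_, fun N => ?_⟩
  · have := Finset.sum_nonneg fun r hr => hD r (Finset.mem_range.1 hr)
    positivity
  obtain ⟨q, s, hs, rfl⟩ : ∃ q s, s < L ∧ N = q * L + s :=
    ⟨N / L, N % L, Nat.mod_lt _ hL, by rw [mul_comm]; exact (Nat.div_add_mod N L).symm⟩
  rw [Finset.sum_range_add, sum_range_mul_add]
  have h1 : |∑ r ∈ Finset.range L, ∑ i ∈ Finset.range q, f (i * L + r) - L * (q * E)| ≤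
      L * (ε * q) + ∑ r ∈ Finset.range L, D r := by
    have e : ∑ r ∈ Finset.range L, ∑ i ∈ Finset.range q, f (i * L + r) - L * (q * E) =
        ∑ r ∈ Finset.range L, (∑ i ∈ Finset.range q, f (i * L + r) - q * E) := by
      rw [Finset.sum_sub_distrib]; simp
    rw [e]
    refine (Finset.abs_sum_le_sum_abs _ _).trans ?_
    refine (Finset.sum_le_sum fun r hr => hD' r (Finset.mem_range.1 hr) q).trans ?_
    rw [Finset.sum_add_distrib]; simp
  have h2 : |∑ x ∈ Finset.range s, f (q * L + x)| ≤ L * C := by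
    refine (Finset.abs_sum_le_sum_abs _ _).trans ?_
    refine (Finset.sum_le_sum fun r _ => hf (q * L + r)).trans ?_
    rw [Finset.sum_const, Finset.card_range, nsmul_eq_mul]
    exact mul_le_mul_of_nonneg_right (by exact_mod_cast hs.le) hC
  have h3 : |(s : ℝ) * E| ≤ L * |E| := by
    rw [abs_mul, abs_of_nonneg (Nat.cast_nonneg s)]
    exact mul_le_mul_of_nonneg_right (by exact_mod_cast hs.le) (abs_nonneg E)
  have h4 : 0 ≤ ε * s := by positivity
  rw [abs_le] at h1 h2 h3 ⊢
  push_cast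
  constructor <;> linarith [h1.1, h1.2, h2.1, h2.2, h3.1, h3.2]

/-- Translates by multiples of 2R + 1 depend on disjoint windows, so the strong law applies on each
residue class. The map e lets one argument serve both half-lines. -/
theorem ae_linear_bound (ρ : unitInterval) {g : Road → ℝ} (hg : IsLocal g) (e : ℕ → ℤ)
    (he : ∀ u v, |e u - e v| = |(u : ℤ) - v|) :
    ∀ᵐ η ∂(initialLaw ρ), ∀ ε : ℝ, 0 < ε → ∃ D, 0 ≤ D ∧ ∀ N : ℕ,
      |∑ u ∈ Finset.range N, g (shift (e u) η) - N * ∫ η, g η ∂(initialLaw ρ)| ≤ ε * N + D := by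
  obtain ⟨R, hR⟩ := id hg
  obtain ⟨C, hC, hC'⟩ := hg.bounded
  have hm : ∀ u, Measurable fun η => g (shift u η) := fun u => hg.measurable.comp (measurable_shift u)
  have key : ∀ r : ℕ, ∀ᵐ η ∂(initialLaw ρ), Tendsto (fun n : ℕ =>
      (∑ i ∈ Finset.range n, g (shift (e (i * (2 * R + 1) + r)) η)) / n) atTop
      (𝓝 (∫ η, g η ∂(initialLaw ρ))) := by
    intro r
    have := strong_law_ae_real (μ := initialLaw ρ)
      (fun i η => g (shift (e (i * (2 * R + 1) + r)) η))
      (Integrable.of_bound (hm _).aestronglyMeasurable C (ae_of_all _ fun η => hC' _)) ?_ ?_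
    · rw [integral_shift ρ _ hg] at this
      exact this
    · intro i j hij
      refine indep_shift ρ hR ?_
      rw [he]
      have : (((i * (2 * R + 1) + r : ℕ) : ℤ) - ((j * (2 * R + 1) + r : ℕ) : ℤ)) =
        (i - j) * (2 * R + 1) := by push_cast; ring
      rw [this, abs_mul, abs_of_nonneg (show (0 : ℤ) ≤ 2 * R + 1 by positivity)]
      have h1 : 1 ≤ |(i : ℤ) - j| := Int.one_le_abs (by omega)
      nlinarith
    · intro i
      refine ⟨(hm _).aemeasurable, (hm _).aemeasurable, ?_⟩
      have : ∀ u, (initialLaw ρ).map (fun η => g (shift u η)) = (initialLaw ρ).map g := by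
        intro u
        conv_rhs => rw [← map_shift ρ u, Measure.map_map hg.measurable (measurable_shift u)]
        rfl
      rw [this, this]
  have hall := ae_all_iff.2 key
  filter_upwards [hall] with η hη ε hε
  exact linear_bound_of_strides (f := fun u => g (shift (e u) η)) (fun u => hC' _)
    (L := 2 * R + 1) (by omega) (fun r _ => hη r) hε

theorem isum_natCast (f : ℤ → ℝ) (N : ℕ) : isum f N = ∑ u ∈ Finset.range N, f u := by
  induction N with
  | zero => simp [isum]
  | succ N ih => rw [Finset.sum_range_succ, ← ih]; push_cast; exact isum_succ f N

theorem isum_neg_natCast (f : ℤ → ℝ) (N : ℕ) :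
    isum f (-N) = -∑ u ∈ Finset.range N, f (-1 - u) := by
  induction N with
  | zero => simp [isum]
  | succ N ih =>
    have := isum_succ f (-((N + 1 : ℕ) : ℤ))
    rw [show -((N + 1 : ℕ) : ℤ) + 1 = -N by push_cast; ring, ih] at this
    rw [Finset.sum_range_succ, show (-1 - (N : ℤ)) = -((N + 1 : ℕ) : ℤ) by push_cast; ring]
    linarith

theorem ae_hasDensity (ρ : unitInterval) {g : Road → ℝ} (hg : IsLocal g) :
    ∀ᵐ η ∂(initialLaw ρ), HasDensity (fun u => g (shift u η)) (∫ η, g η ∂(initialLaw ρ)) := by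
  filter_upwards [ae_linear_bound ρ hg (fun u => u) (fun _ _ => rfl),
    ae_linear_bound ρ hg (fun u => -1 - u) (fun u v => by
      rw [show -1 - (u : ℤ) - (-1 - v) = -(u - v) by ring, abs_neg])] with η h1 h2 ε hε
  obtain ⟨C, hC, hC'⟩ := h1 ε hε
  obtain ⟨D, hD, hD'⟩ := h2 ε hε
  refine ⟨C + D, by positivity, fun z => ?_⟩
  rcases Int.eq_nat_or_neg z with ⟨N, rfl | rfl⟩
  · have := hC' N
    rw [isum_natCast]
    push_cast
    rw [Nat.abs_cast, mul_comm _ (N : ℝ)]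
    linarith
  · have := hD' N
    rw [isum_neg_natCast]
    push_cast
    rw [abs_neg, Nat.abs_cast, ← abs_neg,
      show ∀ x I : ℝ, -(-x - I * -(N : ℝ)) = x - N * I by intros; ring]
    linarith

/-! ### Mean flow, front density and split density. -/

/-- Expected velocity at a site at time `t`. -/
noncomputable def meanFlow (m k : ℕ) (ρ : unitInterval) (t : ℕ) : ℝ :=
  ∫ η, (velocity ((step m k)^[t] η) m k 0 : ℝ) ∂(initialLaw ρ)

/-- Probability of a front at a given bond at time `t`. -/
noncomputable def frontDensity (m k : ℕ) (ρ : unitInterval) (t : ℕ) : ℝ :=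
  ∫ η, (frontInd ((step m k)^[t] η) 0 : ℝ) ∂(initialLaw ρ)

/-- Probability of a split at a given bond at time `t`. -/
noncomputable def splitDensity (m k : ℕ) (ρ : unitInterval) (t : ℕ) : ℝ :=
  ∫ η, (splitInd m k ((step m k)^[t] η) 0 : ℝ) ∂(initialLaw ρ)

theorem isLocal_velocity_iterate (m k t : ℕ) (i : ℤ) :
    IsLocal fun η => (velocity ((step m k)^[t] η) m k i : ℝ) :=
  ((isLocal_velocity m k i).comp (fun n : ℕ => (n : ℝ))).iterate m k t

theorem isLocal_occ_iterate (m k t : ℕ) (i : ℤ) :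
    IsLocal fun η => (occ ((step m k)^[t] η) i : ℝ) :=
  ((isLocal_occ i).comp (fun n : ℤ => (n : ℝ))).iterate m k t

theorem isLocal_crossings_iterate (m k t : ℕ) (i : ℤ) :
    IsLocal fun η => (crossings m k ((step m k)^[t] η) i : ℝ) :=
  ((isLocal_crossings m k i).comp (fun n : ℤ => (n : ℝ))).iterate m k t

theorem isLocal_frontInd_iterate (m k t : ℕ) (i : ℤ) :
    IsLocal fun η => (frontInd ((step m k)^[t] η) i : ℝ) :=
  ((isLocal_frontInd i).comp (fun n : ℤ => (n : ℝ))).iterate m k t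

theorem isLocal_splitInd_iterate (m k t : ℕ) (i : ℤ) :
    IsLocal fun η => (splitInd m k ((step m k)^[t] η) i : ℝ) :=
  ((isLocal_splitInd m k i).comp (fun n : ℤ => (n : ℝ))).iterate m k t

theorem ae_velocity_density (m k : ℕ) (ρ : unitInterval) (t : ℕ) :
    ∀ᵐ η ∂(initialLaw ρ), HasDensity (fun u => (velocity ((step m k)^[t] η) m k u : ℝ))
      (meanFlow m k ρ t) := by
  filter_upwards [ae_hasDensity ρ (isLocal_velocity_iterate m k t 0)] with η h
  simpa only [iterate_shift, velocity_shift, zero_add, meanFlow] using h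

theorem ae_front_density (m k : ℕ) (ρ : unitInterval) (t : ℕ) :
    ∀ᵐ η ∂(initialLaw ρ), HasDensity (fun u => (frontInd ((step m k)^[t] η) u : ℝ))
      (frontDensity m k ρ t) := by
  filter_upwards [ae_hasDensity ρ (isLocal_frontInd_iterate m k t 0)] with η h
  simpa only [iterate_shift, frontInd_shift, zero_add, frontDensity] using h

/-- The probability that the sites of `A` are occupied and those of `B` are empty. -/
theorem integral_pattern (ρ : unitInterval) (A B : Finset ℤ) (hAB : Disjoint A B)
    (P : Road → Prop) (hP : ∀ η, P η ↔ (∀ i ∈ A, η i = true) ∧ ∀ i ∈ B, η i = false) :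
    ∫ η, (ind (P η) : ℝ) ∂(initialLaw ρ) = (ρ : ℝ) ^ A.card * (1 - (ρ : ℝ)) ^ B.card := by
  classical
  let t : ℤ → Set Bool := fun i => if i ∈ A then {true} else {false}
  have hS : ∀ η, P η ↔ η ∈ Set.pi (A ∪ B : Finset ℤ) t := by
    intro η
    rw [hP]
    simp only [Set.mem_pi, Finset.coe_union, Set.mem_union, Finset.mem_coe, t]
    constructor
    · rintro ⟨h1, h2⟩ i hi
      split_ifs with h
      · exact h1 i h
      · exact h2 i (hi.resolve_left h)
    · intro h
      refine ⟨fun i hi => ?_, fun i hi => ?_⟩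
      · simpa [hi] using h i (Or.inl hi)
      · simpa [Finset.disjoint_right.1 hAB hi] using h i (Or.inr hi)
  have hm : MeasurableSet (Set.pi (A ∪ B : Finset ℤ) t) :=
    MeasurableSet.pi (A ∪ B).countable_toSet fun i _ => MeasurableSet.of_discrete
  have e : (fun η => (ind (P η) : ℝ)) = (Set.pi (A ∪ B : Finset ℤ) t).indicator fun _ => (1 : ℝ) := by
    funext η
    by_cases h : P η
    · rw [ind_pos h, Set.indicator_of_mem ((hS η).1 h)]; simp
    · rw [ind_neg h, Set.indicator_of_notMem fun h' => h ((hS η).2 h')]; simp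
  rw [e, integral_indicator_const _ hm, smul_eq_mul, mul_one, measureReal_def]
  unfold initialLaw
  rw [Measure.infinitePi_pi _ fun i _ => MeasurableSet.of_discrete, ENNReal.toReal_prod,
    Finset.prod_union hAB]
  congr 1
  · rw [Finset.prod_congr rfl (g := fun _ => (ρ : ℝ)), Finset.prod_const]
    intro i hi
    simp only [t, hi, if_true]
    rw [← measureReal_def, bernoulliMeasure_real_apply_of_mem_of_notMem] <;> simp
  · rw [Finset.prod_congr rfl (g := fun _ => 1 - (ρ : ℝ)), Finset.prod_const]
    intro i hi
    simp only [t, Finset.disjoint_right.1 hAB hi, if_false]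
    rw [← measureReal_def, bernoulliMeasure_real_apply_of_notMem_of_mem] <;> simp

theorem integral_carRun (ρ : unitInterval) (a : ℕ) :
    ∫ η, (ind (CarRun η a 0) : ℝ) ∂(initialLaw ρ) = (ρ : ℝ) ^ a * (1 - (ρ : ℝ)) := by
  rw [integral_pattern ρ (Finset.Ico (-(a : ℤ)) 0) {0} (by simp)]
  · simp
  · intro η
    simp [CarRun]

theorem integral_holeRun (ρ : unitInterval) (b : ℕ) :
    ∫ η, (ind (HoleRun η b 0) : ℝ) ∂(initialLaw ρ) = (ρ : ℝ) * (1 - (ρ : ℝ)) ^ b := by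
  rw [integral_pattern ρ {-1} (Finset.Ico 0 (b : ℤ)) (by simp)]
  · simp
  · intro η
    simp [HoleRun]

theorem integral_facing (ρ : unitInterval) (b a : ℕ) :
    ∫ η, (ind (Facing η b a 0) : ℝ) ∂(initialLaw ρ) = (ρ : ℝ) ^ a * (1 - (ρ : ℝ)) ^ b := by
  rw [integral_pattern ρ (Finset.Ico 0 (a : ℤ)) (Finset.Ico (-(b : ℤ)) 0)
    (Finset.Ico_disjoint_Ico_consecutive _ _ _).symm]
  · simp
  · intro η
    simp only [Facing, Finset.mem_Ico, and_imp, zero_sub, zero_add]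
    exact and_comm

theorem integral_occ (ρ : unitInterval) (i : ℤ) :
    ∫ η, (occ η i : ℝ) ∂(initialLaw ρ) = ρ := by
  have := integral_pattern ρ {i} ∅ (by simp) (fun η => η i = true) (by simp)
  simp only [Finset.card_singleton, pow_one, Finset.card_empty, pow_zero, mul_one] at this
  rw [← this]
  refine integral_congr_ae (ae_of_all _ fun η => ?_)
  by_cases h : η i = true <;> simp [occ, ind, h]

theorem frontDensity_zero (m k : ℕ) (ρ : unitInterval) :
    frontDensity m k ρ 0 = (ρ : ℝ) * (1 - (ρ : ℝ)) := by
  have := integral_carRun ρ 1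
  rw [pow_one] at this
  rw [← this, frontDensity]
  refine integral_congr_ae (ae_of_all _ fun η => ?_)
  have : IsFront η 0 ↔ CarRun η 1 0 := by
    refine and_congr_left fun _ => ⟨fun h i h1 h2 => ?_, fun h => h _ (by simp) (by simp)⟩
    rw [show i = 0 - 1 by push_cast at h1; omega]; exact h
  change (ind (IsFront η 0) : ℝ) = _
  rw [this]

/-- By translation invariance the two crossing terms in `occ_step` have equal means and cancel. -/
theorem integral_occ_iterate (m k : ℕ) (ρ : unitInterval) (t : ℕ) :
    ∫ η, (occ ((step m k)^[t] η) 0 : ℝ) ∂(initialLaw ρ) = ρ := by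
  induction t with
  | zero => exact integral_occ ρ 0
  | succ t ih =>
    have hc := isLocal_crossings_iterate m k t
    have e : (fun η => (occ ((step m k)^[t + 1] η) 0 : ℝ)) = fun η =>
        ((occ ((step m k)^[t] η) 0 : ℝ) + crossings m k ((step m k)^[t] η) 0) -
          crossings m k ((step m k)^[t] η) 1 := by
      funext η
      rw [Function.iterate_succ_apply', occ_step]
      push_cast; rfl
    have hs := integral_shift ρ 1 (hc 0)
    simp only [iterate_shift, crossings_shift, zero_add] at hs
    have hadd : Integrable (fun η => (occ ((step m k)^[t] η) 0 : ℝ) +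
        crossings m k ((step m k)^[t] η) 0) (initialLaw ρ) :=
      ((isLocal_occ_iterate m k t 0).integrable ρ).add ((hc 0).integrable ρ)
    rw [e, integral_sub hadd ((hc 1).integrable ρ), integral_add ((isLocal_occ_iterate m k t 0).integrable ρ)
      ((hc 0).integrable ρ), ih, hs]
    ring

/-- Mass transport: translate each event that the car at -1-d jumps at least d + 1 sites to the
origin; summing over d gives the velocity there. -/
theorem integral_crossings (m k : ℕ) (ρ : unitInterval) (t : ℕ) :
    ∫ η, (crossings m k ((step m k)^[t] η) 0 : ℝ) ∂(initialLaw ρ) = meanFlow m k ρ t := by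
  have hl : ∀ (d : ℕ) (i : ℤ), IsLocal fun η =>
      if d + 1 ≤ velocity ((step m k)^[t] η) m k i then (1 : ℝ) else 0 := fun d i =>
    ((isLocal_velocity m k i).comp fun v => if d + 1 ≤ v then (1 : ℝ) else 0).iterate m k t
  have e : ∀ d : ℕ, ∫ η, (if d + 1 ≤ velocity ((step m k)^[t] η) m k (0 - 1 - d)
      then (1 : ℝ) else 0) ∂(initialLaw ρ) =
      ∫ η, (if d + 1 ≤ velocity ((step m k)^[t] η) m k 0 then (1 : ℝ) else 0) ∂(initialLaw ρ) := by
    intro d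
    have hs := integral_shift ρ (0 - 1 - d) (hl d 0)
    simpa only [iterate_shift, velocity_shift, zero_add] using hs
  simp only [crossings, Int.cast_sum, Int.cast_ite, Int.cast_one, Int.cast_zero]
  rw [integral_finsetSum _ fun d _ => (hl d _).integrable ρ, Finset.sum_congr rfl fun d _ => e d,
    ← integral_finsetSum _ fun d _ => (hl d _).integrable ρ, meanFlow]
  refine integral_congr_ae (ae_of_all _ fun η => ?_)
  have hv := velocity_le ((step m k)^[t] η) m k 0
  beta_reduce
  rw [← Finset.sum_filter, Finset.sum_const, nsmul_eq_mul, mul_one]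
  congr 1
  rw [show Finset.filter (fun d => d + 1 ≤ velocity ((step m k)^[t] η) m k 0) (Finset.range m) =
    Finset.range (velocity ((step m k)^[t] η) m k 0) by ext d; simp; omega, Finset.card_range]

theorem HasDensity.unbounded {η : Road} {n : ℝ} (hn : 0 < n)
    (h : HasDensity (fun u => (frontInd η u : ℝ)) n) : Unbounded η := by
  obtain ⟨C, hC, hC'⟩ := h (n / 2) (by positivity)
  have hzero : ∀ a b : ℤ, a ≤ b → (∀ z, a ≤ z → z < b → ¬ IsFront η z) →
      isum (fun u => (frontInd η u : ℝ)) b = isum (fun u => (frontInd η u : ℝ)) a := by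
    intro a b hab hno
    rw [← isum_add_sum _ hab, Finset.sum_eq_zero, add_zero]
    intro u hu
    rw [Finset.mem_Ico] at hu
    rw [frontInd, if_neg (hno u hu.1 hu.2)]; simp
  intro N
  constructor
  · by_contra hno
    push Not at hno
    obtain ⟨K, hK⟩ := exists_nat_gt ((isum (fun u => (frontInd η u : ℝ)) N + C) / (n / 2))
    set b : ℤ := N.natAbs + K with hb
    have e := hzero N b (by omega) fun z h1 _ => hno z h1
    have h1 := (abs_le.1 (hC' b)).1
    have hb0 : (0 : ℝ) ≤ b := by exact_mod_cast (by omega : (0 : ℤ) ≤ b)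
    have hbK : (K : ℝ) ≤ b := by exact_mod_cast (by omega : (K : ℤ) ≤ b)
    rw [abs_of_nonneg hb0, e] at h1
    rw [div_lt_iff₀ (by positivity)] at hK
    have := mul_le_mul_of_nonneg_right hbK (show 0 ≤ n / 2 by positivity)
    linarith
  · by_contra hno
    push Not at hno
    obtain ⟨K, hK⟩ := exists_nat_gt ((C - isum (fun u => (frontInd η u : ℝ)) N) / (n / 2))
    set b : ℤ := -(N.natAbs + K) with hb
    have e := hzero b N (by omega) fun z _ h1 => hno z h1.le
    have h1 := (abs_le.1 (hC' b)).2
    have hb0 : (b : ℝ) ≤ 0 := by exact_mod_cast (by omega : b ≤ (0 : ℤ))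
    have hbK : (b : ℝ) ≤ -K := by exact_mod_cast (by omega : b ≤ -(K : ℤ))
    rw [abs_of_nonpos hb0, ← e] at h1
    rw [div_lt_iff₀ (by positivity)] at hK
    have := mul_le_mul_of_nonneg_right hbK (show 0 ≤ n / 2 by positivity)
    linarith

theorem ae_unbounded {ρ : unitInterval} (h0 : 0 < (ρ : ℝ)) (h1 : (ρ : ℝ) < 1) :
    ∀ᵐ η ∂(initialLaw ρ), Unbounded η := by
  filter_upwards [ae_front_density 1 1 ρ 0] with η h
  rw [frontDensity_zero] at h
  exact HasDensity.unbounded (mul_pos h0 (by linarith)) h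

theorem meanFlow_le_left (m k : ℕ) (ρ : unitInterval) (t : ℕ) :
    meanFlow m k ρ t ≤ m * ρ := by
  rw [← integral_occ_iterate m k ρ t, ← integral_const_mul]
  refine integral_mono ((isLocal_velocity_iterate m k t 0).integrable ρ)
    (((isLocal_occ_iterate m k t 0).integrable ρ).const_mul _) fun η => ?_
  beta_reduce
  by_cases h : (step m k)^[t] η 0 = true
  · have := velocity_le ((step m k)^[t] η) m k 0
    simp only [occ, h, if_true, Int.cast_one, mul_one]
    exact_mod_cast this
  · rw [velocity_of_hole _ _ _ _ (by simpa using h)]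
    simp [occ, h]

/-- Both means are almost sure spatial densities, so it suffices to compare them on one typical
state. The other comparisons of means by intervals between fronts use the same device. -/
theorem meanFlow_le_right {m k : ℕ} (hm : 1 ≤ m) (hk : 1 ≤ k) {ρ : unitInterval}
    (h0 : 0 < (ρ : ℝ)) (h1 : (ρ : ℝ) < 1) (t : ℕ) : meanFlow m k ρ t ≤ k * (1 - ρ) := by
  have hl : IsLocal fun η => (k : ℝ) * (1 - occ ((step m k)^[t] η) 0) :=
    (isLocal_occ_iterate m k t 0).comp fun x => (k : ℝ) * (1 - x)
  have hd := ae_hasDensity ρ hl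
  rw [integral_const_mul, integral_sub (integrable_const _)
    ((isLocal_occ_iterate m k t 0).integrable ρ), integral_occ_iterate] at hd
  obtain ⟨η, h2, h3, h4⟩ := (hd.and ((ae_unbounded h0 h1).and (ae_velocity_density m k ρ t))).exists
  simp only [iterate_shift, occ_shift, zero_add] at h2
  have := velocity_density_le (h3.iterate hm hk t) h4 h2
  simpa using this

/-- Every split adds one front. -/
theorem frontDensity_succ {m k : ℕ} (hm : 1 ≤ m) (hk : 1 ≤ k) {ρ : unitInterval}
    (h0 : 0 < (ρ : ℝ)) (h1 : (ρ : ℝ) < 1) (t : ℕ) :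
    frontDensity m k ρ (t + 1) = frontDensity m k ρ t + splitDensity m k ρ t := by
  have hl : IsLocal fun η => (frontInd ((step m k)^[t] η) 0 : ℝ) +
      splitInd m k ((step m k)^[t] η) 0 :=
    (isLocal_frontInd_iterate m k t 0).comp₂ (isLocal_splitInd_iterate m k t 0) (· + ·)
  have hd := ae_hasDensity ρ hl
  rw [integral_add ((isLocal_frontInd_iterate m k t 0).integrable ρ)
    ((isLocal_splitInd_iterate m k t 0).integrable ρ)] at hd
  obtain ⟨η, h2, h3, h4⟩ := (hd.and ((ae_unbounded h0 h1).and
    (ae_front_density m k ρ (t + 1)))).exists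
  simp only [iterate_shift, frontInd_shift, splitInd_shift, zero_add] at h2
  have key : ∀ z o z', Alt ((step m k)^[t] η) z o z' →
      ∑ u ∈ Finset.Ico z z', (frontInd ((step m k)^[t + 1] η) u : ℝ) =
      ∑ u ∈ Finset.Ico z z', ((frontInd ((step m k)^[t] η) u : ℝ) +
        splitInd m k ((step m k)^[t] η) u) := by
    intro z o z' ha
    have := ha.sum_front_step hm hk
    rw [← Function.iterate_succ_apply' (step m k) t η] at this
    have h : ((∑ u ∈ Finset.Ico z z', (frontInd ((step m k)^[t + 1] η) u -
      frontInd ((step m k)^[t] η) u - splitInd m k ((step m k)^[t] η) u) : ℤ) : ℝ) = 0 := by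
      rw [this]; simp
    push_cast at h
    rw [Finset.sum_sub_distrib, Finset.sum_sub_distrib] at h
    rw [Finset.sum_add_distrib]
    linarith
  have hu := h3.iterate hm hk t
  exact le_antisymm (h4.le_of_alt hu h2 fun z o z' ha => (key z o z' ha).le)
    (h2.le_of_alt hu h4 fun z o z' ha => (key z o z' ha).ge)

theorem splitDensity_nonneg (m k : ℕ) (ρ : unitInterval) (t : ℕ) : 0 ≤ splitDensity m k ρ t :=
  integral_nonneg fun η => Int.cast_nonneg (splitInd_nonneg m k ((step m k)^[t] η) 0)

theorem le_splitDensity (m k : ℕ) (ρ : unitInterval) (t : ℕ) :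
    (ρ : ℝ) * (1 - ρ) * ((ρ : ℝ) ^ k * (1 - (ρ : ℝ)) ^ m) ^ (t + 1) ≤ splitDensity m k ρ t := by
  have e : (ρ : ℝ) * (1 - ρ) * ((ρ : ℝ) ^ k * (1 - (ρ : ℝ)) ^ m) ^ (t + 1) =
      (ρ : ℝ) ^ ((t + 1) * k + 1) * (1 - (ρ : ℝ)) ^ ((t + 1) * m + 1) := by ring
  rw [e, ← integral_facing]
  have hl : IsLocal fun η => (ind (Facing η ((t + 1) * m + 1) ((t + 1) * k + 1) 0) : ℝ) :=
    (isLocal_of_window (0 - (((t + 1) * m + 1 : ℕ) : ℤ)) (0 + (((t + 1) * k + 1 : ℕ) : ℤ))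
      fun η η' h => by simp only [facing_congr h])
  refine integral_mono (hl.integrable ρ) ((isLocal_splitInd_iterate m k t 0).integrable ρ)
    fun η => ?_
  beta_reduce
  have := ind_mono (q := IsSplit m k ((step m k)^[t] η) 0)
    (Facing.isSplit_iterate (m := m) (k := k) t (η := η) (o := 0))
  exact_mod_cast this

theorem le_frontDensity {m k : ℕ} (hm : 1 ≤ m) (hk : 1 ≤ k) {ρ : unitInterval}
    (h0 : 0 < (ρ : ℝ)) (h1 : (ρ : ℝ) < 1) (t : ℕ) :
    (ρ : ℝ) * (1 - ρ) * ∑ j ∈ Finset.range (t + 1), ((ρ : ℝ) ^ k * (1 - (ρ : ℝ)) ^ m) ^ j ≤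
      frontDensity m k ρ t := by
  induction t with
  | zero => simp [frontDensity_zero]
  | succ t ih =>
    rw [Finset.sum_range_succ, mul_add, frontDensity_succ hm hk h0 h1]
    exact add_le_add ih (le_splitDensity m k ρ t)

theorem isLocal_carRuns (m k t J : ℕ) (z : ℤ) : IsLocal fun η =>
    ∑ j ∈ Finset.range J, (ind (CarRun ((step m k)^[t] η) (j * k + 1) z) : ℝ) :=
  (isLocal_sum _ fun j _ => (isLocal_carRun (j * k + 1) z).comp (fun x : ℤ => (x : ℝ))).iterate m k t

theorem isLocal_holeRuns (m k t J : ℕ) (z : ℤ) : IsLocal fun η =>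
    ∑ j ∈ Finset.range J, (ind (HoleRun ((step m k)^[t] η) (j * m + 1) z) : ℝ) :=
  (isLocal_sum _ fun j _ => (isLocal_holeRun (j * m + 1) z).comp
    (fun x : ℤ => (x : ℝ))).iterate m k t

theorem integral_carRuns_le {m k : ℕ} (hm : 1 ≤ m) (hk : 1 ≤ k) {ρ : unitInterval}
    (h0 : 0 < (ρ : ℝ)) (h1 : (ρ : ℝ) < 1) (t J : ℕ) :
    ∫ η, ∑ j ∈ Finset.range (J + 1), (ind (CarRun ((step m k)^[t + 1] η) (j * k + 1) 0) : ℝ)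
      ∂(initialLaw ρ) ≤
    ∫ η, ∑ j ∈ Finset.range (J + 2), (ind (CarRun ((step m k)^[t] η) (j * k + 1) 0) : ℝ)
      ∂(initialLaw ρ) := by
  -- The weight is charged to z', which is outside [z, z'); after a translation by one it sits at z'
  -- - 1.
  have hs := integral_shift ρ 1 (isLocal_carRuns m k t (J + 2) 0)
  have hA := ae_hasDensity ρ (isLocal_carRuns m k (t + 1) (J + 1) 0)
  have hB := ae_hasDensity ρ (isLocal_carRuns m k t (J + 2) 1)
  simp only [iterate_shift, carRun_shift, zero_add] at hs hA hB
  rw [← hs]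
  obtain ⟨η, h2, h3, h4⟩ := (hA.and (hB.and (ae_unbounded h0 h1))).exists
  refine h2.le_of_alt (h4.iterate hm hk t) h3 fun z o z' ha => ?_
  have h5 := ha.sum_carRun_le (ha.stepShape hm hk) J
  rw [← Function.iterate_succ_apply' (step m k) t η] at h5
  have h6 : (∑ f ∈ Finset.Ico z z', ∑ j ∈ Finset.range (J + 1),
      (ind (CarRun ((step m k)^[t + 1] η) (j * k + 1) f) : ℝ)) ≤
      ∑ j ∈ Finset.range (J + 2), (ind (CarRun ((step m k)^[t] η) (j * k + 1) z') : ℝ) := by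
    exact_mod_cast h5
  refine h6.trans ?_
  have hl := ha.lt_left
  have hr := ha.lt_right
  have h7 := Finset.single_le_sum (f := fun u : ℤ => ∑ j ∈ Finset.range (J + 2),
    (ind (CarRun ((step m k)^[t] η) (j * k + 1) (1 + u)) : ℝ))
    (fun u _ => Finset.sum_nonneg fun j _ => by exact_mod_cast ind_nonneg _)
    (Finset.mem_Ico.2 (⟨by omega, by omega⟩ : z ≤ z' - 1 ∧ z' - 1 < z'))
  simpa using h7

theorem integral_holeRuns_le {m k : ℕ} (hm : 1 ≤ m) (hk : 1 ≤ k) {ρ : unitInterval}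
    (h0 : 0 < (ρ : ℝ)) (h1 : (ρ : ℝ) < 1) (t J : ℕ) :
    ∫ η, ∑ j ∈ Finset.range (J + 1), (ind (HoleRun ((step m k)^[t + 1] η) (j * m + 1) 0) : ℝ)
      ∂(initialLaw ρ) ≤
    ∫ η, ∑ j ∈ Finset.range (J + 2), (ind (HoleRun ((step m k)^[t] η) (j * m + 1) 0) : ℝ)
      ∂(initialLaw ρ) := by
  have hA := ae_hasDensity ρ (isLocal_holeRuns m k (t + 1) (J + 1) 0)
  have hB := ae_hasDensity ρ (isLocal_holeRuns m k t (J + 2) 0)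
  simp only [iterate_shift, holeRun_shift, zero_add] at hA hB
  obtain ⟨η, h2, h3, h4⟩ := (hA.and (hB.and (ae_unbounded h0 h1))).exists
  refine h2.le_of_alt (h4.iterate hm hk t) h3 fun z o z' ha => ?_
  have h5 := ha.sum_holeRun_le (ha.stepShape hm hk) J
  rw [← Function.iterate_succ_apply' (step m k) t η] at h5
  have h6 : (∑ f ∈ Finset.Ico z z', ∑ j ∈ Finset.range (J + 1),
      (ind (HoleRun ((step m k)^[t + 1] η) (j * m + 1) f) : ℝ)) ≤
      ∑ j ∈ Finset.range (J + 2), (ind (HoleRun ((step m k)^[t] η) (j * m + 1) z) : ℝ) := by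
    exact_mod_cast h5
  refine h6.trans ?_
  have hl := ha.lt_left
  have hr := ha.lt_right
  exact Finset.single_le_sum (f := fun u : ℤ => ∑ j ∈ Finset.range (J + 2),
    (ind (HoleRun ((step m k)^[t] η) (j * m + 1) u) : ℝ))
    (fun u _ => Finset.sum_nonneg fun j _ => by exact_mod_cast ind_nonneg _)
    (Finset.mem_Ico.2 (⟨by omega, by omega⟩ : z ≤ z ∧ z < z'))

/-- The level j = 0 at time t is the front density. Each step back adds one level, ending with
levels 0 to t of the product measure, a geometric sum. -/
theorem frontDensity_le_carRuns {m k : ℕ} (hm : 1 ≤ m) (hk : 1 ≤ k) {ρ : unitInterval}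
    (h0 : 0 < (ρ : ℝ)) (h1 : (ρ : ℝ) < 1) (t : ℕ) :
    frontDensity m k ρ t ≤ (ρ : ℝ) * (1 - ρ) * ∑ j ∈ Finset.range (t + 1), ((ρ : ℝ) ^ k) ^ j := by
  have key : ∀ s J : ℕ, ∫ η, ∑ j ∈ Finset.range (J + 1),
      (ind (CarRun ((step m k)^[s] η) (j * k + 1) 0) : ℝ) ∂(initialLaw ρ) ≤
      ∫ η, ∑ j ∈ Finset.range (s + J + 1), (ind (CarRun η (j * k + 1) 0) : ℝ) ∂(initialLaw ρ) := by
    intro s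
    induction s with
    | zero => intro J; simp
    | succ s ih =>
      intro J
      refine (integral_carRuns_le hm hk h0 h1 s J).trans ((ih (J + 1)).trans_eq ?_)
      rw [show s + (J + 1) + 1 = s + 1 + J + 1 by ring]
  have h2 := key t 0
  rw [integral_finsetSum _ fun j _ =>
    ((isLocal_carRun (j * k + 1) 0).comp (fun x : ℤ => (x : ℝ))).integrable ρ] at h2
  simp only [integral_carRun] at h2
  have e : ∑ j ∈ Finset.range (t + 0 + 1), (ρ : ℝ) ^ (j * k + 1) * (1 - (ρ : ℝ)) =
      (ρ : ℝ) * (1 - ρ) * ∑ j ∈ Finset.range (t + 1), ((ρ : ℝ) ^ k) ^ j := by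
    rw [Finset.mul_sum]
    exact Finset.sum_congr rfl fun j _ => by ring
  rw [e] at h2
  refine le_trans (le_of_eq ?_) h2
  refine integral_congr_ae (ae_of_all _ fun η => ?_)
  beta_reduce
  rw [Finset.sum_range_one]
  have : IsFront ((step m k)^[t] η) 0 ↔ CarRun ((step m k)^[t] η) (0 * k + 1) 0 := by
    refine ⟨fun h => ⟨fun i h1 h2 => ?_, h.2⟩, fun h => h.isFront⟩
    rw [show i = 0 - 1 by push_cast at h1; omega]; exact h.1
  change (ind (IsFront _ 0) : ℝ) = _
  rw [this]

theorem frontDensity_le_holeRuns {m k : ℕ} (hm : 1 ≤ m) (hk : 1 ≤ k) {ρ : unitInterval}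
    (h0 : 0 < (ρ : ℝ)) (h1 : (ρ : ℝ) < 1) (t : ℕ) :
    frontDensity m k ρ t ≤
      (ρ : ℝ) * (1 - ρ) * ∑ j ∈ Finset.range (t + 1), ((1 - (ρ : ℝ)) ^ m) ^ j := by
  have key : ∀ s J : ℕ, ∫ η, ∑ j ∈ Finset.range (J + 1),
      (ind (HoleRun ((step m k)^[s] η) (j * m + 1) 0) : ℝ) ∂(initialLaw ρ) ≤
      ∫ η, ∑ j ∈ Finset.range (s + J + 1), (ind (HoleRun η (j * m + 1) 0) : ℝ) ∂(initialLaw ρ) := by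
    intro s
    induction s with
    | zero => intro J; simp
    | succ s ih =>
      intro J
      refine (integral_holeRuns_le hm hk h0 h1 s J).trans ((ih (J + 1)).trans_eq ?_)
      rw [show s + (J + 1) + 1 = s + 1 + J + 1 by ring]
  have h2 := key t 0
  rw [integral_finsetSum _ fun j _ =>
    ((isLocal_holeRun (j * m + 1) 0).comp (fun x : ℤ => (x : ℝ))).integrable ρ] at h2
  simp only [integral_holeRun] at h2
  have e : ∑ j ∈ Finset.range (t + 0 + 1), (ρ : ℝ) * (1 - (ρ : ℝ)) ^ (j * m + 1) =
      (ρ : ℝ) * (1 - ρ) * ∑ j ∈ Finset.range (t + 1), ((1 - (ρ : ℝ)) ^ m) ^ j := by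
    rw [Finset.mul_sum]
    exact Finset.sum_congr rfl fun j _ => by ring
  rw [e] at h2
  refine le_trans (le_of_eq ?_) h2
  refine integral_congr_ae (ae_of_all _ fun η => ?_)
  beta_reduce
  rw [Finset.sum_range_one]
  have : IsFront ((step m k)^[t] η) 0 ↔ HoleRun ((step m k)^[t] η) (0 * m + 1) 0 := by
    refine ⟨fun h => ⟨h.1, fun i h1 h2 => ?_⟩, fun h => h.isFront⟩
    rw [show i = 0 by push_cast at h2; omega]; exact h.2
  change (ind (IsFront _ 0) : ℝ) = _
  rw [this]

/-! ### From almost sure flux bounds to the mean flow. -/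

/-- Dominated convergence for the positive parts, which are bounded by K and eventually vanish; no
lower bound on f is needed. -/
theorem eventually_integral_le {Ω : Type*} [MeasurableSpace Ω] {μ : Measure Ω}
    [IsProbabilityMeasure μ] {f : ℕ → Ω → ℝ} {K : ℝ} (hK : 0 ≤ K)
    (hf : ∀ T, Integrable (f T) μ) (hle : ∀ T ω, f T ω ≤ K)
    (h : ∀ᵐ ω ∂μ, ∀ᶠ T in atTop, f T ω ≤ 0) {ε : ℝ} (hε : 0 < ε) :
    ∀ᶠ T in atTop, ∫ ω, f T ω ∂μ ≤ ε := by
  have hpos : ∀ T, Integrable (fun ω => max (f T ω) 0) μ := fun T => (hf T).pos_part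
  have hlim : Tendsto (fun T => ∫ ω, max (f T ω) 0 ∂μ) atTop (𝓝 (∫ _, (0 : ℝ) ∂μ)) := by
    refine tendsto_integral_of_dominated_convergence (fun _ => K)
      (fun T => (hpos T).aestronglyMeasurable) (integrable_const K)
      (fun T => ae_of_all _ fun ω => ?_) ?_
    · rw [Real.norm_of_nonneg (le_max_right _ _)]
      exact max_le (hle T ω) hK
    · filter_upwards [h] with ω hω
      refine tendsto_const_nhds.congr' ?_
      filter_upwards [hω] with T hT
      exact (max_eq_right hT).symm
  rw [integral_zero] at hlim
  filter_upwards [hlim.eventually (gt_mem_nhds hε)] with T hT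
  exact (integral_mono (hf T) (hpos T) fun ω => le_max_left _ _).trans hT.le

/-- Bounds on shifted Cesàro means pass to the unshifted ones. -/
theorem eventually_sum_le {a : ℕ → ℝ} {c : ℝ} {s : ℕ}
    (h : ∀ᶠ T : ℕ in atTop, ∑ t ∈ Finset.range T, a (t + s) ≤ c * T) {ε : ℝ} (hε : 0 < ε) :
    ∀ᶠ T : ℕ in atTop, (∑ t ∈ Finset.range T, a t) / (T : ℝ) ≤ c + ε := by
  obtain ⟨T₀, hT₀⟩ := eventually_atTop.1 h
  obtain ⟨K, hK⟩ := exists_nat_gt ((∑ t ∈ Finset.range s, a t - c * s) / ε)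
  filter_upwards [eventually_ge_atTop (T₀ + s + K + 1)] with T hT
  obtain ⟨T', rfl⟩ := Nat.exists_eq_add_of_le (show s ≤ T by omega)
  have h1 := hT₀ T' (by omega)
  rw [div_lt_iff₀ hε] at hK
  have hTK : (K : ℝ) ≤ ((s + T' : ℕ) : ℝ) := by exact_mod_cast (by omega : K ≤ s + T')
  have hT0 : (0 : ℝ) < ((s + T' : ℕ) : ℝ) := by exact_mod_cast (by omega : 0 < s + T')
  rw [div_le_iff₀ hT0, Finset.sum_range_add]
  simp only [add_comm s]
  have h2 := mul_le_mul_of_nonneg_right hTK hε.le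
  push_cast at h2 ⊢
  linarith

/-- Number of cars that cross a bond in `T` steps, from time `s` on. -/
noncomputable def crossingCount (m k s T : ℕ) (η : Road) : ℝ :=
  ∑ t ∈ Finset.range T, (crossings m k ((step m k)^[t + s] η) 0 : ℝ)

theorem neg_label_iterate (m k s T : ℕ) (η : Road) :
    -(label m k ((step m k)^[s] η) T 0 : ℝ) = crossingCount m k s T η := by
  rw [label_zero, crossingCount]
  push_cast
  rw [neg_neg]
  exact Finset.sum_congr rfl fun t _ => by rw [Function.iterate_add_apply]

theorem crossingCount_nonneg (m k s T : ℕ) (η : Road) : 0 ≤ crossingCount m k s T η :=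
  Finset.sum_nonneg fun _ _ => Int.cast_nonneg (crossings_nonneg m k _ 0)

theorem crossingCount_le (m k s T : ℕ) (η : Road) : crossingCount m k s T η ≤ m * T := by
  refine (Finset.sum_le_sum fun _ _ => show _ ≤ (m : ℝ) by
    exact_mod_cast crossings_le m k _ 0).trans_eq ?_
  rw [Finset.sum_const, Finset.card_range, nsmul_eq_mul, mul_comm]

theorem integrable_crossingCount (m k s T : ℕ) (ρ : unitInterval) :
    Integrable (crossingCount m k s T) (initialLaw ρ) :=
  integrable_finsetSum _ fun t _ => (isLocal_crossings_iterate m k (t + s) 0).integrable ρ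

theorem integral_crossingCount (m k s T : ℕ) (ρ : unitInterval) :
    ∫ η, crossingCount m k s T η ∂(initialLaw ρ) =
      ∑ t ∈ Finset.range T, meanFlow m k ρ (t + s) := by
  simp only [crossingCount]
  rw [integral_finsetSum _ fun t _ => (isLocal_crossings_iterate m k (t + s) 0).integrable ρ]
  exact Finset.sum_congr rfl fun t _ => integral_crossings m k ρ (t + s)

/-- Number of splits during `T` steps from time `s` on, within distance `L`. -/
noncomputable def splitCount (m k s T L : ℕ) (η : Road) : ℝ :=
  ∑ t ∈ Finset.range T, ∑ u ∈ Finset.Ico (-(L : ℤ)) (L : ℤ),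
    (splitInd m k ((step m k)^[t + s] η) u : ℝ)

theorem splitCount_nonneg (m k s T L : ℕ) (η : Road) : 0 ≤ splitCount m k s T L η :=
  Finset.sum_nonneg fun _ _ => Finset.sum_nonneg fun _ _ =>
    Int.cast_nonneg (splitInd_nonneg m k _ _)

theorem integrable_splitCount (m k s T L : ℕ) (ρ : unitInterval) :
    Integrable (splitCount m k s T L) (initialLaw ρ) :=
  integrable_finsetSum _ fun t _ => integrable_finsetSum _ fun u _ =>
    (isLocal_splitInd_iterate m k (t + s) u).integrable ρ

theorem sum_splitDensity {m k : ℕ} (hm : 1 ≤ m) (hk : 1 ≤ k) {ρ : unitInterval}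
    (h0 : 0 < (ρ : ℝ)) (h1 : (ρ : ℝ) < 1) (s T : ℕ) :
    ∑ t ∈ Finset.range T, splitDensity m k ρ (t + s) =
      frontDensity m k ρ (T + s) - frontDensity m k ρ s := by
  induction T with
  | zero => simp
  | succ T ih =>
    rw [Finset.sum_range_succ, ih, show T + 1 + s = T + s + 1 by ring,
      frontDensity_succ hm hk h0 h1]
    ring

/-- With L = RT this is at most 2RT times the growth of the front density still to come after time
s. -/
theorem integral_splitCount {m k : ℕ} (hm : 1 ≤ m) (hk : 1 ≤ k) {ρ : unitInterval}
    (h0 : 0 < (ρ : ℝ)) (h1 : (ρ : ℝ) < 1) (s T L : ℕ) :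
    ∫ η, splitCount m k s T L η ∂(initialLaw ρ) =
      2 * L * (frontDensity m k ρ (T + s) - frontDensity m k ρ s) := by
  have hu : ∀ (t : ℕ) (u : ℤ), ∫ η, (splitInd m k ((step m k)^[t] η) u : ℝ) ∂(initialLaw ρ) =
      splitDensity m k ρ t := by
    intro t u
    have hs := integral_shift ρ u (isLocal_splitInd_iterate m k t 0)
    simpa only [iterate_shift, splitInd_shift, zero_add, splitDensity] using hs
  simp only [splitCount]
  rw [integral_finsetSum _ fun t _ => integrable_finsetSum _ fun u _ =>
    (isLocal_splitInd_iterate m k (t + s) u).integrable ρ, ← sum_splitDensity hm hk h0 h1,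
    Finset.mul_sum]
  refine Finset.sum_congr rfl fun t _ => ?_
  rw [integral_finsetSum _ fun u _ => (isLocal_splitInd_iterate m k (t + s) u).integrable ρ]
  simp only [hu]
  rw [Finset.sum_const, Int.card_Ico, nsmul_eq_mul]
  congr 1
  have : (((L : ℤ) - -(L : ℤ)).toNat : ℤ) = 2 * L := by rw [Int.toNat_of_nonneg] <;> omega
  exact_mod_cast this

theorem frontDensity_pos {m k : ℕ} (hm : 1 ≤ m) (hk : 1 ≤ k) {ρ : unitInterval}
    (h0 : 0 < (ρ : ℝ)) (h1 : (ρ : ℝ) < 1) (t : ℕ) : 0 < frontDensity m k ρ t := by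
  induction t with
  | zero =>
    rw [frontDensity_zero]
    exact mul_pos h0 (by linarith)
  | succ t ih =>
    rw [frontDensity_succ hm hk h0 h1]
    linarith [splitDensity_nonneg m k ρ t]

theorem ae_occ_density (m k : ℕ) (ρ : unitInterval) (t : ℕ) :
    ∀ᵐ η ∂(initialLaw ρ), HasDensity (fun u => (occ ((step m k)^[t] η) u : ℝ)) ρ := by
  have h := ae_hasDensity ρ (isLocal_occ_iterate m k t 0)
  rw [integral_occ_iterate] at h
  simpa only [iterate_shift, occ_shift, zero_add] using h

theorem sum_meanFlow_le {m k : ℕ} (hm : 1 ≤ m) (hk : 1 ≤ k) {ρ : unitInterval}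
    (h0 : 0 < (ρ : ℝ)) (h1 : (ρ : ℝ) < 1) (s : ℕ) {ε : ℝ} (hε : 0 < ε) :
    ∀ᶠ T : ℕ in atTop, ∑ t ∈ Finset.range T, meanFlow m k ρ (t + s) ≤
      (ρ * (1 - ρ) / frontDensity m k ρ s + ε) * T := by
  set r := ρ * (1 - ρ) / frontDensity m k ρ s with hr
  have hn := frontDensity_pos hm hk h0 h1 s
  have hr0 : 0 < r := div_pos (mul_pos h0 (by linarith)) hn
  have key := eventually_integral_le (μ := initialLaw ρ)
    (f := fun T η => crossingCount m k s T η / T - (r + ε / 2)) (K := m) (Nat.cast_nonneg m)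
    (fun T => ((integrable_crossingCount m k s T ρ).div_const _).sub (integrable_const _))
    (fun T η => by
      have := div_le_of_le_mul₀ (Nat.cast_nonneg T) (Nat.cast_nonneg m)
        (crossingCount_le m k s T η)
      linarith) (by
      filter_upwards [ae_unbounded h0 h1, ae_occ_density m k ρ s, ae_front_density m k ρ s]
        with η hu ho hf
      obtain ⟨T₀, hT₀⟩ := flux_upper hm hk (hu.iterate hm hk s) h0 h1 hn ho hf (half_pos hε)
      filter_upwards [eventually_ge_atTop T₀] with T hT
      have h2 := hT₀ T hT
      rw [neg_label_iterate] at h2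
      have := div_le_of_le_mul₀ (Nat.cast_nonneg T) (by positivity) h2
      linarith) (half_pos hε)
  filter_upwards [key, eventually_gt_atTop 0] with T hT hT0
  rw [integral_sub ((integrable_crossingCount m k s T ρ).div_const _) (integrable_const _),
    integral_div, integral_crossingCount] at hT
  simp only [integral_const, probReal_univ, one_smul] at hT
  rw [← div_le_iff₀ (by exact_mod_cast hT0)]
  linarith

theorem le_sum_meanFlow {m k : ℕ} (hm : 1 ≤ m) (hk : 1 ≤ k) {ρ : unitInterval}
    (h0 : 0 < (ρ : ℝ)) (h1 : (ρ : ℝ) < 1) {M : ℝ} (hM : 0 ≤ M) (hM1 : M ≤ m * ρ)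
    (hM2 : M ≤ k * (1 - ρ)) {R : ℕ} (hR1 : 4 * m ≤ (ρ : ℝ) * R) (hR2 : 4 * m ≤ (1 - (ρ : ℝ)) * R)
    {s : ℕ} (hM3 : M ≤ ρ * (1 - ρ) / frontDensity m k ρ s) {ε : ℝ} (hε : 0 < ε) :
    ∀ᶠ T : ℕ in atTop, (M - ε - M * (2 * R *
      (frontDensity m k ρ (T + s) - frontDensity m k ρ s))) * T ≤
      ∑ t ∈ Finset.range T, meanFlow m k ρ (t + s) := by
  have hn := frontDensity_pos hm hk h0 h1 s
  have hi : ∀ T : ℕ, Integrable (fun η => (crossingCount m k s T η +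
      M * splitCount m k s T (R * T) η) / (T : ℝ)) (initialLaw ρ) := fun T =>
    ((integrable_crossingCount m k s T ρ).add
      ((integrable_splitCount m k s T (R * T) ρ).const_mul M)).div_const _
  have key := eventually_integral_le (μ := initialLaw ρ)
    (f := fun T η => (M - ε / 2) - (crossingCount m k s T η +
      M * splitCount m k s T (R * T) η) / T) (K := M) hM
    (fun T => (integrable_const _).sub (hi T))
    (fun T η => by
      have h2 := crossingCount_nonneg m k s T η
      have h3 := splitCount_nonneg m k s T (R * T) η
      have : 0 ≤ (crossingCount m k s T η + M * splitCount m k s T (R * T) η) / T := by positivity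
      linarith) (by
      filter_upwards [ae_unbounded h0 h1, ae_occ_density m k ρ s, ae_front_density m k ρ s]
        with η hu ho hf
      obtain ⟨T₀, hT₀⟩ := flux_lower hm hk (hu.iterate hm hk s) h0 h1 hn ho hf hM hM1 hM2 hM3
        hR1 hR2 (half_pos hε)
      filter_upwards [eventually_ge_atTop T₀, eventually_gt_atTop 0] with T hT hT0
      have h2 := hT₀ T hT
      rw [neg_label_iterate] at h2
      simp only [← Function.iterate_add_apply] at h2
      have h3 := (le_div_iff₀ (by exact_mod_cast hT0)).2 h2
      exact sub_nonpos.2 h3) (half_pos hε)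
  filter_upwards [key, eventually_gt_atTop 0] with T hT hT0
  have hT0' : (0 : ℝ) < T := by exact_mod_cast hT0
  rw [integral_sub (integrable_const _) (hi T), integral_div,
    integral_add (integrable_crossingCount m k s T ρ)
      ((integrable_splitCount m k s T (R * T) ρ).const_mul M), integral_const_mul,
    integral_crossingCount, integral_splitCount hm hk h0 h1] at hT
  simp only [integral_const, probReal_univ, one_smul] at hT
  have h2 : M - ε ≤ (∑ t ∈ Finset.range T, meanFlow m k ρ (t + s) + M * (2 * ((R * T : ℕ) : ℝ) *
      (frontDensity m k ρ (T + s) - frontDensity m k ρ s))) / T := by linarith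
  rw [le_div_iff₀ hT0'] at h2
  push_cast at h2
  linarith

/-! ### The limiting front density and the limit of the mean flow. -/

/-- The front density increases to a limit, between explicit bounds. -/
theorem exists_frontDensity_limit {m k : ℕ} (hm : 1 ≤ m) (hk : 1 ≤ k) {ρ : unitInterval}
    (h0 : 0 < (ρ : ℝ)) (h1 : (ρ : ℝ) < 1) :
    ∃ n : ℝ, 0 < n ∧ Tendsto (frontDensity m k ρ) atTop (𝓝 n) ∧ (∀ t, frontDensity m k ρ t ≤ n) ∧
      (ρ : ℝ) * (1 - ρ) ≤ (1 - (ρ : ℝ) ^ k * (1 - (ρ : ℝ)) ^ m) * n ∧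
      (1 - (ρ : ℝ) ^ k) * n ≤ ρ * (1 - ρ) ∧ (1 - (1 - (ρ : ℝ)) ^ m) * n ≤ ρ * (1 - ρ) := by
  have h1' : 0 < 1 - (ρ : ℝ) := by linarith
  have hpos : 0 < (ρ : ℝ) * (1 - ρ) := mul_pos h0 h1'
  have hx0 : 0 ≤ (ρ : ℝ) ^ k := by positivity
  have hx1 : (ρ : ℝ) ^ k < 1 := pow_lt_one₀ h0.le h1 (by omega)
  have hy0 : 0 ≤ (1 - (ρ : ℝ)) ^ m := by positivity
  have hy1 : (1 - (ρ : ℝ)) ^ m < 1 := pow_lt_one₀ h1'.le (by linarith) (by omega)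
  have hgeom : ∀ (x : ℝ) (t : ℕ), 0 ≤ x → x < 1 →
      frontDensity m k ρ t ≤ (ρ : ℝ) * (1 - ρ) * ∑ j ∈ Finset.range (t + 1), x ^ j →
      (1 - x) * frontDensity m k ρ t ≤ ρ * (1 - ρ) := by
    intro x t hx hx' h
    have h2 := mul_le_mul_of_nonneg_left h (sub_nonneg.2 hx'.le)
    have h3 := mul_neg_geom_sum x (t + 1)
    have h4 : 0 ≤ (ρ : ℝ) * (1 - ρ) * x ^ (t + 1) := by positivity
    have h5 : (1 - x) * ((ρ : ℝ) * (1 - ρ) * ∑ j ∈ Finset.range (t + 1), x ^ j) =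
        (ρ : ℝ) * (1 - ρ) * (1 - x ^ (t + 1)) := by rw [← h3]; ring
    linarith
  have hA := fun t => hgeom _ t hx0 hx1 (frontDensity_le_carRuns hm hk h0 h1 t)
  have hB := fun t => hgeom _ t hy0 hy1 (frontDensity_le_holeRuns hm hk h0 h1 t)
  have hmono : Monotone (frontDensity m k ρ) := monotone_nat_of_le_succ fun t => by
    rw [frontDensity_succ hm hk h0 h1]
    linarith [splitDensity_nonneg m k ρ t]
  have hbdd : BddAbove (Set.range (frontDensity m k ρ)) := by
    refine ⟨ρ * (1 - ρ) / (1 - (ρ : ℝ) ^ k), ?_⟩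
    rintro _ ⟨t, rfl⟩
    rw [le_div_iff₀ (by linarith), mul_comm]
    exact hA t
  have hlim := tendsto_atTop_ciSup hmono hbdd
  have hle := fun t => le_ciSup hbdd t
  refine ⟨_, (frontDensity_pos hm hk h0 h1 0).trans_le (hle 0), hlim, hle, ?_,
    le_of_tendsto' (hlim.const_mul _) hA, le_of_tendsto' (hlim.const_mul _) hB⟩
  have hxy : (ρ : ℝ) ^ k * (1 - (ρ : ℝ)) ^ m < 1 := mul_lt_one_of_nonneg_of_lt_one_left hx0 hx1 hy1.le
  have hz : Tendsto (fun t : ℕ => (ρ : ℝ) * (1 - ρ) *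
      (1 - ((ρ : ℝ) ^ k * (1 - (ρ : ℝ)) ^ m) ^ (t + 1))) atTop
      (𝓝 ((ρ : ℝ) * (1 - ρ) * (1 - 0))) :=
    (tendsto_const_nhds.sub ((tendsto_pow_atTop_nhds_zero_of_lt_one (mul_nonneg hx0 hy0) hxy).comp
      (tendsto_add_atTop_nat 1))).const_mul _
  rw [sub_zero, mul_one] at hz
  refine le_of_tendsto' hz fun t => ?_
  rw [← mul_neg_geom_sum]
  have h2 := mul_le_mul_of_nonneg_left ((le_frontDensity hm hk h0 h1 t).trans (hle t))
    (sub_nonneg.2 hxy.le)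
  linarith

/-- The flux bounds are started at a late time s: then ρ(1-ρ)/n_s is close to ρ(1-ρ)/n, and the loss
from splits is below ε/3. The first s steps do not affect Cesàro limits. -/
theorem tendsto_meanFlow {m k : ℕ} (hm : 1 ≤ m) (hk : 1 ≤ k) {ρ : unitInterval}
    (h0 : 0 < (ρ : ℝ)) (h1 : (ρ : ℝ) < 1) {n : ℝ} (hn : 0 < n)
    (hlim : Tendsto (frontDensity m k ρ) atTop (𝓝 n)) (hle : ∀ t, frontDensity m k ρ t ≤ n) :
    Tendsto (fun T : ℕ => (∑ t ∈ Finset.range T, meanFlow m k ρ t) / (T : ℝ)) atTop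
      (𝓝 (min (m * ρ) (min (ρ * (1 - ρ) / n) (k * (1 - ρ))))) := by
  have h1' : 0 < 1 - (ρ : ℝ) := by linarith
  set M : ℝ := min (m * ρ) (min (ρ * (1 - ρ) / n) (k * (1 - ρ))) with hMdef
  have hM : 0 ≤ M := le_min (by positivity) (le_min (by positivity) (by positivity))
  have hM1 : M ≤ m * ρ := min_le_left _ _
  have hM3 : M ≤ ρ * (1 - ρ) / n := (min_le_right _ _).trans (min_le_left _ _)
  have hM2 : M ≤ k * (1 - ρ) := (min_le_right _ _).trans (min_le_right _ _)
  have hconst : ∀ c : ℝ, (∀ t, meanFlow m k ρ t ≤ c) →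
      ∀ T : ℕ, 0 < T → (∑ t ∈ Finset.range T, meanFlow m k ρ t) / (T : ℝ) ≤ c := by
    intro c hc T hT
    rw [div_le_iff₀ (by exact_mod_cast hT)]
    refine (Finset.sum_le_sum fun t _ => hc t).trans_eq ?_
    rw [Finset.sum_const, Finset.card_range, nsmul_eq_mul, mul_comm]
  have hupper : ∀ ε : ℝ, 0 < ε →
      ∀ᶠ T : ℕ in atTop, (∑ t ∈ Finset.range T, meanFlow m k ρ t) / (T : ℝ) ≤ M + ε := by
    intro ε hε
    have hr : Tendsto (fun s => ρ * (1 - ρ) / frontDensity m k ρ s) atTop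
        (𝓝 ((ρ : ℝ) * (1 - ρ) / n)) := tendsto_const_nhds.div hlim hn.ne'
    obtain ⟨s, hs⟩ := (hr.eventually (gt_mem_nhds
      (show (ρ : ℝ) * (1 - ρ) / n < ρ * (1 - ρ) / n + ε / 3 by linarith))).exists
    filter_upwards [eventually_sum_le (sum_meanFlow_le hm hk h0 h1 s (ε := ε / 3) (by positivity))
      (show 0 < ε / 3 by positivity), eventually_gt_atTop 0] with T hT hT0
    rw [← sub_le_iff_le_add]
    refine le_min ?_ (le_min ?_ ?_)
    · linarith [hconst _ (meanFlow_le_left m k ρ) T hT0]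
    · linarith
    · linarith [hconst _ (meanFlow_le_right hm hk h0 h1) T hT0]
  have hlower : ∀ ε : ℝ, 0 < ε →
      ∀ᶠ T : ℕ in atTop, M - ε ≤ (∑ t ∈ Finset.range T, meanFlow m k ρ t) / (T : ℝ) := by
    intro ε hε
    obtain ⟨R₁, hR₁⟩ := exists_nat_gt (4 * m / (ρ : ℝ))
    obtain ⟨R₂, hR₂⟩ := exists_nat_gt (4 * m / (1 - (ρ : ℝ)))
    rw [div_lt_iff₀' h0] at hR₁
    rw [div_lt_iff₀' h1'] at hR₂
    have hR1 : 4 * m ≤ (ρ : ℝ) * (R₁ + R₂ : ℕ) := by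
      refine hR₁.le.trans (mul_le_mul_of_nonneg_left ?_ h0.le)
      exact_mod_cast Nat.le_add_right _ _
    have hR2 : 4 * m ≤ (1 - (ρ : ℝ)) * (R₁ + R₂ : ℕ) := by
      refine hR₂.le.trans (mul_le_mul_of_nonneg_left ?_ h1'.le)
      exact_mod_cast Nat.le_add_left _ _
    set R := R₁ + R₂
    have hd : Tendsto (fun s => M * (2 * R * (n - frontDensity m k ρ s))) atTop
        (𝓝 (M * (2 * R * (n - n)))) := ((hlim.const_sub n).const_mul _).const_mul _
    rw [sub_self, mul_zero, mul_zero] at hd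
    obtain ⟨s, hs⟩ := (hd.eventually (gt_mem_nhds (show 0 < ε / 3 by positivity))).exists
    have hM3' : M ≤ ρ * (1 - ρ) / frontDensity m k ρ s :=
      hM3.trans (div_le_div_of_nonneg_left (by positivity) (frontDensity_pos hm hk h0 h1 s) (hle s))
    have h2 : ∀ᶠ T : ℕ in atTop, ∑ t ∈ Finset.range T, -meanFlow m k ρ (t + s) ≤
        -(M - ε / 3 - ε / 3) * T := by
      filter_upwards [le_sum_meanFlow hm hk h0 h1 hM hM1 hM2 hR1 hR2 hM3'
        (show 0 < ε / 3 by positivity)] with T hT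
      have h3 : M * (2 * R * (frontDensity m k ρ (T + s) - frontDensity m k ρ s)) ≤
          M * (2 * R * (n - frontDensity m k ρ s)) := by
        have := hle (T + s)
        gcongr
      have h4 := mul_le_mul_of_nonneg_right (h3.trans hs.le) (Nat.cast_nonneg (α := ℝ) T)
      rw [Finset.sum_neg_distrib]
      linarith
    filter_upwards [eventually_sum_le (a := fun t => -meanFlow m k ρ t) h2
      (show 0 < ε / 3 by positivity)] with T hT
    rw [Finset.sum_neg_distrib, neg_div] at hT
    linarith
  rw [Metric.tendsto_atTop']
  intro ε hε
  obtain ⟨N, hN⟩ := eventually_atTop.1 ((hupper (ε / 2) (by positivity)).and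
    (hlower (ε / 2) (by positivity)))
  refine ⟨N, fun T hT => ?_⟩
  rw [Real.dist_eq, abs_lt]
  constructor <;> linarith [hN T hT.le]

/-! ### Spatial flow of a state, and the densities zero and one. -/

theorem HasDensity.hasFlow {m k : ℕ} {η : Road} {J : ℝ}
    (h : HasDensity (fun u => (velocity η m k u : ℝ)) J) : HasFlow m k η J := by
  unfold HasFlow
  rw [Metric.tendsto_atTop]
  intro ε hε
  obtain ⟨C, hC, hC'⟩ := h (ε / 2) (by positivity)
  obtain ⟨N₀, hN₀⟩ := exists_nat_gt (4 * C / ε)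
  refine ⟨N₀, fun N hN => ?_⟩
  rw [div_lt_iff₀ hε] at hN₀
  have hN' : (N₀ : ℝ) ≤ N := by exact_mod_cast hN
  have hN0 : (0 : ℝ) < 2 * N + 1 := by positivity
  have hI : Finset.Icc (-(N : ℤ)) (N : ℤ) = Finset.Ico (-(N : ℤ)) ((N : ℤ) + 1) := by
    ext i; simp only [Finset.mem_Icc, Finset.mem_Ico]; omega
  have e := isum_add_sum (fun u => (velocity η m k u : ℝ))
    (show -(N : ℤ) ≤ (N : ℤ) + 1 by omega)
  have h1 := hC' ((N : ℤ) + 1)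
  have h2 := hC' (-(N : ℤ))
  push_cast at h1 h2
  rw [abs_neg, abs_of_nonneg (Nat.cast_nonneg (α := ℝ) N)] at h2
  rw [abs_of_nonneg (show (0 : ℝ) ≤ N + 1 by positivity)] at h1
  have h1' := abs_le.1 h1
  have h2' := abs_le.1 h2
  have hmul := mul_le_mul_of_nonneg_right hN' hε.le
  rw [hI, Real.dist_eq, abs_lt, lt_sub_iff_add_lt, sub_lt_iff_lt_add, lt_div_iff₀ hN0,
    div_lt_iff₀ hN0]
  constructor <;> linarith [h1'.1, h1'.2, h2'.1, h2'.2]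

theorem step_eq_self_of_velocity {m k : ℕ} {η : Road} (h : ∀ i, velocity η m k i = 0) :
    step m k η = η := by
  funext i
  simp [step, h]

theorem hasSteadyStateFlow_of_velocity {m k : ℕ} {η : Road} (h : ∀ i, velocity η m k i = 0) :
    HasSteadyStateFlow m k η 0 := by
  refine ⟨fun _ => 0, fun t => ?_, by simp⟩
  rw [Function.iterate_fixed (step_eq_self_of_velocity h)]
  simp [HasFlow, h]

theorem velocity_of_all_cars {η : Road} (h : ∀ i, η i = true) (m k : ℕ) (i : ℤ) :
    velocity η m k i = 0 := by
  induction k generalizing i with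
  | zero => rfl
  | succ k ih => simp [velocity, h, ih]

theorem ae_eq_of_zero {ρ : unitInterval} (h : (ρ : ℝ) = 0) :
    ∀ᵐ η ∂(initialLaw ρ), η = fun _ => false := by
  obtain rfl : ρ = 0 := Subtype.ext h
  simp [initialLaw, ae_dirac_eq]

theorem ae_eq_of_one {ρ : unitInterval} (h : (ρ : ℝ) = 1) :
    ∀ᵐ η ∂(initialLaw ρ), η = fun _ => true := by
  obtain rfl : ρ = 1 := Subtype.ext h
  simp [initialLaw, ae_dirac_eq]

end TrafficRule

theorem mainTheorem5 (m k : ℕ) (hm : 1 ≤ m) (hk : 1 ≤ k) (ρ : unitInterval) :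
    ∃ φ : ℝ,
      (∀ᵐ η ∂(TrafficRule.initialLaw ρ), TrafficRule.HasSteadyStateFlow m k η φ) ∧
      φ ≤ min (m * (ρ : ℝ)) (min 1 (k * (1 - (ρ : ℝ)))) ∧
      φ ≤ min (m * (ρ : ℝ)) (min (1 - (ρ : ℝ) ^ k * (1 - (ρ : ℝ)) ^ m) (k * (1 - (ρ : ℝ)))) ∧
      min (m * (ρ : ℝ))
        (min (max (1 - (ρ : ℝ) ^ k) (1 - (1 - (ρ : ℝ)) ^ m)) (k * (1 - (ρ : ℝ)))) ≤ φ := by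
  have hm0 : m ≠ 0 := by omega
  have hk0 : k ≠ 0 := by omega
  -- For ρ = 0 or ρ = 1 there are almost surely no fronts and nothing moves, so φ = 0 is checked
  -- directly.
  rcases ρ.2.1.eq_or_lt with h0 | h0
  · refine ⟨0, ?_, ?_⟩
    · filter_upwards [TrafficRule.ae_eq_of_zero h0.symm] with η hη
      exact TrafficRule.hasSteadyStateFlow_of_velocity fun i =>
        TrafficRule.velocity_of_hole _ _ _ _ (by rw [hη])
    · simp [← h0, hk0]
  rcases ρ.2.2.eq_or_lt with h1 | h1
  · refine ⟨0, ?_, ?_⟩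
    · filter_upwards [TrafficRule.ae_eq_of_one h1] with η hη
      exact TrafficRule.hasSteadyStateFlow_of_velocity
        (TrafficRule.velocity_of_all_cars (fun i => by rw [hη]) m k)
    · simp [h1, hm0]
  obtain ⟨n, hn, hlim, hle, hA, hB, hC⟩ := TrafficRule.exists_frontDensity_limit hm hk h0 h1
  -- All three claims differ from φ only in the middle entry of the minimum, so they reduce to
  -- bounds for ρ(1-ρ)/n.
  have hr : (ρ : ℝ) * (1 - ρ) / n ≤ 1 - (ρ : ℝ) ^ k * (1 - (ρ : ℝ)) ^ m := (div_le_iff₀ hn).2 hA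
  have hxy : 0 ≤ (ρ : ℝ) ^ k * (1 - (ρ : ℝ)) ^ m :=
    mul_nonneg (pow_nonneg h0.le _) (pow_nonneg (by linarith) _)
  refine ⟨_, ?_, min_le_min_left _ (min_le_min_right _ (hr.trans (by linarith))),
    min_le_min_left _ (min_le_min_right _ hr), min_le_min_left _ (min_le_min_right _
      (max_le ((le_div_iff₀ hn).2 hB) ((le_div_iff₀ hn).2 hC)))⟩
  filter_upwards [ae_all_iff.2 fun t => TrafficRule.ae_velocity_density m k ρ t] with η hη
  exact ⟨TrafficRule.meanFlow m k ρ, fun t => (hη t).hasFlow,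
    TrafficRule.tendsto_meanFlow hm hk h0 h1 hn hlim hle⟩
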